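/- Let $\Sigma\subset\mathbb R^3$ be a compact embedded disk, smooth up to its boundary, with unit normal $N$, principal curvatures $k_1,k_2$, mean curvature $H=k_1+k_2$ and $|A|^2=k_1^2+k_2^2$. Write $d_\Sigma$ for the intrinsic distance of $\Sigma$ and $\mathcal B_l(x)=\{y\in\Sigma : d_\Sigma(x,y)<l\}$ for the geodesic ball. A domain $\Omega\subset\Sigma$ is called $\delta$-stable if $(1-\delta)\int_\Omega|A|^2\phi^2\le\int_\Omega|\nabla\phi|^2$ for all $\phi\in C_0^\infty(\Omega)$. For $C>0$ and $\bar l>1$ let $\mathcal F(C,\bar l)$ be the class of such disks $\Sigma$ that have constant mean curvature and satisfy $0\in\Sigma\subset \overline{B_{\bar l}(0)}$, $\partial\Sigma\subset\partial B_{\bar l}(0)$ and $\sup_{\Sigma\cap B_{\bar l}(0)}|A|^2\le 4C^2=4|A|^2(0)$. Let $\Sigma^1$ be the connected component of $\Sigma\cap B_1(0)$ that contains $0$. Let $C>0$, $\bar l>1$, $\bar\epsilon>0$. For each $0<l<\bar l-(1+\bar\epsilon)$ there exists $C_l>0$ such that for each $\delta>0$ there exists $\alpha_{l,\delta}>0$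 with the following property. (The constants may depend on $C,\bar l,\bar\epsilon$; $C_l$ does not depend on $\delta$; neither depends on $\Sigma$.) Let $\Sigma\in\mathcal F(C,\bar l)$, $\alpha<\alpha_{l,\delta}$ and $x,y\in\Sigma^1$ with $|x-y|\le\alpha$, $d_\Sigma(x,y)\ge C_l$ and $\langle N(x),N(y)\rangle>0$. Then $\mathcal B_l(x)$ is $\delta$-stable. -/

import Mathlib

open Set Metric MeasureTheory
open scoped ContDiff Matrix ENNReal

noncomputable section

namespace CMCDisk

/-- The parameter plane `ℝ²`. -/
abbrev Plane := EuclideanSpace ℝ (Fin 2)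

/-- The ambient Euclidean space `ℝ³`. -/
abbrev Space := EuclideanSpace ℝ (Fin 3)

/-- The closed unit disk of the parameter plane. -/
def disk : Set Plane := closedBall 0 1

/-- The unit circle, boundary of the parameter disk. -/
def circle : Set Plane := sphere 0 1

/-- `F` restricted to the closed unit disk parametrizes a compact embedded disk `Σ = F(disk)` in
`ℝ³`, smooth up to its boundary `∂Σ = F(circle)`: an injective immersion of the closed unit disk.
(A map that is smooth on the closed disk up to the boundary extends smoothly to the plane; the
values of `F` outside the closed disk play no role.) -/
structure IsEmbeddedDisk (F : Plane → Space) : Prop where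
  smooth : ContDiff ℝ ∞ F
  injOn : InjOn F disk
  immersion : ∀ p ∈ disk, Function.Injective (fderiv ℝ F p)

/-- The partial derivative `∂ᵢ f` of a map on the plane. -/
def pd {E : Type*} [NormedAddCommGroup E] [NormedSpace ℝ E] (i : Fin 2) (f : Plane → E)
    (p : Plane) : E :=
  fderiv ℝ f p (EuclideanSpace.single i 1)

/-- The cross product in `ℝ³`. -/
def cross (v w : Space) : Space :=
  WithLp.toLp 2 (crossProduct (WithLp.ofLp v) (WithLp.ofLp w))

/-- The unit normal `N` of the surface at the point with parameter `p`. -/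
def unitNormal (F : Plane → Space) (p : Plane) : Space :=
  ‖cross (pd 0 F p) (pd 1 F p)‖⁻¹ • cross (pd 0 F p) (pd 1 F p)

/-- The first fundamental form `gᵢⱼ = ⟨∂ᵢF, ∂ⱼF⟩`. -/
def firstForm (F : Plane → Space) (p : Plane) : Matrix (Fin 2) (Fin 2) ℝ :=
  Matrix.of fun i j => inner ℝ (pd i F p) (pd j F p)

/-- The second fundamental form `bᵢⱼ = ⟨∂ᵢ∂ⱼF, N⟩`. -/
def secondForm (F : Plane → Space) (p : Plane) : Matrix (Fin 2) (Fin 2) ℝ :=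
  Matrix.of fun i j => inner ℝ (pd i (pd j F) p) (unitNormal F p)

/-- The matrix `g⁻¹ b` of the shape operator; its eigenvalues are the principal curvatures
`k₁, k₂`. -/
def shapeOperator (F : Plane → Space) (p : Plane) : Matrix (Fin 2) (Fin 2) ℝ :=
  (firstForm F p)⁻¹ * secondForm F p

/-- The mean curvature `H = k₁ + k₂`. -/
def meanCurvature (F : Plane → Space) (p : Plane) : ℝ :=
  (shapeOperator F p).trace

/-- The squared norm `|A|² = k₁² + k₂²` of the second fundamental form. -/
def normSqA (F : Plane → Space) (p : Plane) : ℝ :=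
  (shapeOperator F p * shapeOperator F p).trace

/-- The area density `√(det g)`, so that `d area = √(det g) dp`. -/
def areaDensity (F : Plane → Space) (p : Plane) : ℝ :=
  √(firstForm F p).det

/-- The squared length `|∇φ|² = gⁱʲ ∂ᵢφ ∂ⱼφ` of the intrinsic gradient of a function `φ` on the
surface, written in the parameter. -/
def gradNormSq (F : Plane → Space) (φ : Plane → ℝ) (p : Plane) : ℝ :=
  (fun i => pd i φ p) ⬝ᵥ ((firstForm F p)⁻¹ *ᵥ fun i => pd i φ p)

/-- The integral `∫_Σ f d area`, where `f` is a function on the surface written in the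
parameter. -/
def surfaceIntegral (F : Plane → Space) (f : Plane → ℝ) : ℝ :=
  ∫ p in disk, f p * areaDensity F p

/-- The intrinsic distance `dist_Σ` between the points of `Σ` with parameters `p` and `q`: the
infimum of the lengths of the `C¹` curves `F ∘ γ` in `Σ` that join them. -/
def intrinsicDist (F : Plane → Space) (p q : Plane) : ℝ≥0∞ :=
  ⨅ (γ : ℝ → Plane) (_ : ContDiff ℝ 1 γ) (_ : ∀ t ∈ Icc (0 : ℝ) 1, γ t ∈ disk)
    (_ : γ 0 = p) (_ : γ 1 = q), ∫⁻ t in Icc (0 : ℝ) 1, ‖deriv (fun s => F (γ s)) t‖ₑ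

/-- The (open) geodesic ball `𝓑_r` of `Σ` centred at the point with parameter `p`, as a set of
parameters. -/
def geodesicBall (F : Plane → Space) (p : Plane) (r : ℝ) : Set Plane :=
  {q ∈ disk | intrinsicDist F p q < ENNReal.ofReal r}

/-- `δ`-stability of the domain of `Σ` with parameter set `Ω ⊆ disk`:
`(1 - δ) ∫ |A|² φ² ≤ ∫ |∇φ|²` for all smooth `φ` with compact support in `Ω`. -/
def IsDeltaStable (F : Plane → Space) (Ω : Set Plane) (δ : ℝ) : Prop :=
  ∀ φ : Plane → ℝ, ContDiff ℝ ∞ φ → HasCompactSupport φ → tsupport φ ⊆ Ω →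
    (1 - δ) * surfaceIntegral F (fun p => normSqA F p * φ p ^ 2) ≤
      surfaceIntegral F (gradNormSq F φ)

/-- `Σ = F(disk)` is an embedded disk of constant mean curvature `h` with
`0 ∈ Σ ⊆ B_L(0)`, `∂Σ ⊆ ∂B_L(0)` and `sup_{Σ ∩ B_L(0)} |A|² ≤ 4C² = 4|A|²(0)`.
As `Σ` contains its boundary, the ball that contains `Σ` is the closed one. -/
structure IsAdmissible (F : Plane → Space) (h C L : ℝ) : Prop where
  embedded : IsEmbeddedDisk F
  cmc : ∀ p ∈ disk, meanCurvature F p = h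
  zero_mem : (0 : Space) ∈ F '' disk
  subset_ball : F '' disk ⊆ closedBall 0 L
  boundary : F '' circle ⊆ sphere 0 L
  curvature_le : ∀ p ∈ disk, F p ∈ ball (0 : Space) L → normSqA F p ≤ 4 * C ^ 2
  curvature_zero : ∀ p ∈ disk, F p = 0 → normSqA F p = C ^ 2

/-- `Σ¹`: the connected component of `Σ ∩ B_1(0)` that contains `0`. -/
def unitComponent (F : Plane → Space) : Set Space :=
  connectedComponentIn (F '' disk ∩ ball 0 1) 0

end CMCDisk

end

/-!
Two nearby points `x, y` of `Σ` that are far apart in `Σ` lie on different local sheets. If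
`⟨N(x), N(y)⟩ > 0`, embeddedness forces these sheets to be nearly parallel, and both have the same
constant mean curvature, so that their difference over a common plane satisfies an elliptic
inequality without a term of order zero. By a quantitative form of the strong maximum principle the
sheet through `y` then stays close to the sheet through `x`, on one side of it, over the whole
geodesic ball `𝓑_l(x)`. As in the classical argument that a positive Jacobi function implies
stability, the height `u` of the neighbouring sheet makes `𝓑_l(x)` almost stable.

*Charts.* The bound on `|A|²` makes `Σ`, at distance `ρ` from the boundary sphere, a graph of small
slope over disks of a uniform radius `r` in planes close to the tangent plane (`exists_chart`). The
chart is obtained by lifting rays through the orthogonal projection, which is a local diffeomorphism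
as long as the tilt is small. Since `Σ` is embedded, two charts over the same disk either have the
same base point or are disjoint (`IsChart.base_eq_of_meet`).

*Nearly parallel sheets.* If the tangent planes at two nearby points of different sheets made a
definite angle, the sheets would cross (`exists_tilt_bound`). Otherwise both sheets are graphs over
the same disk, and the difference `v` of the heights has a sign and satisfies
`|v₁₁ + v₂₂ + …| ≤ K |∇v|` (`isSheetGap_height`). A comparison with the Hopf barrier
`c exp (-λ |ξ - y|²)` shows that `v` is small near a point where it is small
(`exists_gap_lower_bound`). A bounded number of such steps along curves of length less than `l`
provides every point of `𝓑_l(x)` with a sheet, on a fixed side and at small height on its normal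
line (`exists_sheets_over_geodesicBall`). The number of steps does not depend on `δ`, only the
height that is reached does, and so `C_l = 4 r` is independent of `δ`.

*The height function.* Over each point the sheet closest to it is chosen. As a limit of sheets is a
sheet, this choice is attained, and by the implicit function theorem its height `u` and its
parameter `ψ` are smooth (`IsLowestSheet.exists_contDiffAt`). In this way `u` is defined on the whole
ball, although the continuation of a sheet along curves may depend on the curve.

*Stability.* Let `G = F ∘ ψ = F + u N` and `N₂ = N ∘ ψ`. The one-form `⟨N, dG × N₂⟩` takes the part
of `*du` in the classical argument. In its exterior derivative the second derivatives of `G` cancel,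
and the derivative of `N₂` enters only through the mean curvature (`fderiv_sheetForm_sub`), which is
the same for both sheets. For a test function `φ`, the exterior derivative of `(φ² / u) ⟨N, dG × N₂⟩` integrates to zero, and in a
principal frame Young's inequality bounds `(1 - 9τ) |A|² φ² - |∇φ|²` by a multiple of it
(`young_stability`, `stability_integrand_le`), where `τ` measures the height and the tilt of the
sheet. Integration gives `9τ`-stability.
-/

noncomputable section

namespace CMCDisk

/-! ### Cross product and orthonormal frames in space -/

theorem cross_apply_zero (v w : Space) : cross v w 0 = v 1 * w 2 - v 2 * w 1 := by
  simp [cross, crossProduct]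

theorem cross_apply_one (v w : Space) : cross v w 1 = v 2 * w 0 - v 0 * w 2 := by
  simp [cross, crossProduct]

theorem cross_apply_two (v w : Space) : cross v w 2 = v 0 * w 1 - v 1 * w 0 := by
  simp [cross, crossProduct]

theorem inner_space (v w : Space) : inner ℝ v w = v 0 * w 0 + v 1 * w 1 + v 2 * w 2 := by
  simp [PiLp.inner_apply, Fin.sum_univ_three, mul_comm]

theorem space_ext {v w : Space} (h0 : v 0 = w 0) (h1 : v 1 = w 1) (h2 : v 2 = w 2) : v = w := by
  ext i; fin_cases i <;> assumption

theorem cross_add_left (a b c : Space) : cross (a + b) c = cross a c + cross b c := by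
  apply space_ext <;> simp [cross_apply_zero, cross_apply_one, cross_apply_two] <;> ring

theorem cross_smul_left (r : ℝ) (a b : Space) : cross (r • a) b = r • cross a b := by
  apply space_ext <;> simp [cross_apply_zero, cross_apply_one, cross_apply_two] <;> ring

theorem cross_swap (a b : Space) : cross a b = -cross b a := by
  apply space_ext <;> simp [cross_apply_zero, cross_apply_one, cross_apply_two] <;> ring

theorem cross_add_right (a b c : Space) : cross a (b + c) = cross a b + cross a c := by
  apply space_ext <;> simp [cross_apply_zero, cross_apply_one, cross_apply_two] <;> ring

theorem cross_smul_right (r : ℝ) (a b : Space) : cross a (r • b) = r • cross a b := by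
  apply space_ext <;> simp [cross_apply_zero, cross_apply_one, cross_apply_two] <;> ring

theorem cross_self (a : Space) : cross a a = 0 := by
  apply space_ext <;> simp [cross_apply_zero, cross_apply_one, cross_apply_two] <;> ring

theorem inner_cross_left (a b : Space) : inner ℝ (cross a b) a = 0 := by
  simp only [inner_space, cross_apply_zero, cross_apply_one, cross_apply_two]; ring

theorem inner_cross_right (a b : Space) : inner ℝ (cross a b) b = 0 := by
  simp only [inner_space, cross_apply_zero, cross_apply_one, cross_apply_two]; ring

theorem inner_cross_cross (a b c d : Space) : inner ℝ (cross a b) (cross c d) =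
    inner ℝ a c * inner ℝ b d - inner ℝ a d * inner ℝ b c := by
  simp only [inner_space, cross_apply_zero, cross_apply_one, cross_apply_two]; ring

theorem inner_cross_rotate (a b c : Space) : inner ℝ a (cross b c) = inner ℝ c (cross a b) := by
  simp only [inner_space, cross_apply_zero, cross_apply_one, cross_apply_two]; ring

theorem cross_cross (a b c : Space) : cross a (cross b c) = inner ℝ a c • b - inner ℝ a b • c := by
  apply space_ext <;>
  simp [cross_apply_zero, cross_apply_one, cross_apply_two, inner_space] <;> ring

/-- The cross product as a continuous bilinear map. -/
def crossL : Space →L[ℝ] Space →L[ℝ] Space :=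
  LinearMap.toContinuousLinearMap
    { toFun := fun a => LinearMap.toContinuousLinearMap
        { toFun := fun b => cross a b
          map_add' := fun b c => cross_add_right a b c
          map_smul' := fun r b => cross_smul_right r a b }
      map_add' := fun a b => by ext c : 1; exact cross_add_left a b c
      map_smul' := fun r a => by ext c : 1; exact cross_smul_left r a c }

@[simp] theorem crossL_apply (a b : Space) : crossL a b = cross a b := rfl

/-- `(a₁, a₂, ν)` is a positively oriented orthonormal frame of `ℝ³`. -/
structure IsFrame (a₁ a₂ ν : Space) : Prop where
  h11 : inner ℝ a₁ a₁ = 1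
  h22 : inner ℝ a₂ a₂ = 1
  h12 : inner ℝ a₁ a₂ = 0
  hc : cross a₁ a₂ = ν

namespace IsFrame

variable {a₁ a₂ ν : Space} (H : IsFrame a₁ a₂ ν)
include H

theorem h21 : inner ℝ a₂ a₁ = 0 := by rw [real_inner_comm]; exact H.h12
theorem h33 : inner ℝ ν ν = 1 := by
  rw [← H.hc, inner_cross_cross, H.h11, H.h22, H.h12]; ring
theorem h31 : inner ℝ ν a₁ = 0 := by rw [← H.hc]; exact inner_cross_left _ _
theorem h32 : inner ℝ ν a₂ = 0 := by rw [← H.hc]; exact inner_cross_right _ _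
theorem h13 : inner ℝ a₁ ν = 0 := by rw [real_inner_comm]; exact H.h31
theorem h23 : inner ℝ a₂ ν = 0 := by rw [real_inner_comm]; exact H.h32
theorem c23 : cross a₂ ν = a₁ := by
  rw [← H.hc, cross_cross, H.h22, H.h21]; simp
theorem c31 : cross ν a₁ = a₂ := by
  rw [cross_swap, ← H.hc, cross_cross, H.h11, H.h12]; simp

theorem expand (x : Space) :
    x = inner ℝ x a₁ • a₁ + inner ℝ x a₂ • a₂ + inner ℝ x ν • ν := by
  have key : inner ℝ (cross a₁ a₂) ν • x = inner ℝ x (cross a₂ ν) • a₁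
      + inner ℝ x (cross ν a₁) • a₂ + inner ℝ x (cross a₁ a₂) • ν := by
    apply space_ext <;>
    simp [cross_apply_zero, cross_apply_one, cross_apply_two, inner_space] <;> ring
  rwa [H.c23, H.c31, H.hc, H.h33, one_smul] at key

theorem inner_eq (x y : Space) : inner ℝ x y =
    inner ℝ x a₁ * inner ℝ y a₁ + inner ℝ x a₂ * inner ℝ y a₂ + inner ℝ x ν * inner ℝ y ν := by
  conv_lhs => rw [H.expand y]
  simp only [inner_add_right, real_inner_smul_right]; ring

theorem norm_sq (x : Space) : ‖x‖ ^ 2 =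
    inner ℝ x a₁ ^ 2 + inner ℝ x a₂ ^ 2 + inner ℝ x ν ^ 2 := by
  rw [← real_inner_self_eq_norm_sq, H.inner_eq]; ring

theorem ext {x y : Space} (h1 : inner ℝ x a₁ = inner ℝ y a₁) (h2 : inner ℝ x a₂ = inner ℝ y a₂)
    (h3 : inner ℝ x ν = inner ℝ y ν) : x = y := by
  rw [H.expand x, H.expand y, h1, h2, h3]

end IsFrame

/-- Every unit vector completes to a positively oriented orthonormal frame. -/
theorem exists_isFrame (ν : Space) (hν : ‖ν‖ = 1) : ∃ a₁ a₂, IsFrame a₁ a₂ ν := by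
  have hν2 : inner ℝ ν ν = 1 := by rw [real_inner_self_eq_norm_sq, hν]; norm_num
  obtain ⟨x, hx⟩ : ∃ x : Space, cross ν x ≠ 0 := by
    by_contra! h
    have h0 := h (EuclideanSpace.single 0 1)
    have h1 := h (EuclideanSpace.single 1 1)
    have e1 := congrArg (fun v : Space => v 1) h0
    have e2 := congrArg (fun v : Space => v 2) h0
    have e3 := congrArg (fun v : Space => v 2) h1
    simp [cross_apply_one, cross_apply_two] at e1 e2 e3
    rw [inner_space, e1, e2, e3] at hν2
    simp at hν2
  have hn : ‖cross ν x‖ ≠ 0 := norm_ne_zero_iff.mpr hx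
  set a := ‖cross ν x‖⁻¹ • cross ν x with ha
  have haa : inner ℝ a a = 1 := by
    rw [ha, real_inner_smul_left, real_inner_smul_right, real_inner_self_eq_norm_sq]
    field_simp
  have hνa : inner ℝ ν a = 0 := by
    rw [ha, real_inner_smul_right, real_inner_comm, inner_cross_left, mul_zero]
  have haν : inner ℝ a ν = 0 := by rw [real_inner_comm]; exact hνa
  refine ⟨a, cross ν a, haa, ?_, ?_, ?_⟩
  · rw [inner_cross_cross, haa, hν2, hνa]; ring
  · rw [real_inner_comm]; exact inner_cross_right _ _
  · rw [cross_cross, haa, haν]; simp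

/-! ### Pointwise geometry of an immersed surface -/

theorem plane_eq (v : Plane) :
    v = v 0 • EuclideanSpace.single 0 1 + v 1 • EuclideanSpace.single 1 1 := by
  ext i; fin_cases i <;> simp

theorem clm_plane_eq {E : Type*} [NormedAddCommGroup E] [NormedSpace ℝ E] (T : Plane →L[ℝ] E)
    (v : Plane) :
    T v = v 0 • T (EuclideanSpace.single 0 1) + v 1 • T (EuclideanSpace.single 1 1) := by
  conv_lhs => rw [plane_eq v]
  simp

theorem fderiv_eq_pd {E : Type*} [NormedAddCommGroup E] [NormedSpace ℝ E] (f : Plane → E)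
    (p v : Plane) : fderiv ℝ f p v = v 0 • pd 0 f p + v 1 • pd 1 f p :=
  clm_plane_eq _ v

theorem cross_pd_ne_zero {F : Plane → Space} {p : Plane}
    (hF : Function.Injective (fderiv ℝ F p)) : cross (pd 0 F p) (pd 1 F p) ≠ 0 := by
  intro h
  set a := pd 0 F p
  set b := pd 1 F p
  have hb : b ≠ 0 := by
    intro hb
    have : fderiv ℝ F p (EuclideanSpace.single 1 1) = fderiv ℝ F p 0 := by rw [map_zero]; exact hb
    have := congrArg (fun v : Plane => v 1) (hF this)
    simp at this
  have h2 : cross b (cross a b) = 0 := by rw [h]; apply space_ext <;> simp [cross_apply_zero, cross_apply_one, cross_apply_two]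
  rw [cross_cross] at h2
  have : fderiv ℝ F p (WithLp.toLp 2 ![inner ℝ b b, -inner ℝ b a]) = fderiv ℝ F p 0 := by
    rw [map_zero, fderiv_eq_pd, ← h2]; simp [a, b, sub_eq_add_neg]
  have := congrArg (fun v : Plane => v 0) (hF this)
  simp [hb] at this

theorem norm_unitNormal {F : Plane → Space} {p : Plane}
    (hF : Function.Injective (fderiv ℝ F p)) : ‖unitNormal F p‖ = 1 := by
  have := norm_ne_zero_iff.mpr (cross_pd_ne_zero hF)
  rw [unitNormal, norm_smul, norm_inv, norm_norm, inv_mul_cancel₀ this]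

theorem inner_unitNormal_fderiv (F : Plane → Space) (p v : Plane) :
    inner ℝ (unitNormal F p) (fderiv ℝ F p v) = 0 := by
  rw [fderiv_eq_pd, unitNormal, real_inner_smul_left, inner_add_right, real_inner_smul_right,
    real_inner_smul_right, inner_cross_left, inner_cross_right]; simp

theorem cross_fderiv (F : Plane → Space) (p v w : Plane) :
    cross (fderiv ℝ F p v) (fderiv ℝ F p w) =
      (v 0 * w 1 - v 1 * w 0) • cross (pd 0 F p) (pd 1 F p) := by
  rw [fderiv_eq_pd, fderiv_eq_pd]
  apply space_ext <;>
  simp [cross_apply_zero, cross_apply_one, cross_apply_two] <;> ring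

theorem contDiff_pd {E : Type*} [NormedAddCommGroup E] [NormedSpace ℝ E] {f : Plane → E}
    (hf : ContDiff ℝ ∞ f) (i : Fin 2) : ContDiff ℝ ∞ (pd i f) := by
  unfold pd
  exact (hf.fderiv_right (m := ∞) (by simp)).clm_apply contDiff_const

theorem contDiffAt_cross {E : Type*} [NormedAddCommGroup E] [NormedSpace ℝ E] {f g : E → Space}
    {p : E} {n : ℕ∞ω} (hf : ContDiffAt ℝ n f p) (hg : ContDiffAt ℝ n g p) :
    ContDiffAt ℝ n (fun x => cross (f x) (g x)) p := by
  have := (crossL.contDiff (n := n)).contDiffAt.comp p hf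
  exact this.clm_apply hg

theorem contDiffAt_unitNormal {F : Plane → Space} (hF : ContDiff ℝ ∞ F) {p : Plane}
    (hi : Function.Injective (fderiv ℝ F p)) : ContDiffAt ℝ ∞ (unitNormal F) p := by
  have h1 : ContDiffAt ℝ ∞ (fun p => cross (pd 0 F p) (pd 1 F p)) p :=
    contDiffAt_cross (contDiff_pd hF 0).contDiffAt (contDiff_pd hF 1).contDiffAt
  have h0 := cross_pd_ne_zero hi
  exact ((h1.norm ℝ h0).inv (norm_ne_zero_iff.mpr h0)).smul h1

theorem eventually_injective_fderiv {F : Plane → Space} (hF : ContDiff ℝ ∞ F) {p : Plane}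
    (hi : Function.Injective (fderiv ℝ F p)) :
    ∀ᶠ q in nhds p, Function.Injective (fderiv ℝ F q) := by
  have h1 : ContinuousAt (fun p => cross (pd 0 F p) (pd 1 F p)) p :=
    (contDiffAt_cross (contDiff_pd hF 0).contDiffAt (contDiff_pd hF 1).contDiffAt :
      ContDiffAt ℝ ∞ _ p).continuousAt
  filter_upwards [h1.eventually_ne (cross_pd_ne_zero hi)] with q hq
  rw [injective_iff_map_eq_zero]
  intro v hv
  have k0 := cross_fderiv F q v (EuclideanSpace.single 0 1)
  have k1 := cross_fderiv F q v (EuclideanSpace.single 1 1)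
  have z : ∀ x : Space, cross 0 x = 0 := fun x => by
    apply space_ext <;> simp [cross_apply_zero, cross_apply_one, cross_apply_two]
  rw [hv, z, eq_comm, smul_eq_zero] at k0 k1
  simp [hq] at k0 k1
  rw [plane_eq v, k0, k1]; simp

theorem inner_fderiv_unitNormal_self {F : Plane → Space} (hF : ContDiff ℝ ∞ F) {p : Plane}
    (hi : Function.Injective (fderiv ℝ F p)) (v : Plane) :
    inner ℝ (fderiv ℝ (unitNormal F) p v) (unitNormal F p) = 0 := by
  have hd : DifferentiableAt ℝ (unitNormal F) p :=
    (contDiffAt_unitNormal hF hi).differentiableAt (by simp)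
  have h1 : (fun q => inner ℝ (unitNormal F q) (unitNormal F q)) =ᶠ[nhds p] fun _ => (1 : ℝ) := by
    filter_upwards [eventually_injective_fderiv hF hi] with q hq
    rw [real_inner_self_eq_norm_sq, norm_unitNormal hq]; norm_num
  have h2 := congrArg (fun T : Plane →L[ℝ] ℝ => T v) h1.fderiv_eq
  simp only [fderiv_inner_apply ℝ hd hd, fderiv_fun_const, Pi.zero_apply,
    zero_apply] at h2
  rw [real_inner_comm] at h2
  linarith

/-- Weingarten's equation: `⟨∂ᵢN, ∂ⱼF⟩ = -bᵢⱼ`. -/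
theorem inner_pd_unitNormal_pd {F : Plane → Space} (hF : ContDiff ℝ ∞ F) {p : Plane}
    (hi : Function.Injective (fderiv ℝ F p)) (i j : Fin 2) :
    inner ℝ (pd i (unitNormal F) p) (pd j F p) = -secondForm F p i j := by
  have hd : DifferentiableAt ℝ (unitNormal F) p :=
    (contDiffAt_unitNormal hF hi).differentiableAt (by simp)
  have hd' : DifferentiableAt ℝ (pd j F) p :=
    (contDiff_pd hF j).contDiffAt.differentiableAt (by simp)
  have h1 : (fun q => inner ℝ (unitNormal F q) (pd j F q)) =ᶠ[nhds p] fun _ => (0 : ℝ) :=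
    Filter.Eventually.of_forall fun q => inner_unitNormal_fderiv F q _
  have h2 := congrArg (fun T : Plane →L[ℝ] ℝ => T (EuclideanSpace.single i 1)) h1.fderiv_eq
  simp only [fderiv_inner_apply ℝ hd hd', fderiv_fun_const, Pi.zero_apply,
    zero_apply] at h2
  rw [secondForm, Matrix.of_apply, real_inner_comm (unitNormal F p)]
  change inner ℝ (fderiv ℝ (unitNormal F) p (EuclideanSpace.single i 1)) (pd j F p) = -(inner ℝ (unitNormal F p) (fderiv ℝ (pd j F) p (EuclideanSpace.single i 1)))
  linarith

theorem secondForm_symm {F : Plane → Space} (hF : ContDiff ℝ ∞ F) (p : Plane) (i j : Fin 2) :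
    secondForm F p i j = secondForm F p j i := by
  have hs : IsSymmSndFDerivAt ℝ F p := hF.contDiffAt.isSymmSndFDerivAt
    (by rw [minSmoothness_of_isRCLikeNormedField]; exact WithTop.coe_le_coe.2 le_top)
  have hd : DifferentiableAt ℝ (fderiv ℝ F) p :=
    (hF.fderiv_right (m := ∞) (by simp)).contDiffAt.differentiableAt (by simp)
  have key : ∀ i j : Fin 2, pd i (pd j F) p =
      fderiv ℝ (fderiv ℝ F) p (EuclideanSpace.single i 1) (EuclideanSpace.single j 1) := by
    intro i j
    unfold pd
    rw [fderiv_clm_apply hd (by fun_prop)]; simp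
  simp only [secondForm, Matrix.of_apply, key]
  rw [hs.eq]

/-- A principal frame of the surface at the point with parameter `p`: the parameter directions
`v₁, v₂` are mapped to positively oriented orthonormal principal directions, with principal
curvatures `k₁, k₂`. -/
structure IsPrincipal (F : Plane → Space) (p v₁ v₂ : Plane) (k₁ k₂ : ℝ) : Prop where
  frame : IsFrame (fderiv ℝ F p v₁) (fderiv ℝ F p v₂) (unitNormal F p)
  dN1 : fderiv ℝ (unitNormal F) p v₁ = -k₁ • fderiv ℝ F p v₁
  dN2 : fderiv ℝ (unitNormal F) p v₂ = -k₂ • fderiv ℝ F p v₂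
  mean : meanCurvature F p = k₁ + k₂
  normSq : normSqA F p = k₁ ^ 2 + k₂ ^ 2
  det : (v₁ 0 * v₂ 1 - v₁ 1 * v₂ 0) * areaDensity F p = 1
  det_pos : 0 < v₁ 0 * v₂ 1 - v₁ 1 * v₂ 0
  grad : ∀ φ : Plane → ℝ, gradNormSq F φ p = fderiv ℝ φ p v₁ ^ 2 + fderiv ℝ φ p v₂ ^ 2

theorem areaDensity_eq (F : Plane → Space) (p : Plane) :
    areaDensity F p = ‖cross (pd 0 F p) (pd 1 F p)‖ := by
  rw [areaDensity, ← Real.sqrt_sq (norm_nonneg (cross _ _)), ← real_inner_self_eq_norm_sq,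
    inner_cross_cross, Matrix.det_fin_two]
  simp [firstForm]

theorem areaDensity_pos {F : Plane → Space} {p : Plane}
    (hi : Function.Injective (fderiv ℝ F p)) : 0 < areaDensity F p := by
  rw [areaDensity_eq]; exact norm_pos_iff.mpr (cross_pd_ne_zero hi)

theorem cross_pd_eq {F : Plane → Space} {p : Plane} (hi : Function.Injective (fderiv ℝ F p)) :
    cross (pd 0 F p) (pd 1 F p) = areaDensity F p • unitNormal F p := by
  rw [areaDensity_eq, unitNormal, smul_smul,
    mul_inv_cancel₀ (norm_ne_zero_iff.mpr (cross_pd_ne_zero hi)), one_smul]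

theorem inner_fderiv_unitNormal_symm {F : Plane → Space} (hF : ContDiff ℝ ∞ F) {p : Plane}
    (hi : Function.Injective (fderiv ℝ F p)) (v w : Plane) :
    inner ℝ (fderiv ℝ (unitNormal F) p v) (fderiv ℝ F p w) =
      inner ℝ (fderiv ℝ (unitNormal F) p w) (fderiv ℝ F p v) := by
  have h01 := inner_pd_unitNormal_pd hF hi 0 1
  have h10 := inner_pd_unitNormal_pd hF hi 1 0
  rw [secondForm_symm hF] at h10
  simp only [fderiv_eq_pd, inner_add_left, inner_add_right, real_inner_smul_left,
    real_inner_smul_right, h01, h10]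
  ring

/-- The two columns of a matrix `W` that diagonalizes the two fundamental forms determine the
traces in the definition of the curvatures. -/
theorem trace_shape_of_diagonalize {g b W : Matrix (Fin 2) (Fin 2) ℝ} {k₁ k₂ : ℝ}
    (hg : Wᵀ * g * W = 1) (hb : Wᵀ * b * W = !![k₁, 0; 0, k₂]) :
    g⁻¹ = W * Wᵀ ∧ (g⁻¹ * b).trace = k₁ + k₂ ∧ (g⁻¹ * b * (g⁻¹ * b)).trace = k₁ ^ 2 + k₂ ^ 2 := by
  have h1 : W * (Wᵀ * g) = 1 := mul_eq_one_comm.mp hg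
  have h2 : g⁻¹ = W * Wᵀ := Matrix.inv_eq_left_inv (by rw [Matrix.mul_assoc]; exact h1)
  refine ⟨h2, ?_, ?_⟩
  · rw [h2, Matrix.mul_assoc, Matrix.trace_mul_comm, hb]; simp [Matrix.trace_fin_two]
  · have : (W * Wᵀ * b * (W * Wᵀ * b)).trace = ((Wᵀ * b * W) * (Wᵀ * b * W)).trace := by
      rw [show W * Wᵀ * b * (W * Wᵀ * b) = W * (Wᵀ * b * W * (Wᵀ * b)) by
        simp only [Matrix.mul_assoc], Matrix.trace_mul_comm]
      simp only [Matrix.mul_assoc]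
    rw [h2, this, hb]; simp [Matrix.trace_fin_two]; ring

/-- A rotation diagonalizes a symmetric matrix; its angle is half the argument of
`(a - c) / 2 + b i`. -/
theorem exists_rotation_diag (a b c : ℝ) : ∃ x y : ℝ, x ^ 2 + y ^ 2 = 1 ∧
    (c - a) * (x * y) + b * (x ^ 2 - y ^ 2) = 0 := by
  set z : ℂ := ⟨(a - c) / 2, b⟩ with hz
  have hre : ‖z‖ * Real.cos z.arg = (a - c) / 2 := Complex.norm_mul_cos_arg z
  have him : ‖z‖ * Real.sin z.arg = b := Complex.norm_mul_sin_arg z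
  refine ⟨Real.cos (z.arg / 2), Real.sin (z.arg / 2), Real.cos_sq_add_sin_sq _, ?_⟩
  have hc : Real.cos z.arg = Real.cos (z.arg / 2) ^ 2 - Real.sin (z.arg / 2) ^ 2 := by
    rw [← Real.cos_two_mul']; ring_nf
  have hs : Real.sin z.arg = 2 * Real.sin (z.arg / 2) * Real.cos (z.arg / 2) := by
    rw [← Real.sin_two_mul]; ring_nf
  rw [hc] at hre; rw [hs] at him
  have : c - a = -2 * ((a - c) / 2) := by ring
  rw [this, ← hre, ← him]; ring

/-- Principal frames exist: the coordinate directions are made orthonormal, and then rotated to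
diagonalize the second fundamental form. -/
theorem exists_isPrincipal {F : Plane → Space} (hF : ContDiff ℝ ∞ F) {p : Plane}
    (hi : Function.Injective (fderiv ℝ F p)) : ∃ v₁ v₂ k₁ k₂, IsPrincipal F p v₁ v₂ k₁ k₂ := by
  set T := fderiv ℝ F p with hT
  set D := areaDensity F p with hD
  have hDpos : 0 < D := areaDensity_pos hi
  have hA := hDpos
  set A := pd 0 F p with hAdef
  set B := pd 1 F p with hBdef
  have hD2 : D ^ 2 = inner ℝ A A * inner ℝ B B - inner ℝ A B ^ 2 := by
    rw [hD, areaDensity_eq, ← real_inner_self_eq_norm_sq, inner_cross_cross,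
      real_inner_comm A B]; ring
  set e := ‖A‖ with he
  have hAA : inner ℝ A A = e ^ 2 := real_inner_self_eq_norm_sq A
  have hepos : 0 < e := by
    rcases (norm_nonneg A).lt_or_eq with h | h
    · exact h
    · exfalso
      have : A = 0 := norm_eq_zero.mp h.symm
      rw [this] at hD2; simp at hD2; exact hDpos.ne' hD2
  -- the Gram-Schmidt process for the coordinate directions
  set f := inner ℝ A B with hf
  set w₁ : Plane := WithLp.toLp 2 ![e⁻¹, 0] with hw₁
  set w₂ : Plane := WithLp.toLp 2 ![-f / (e * D), e / D] with hw₂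
  have hTw : ∀ v, T v = v 0 • A + v 1 • B := fun v => fderiv_eq_pd F p v
  have hBA : inner ℝ B A = f := by rw [real_inner_comm]
  have n11 : inner ℝ (T w₁) (T w₁) = 1 := by
    rw [hTw]
    simp only [w₁, real_inner_smul_left, real_inner_smul_right, inner_add_right, inner_add_left, hAA]
    simp; field_simp
  have n12 : inner ℝ (T w₁) (T w₂) = 0 := by
    rw [hTw, hTw]
    simp [w₁, w₂, real_inner_smul_left, real_inner_smul_right, inner_add_right, ← hf]
    field_simp; ring
  have n22 : inner ℝ (T w₂) (T w₂) = 1 := by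
    rw [hTw]
    simp only [w₂, real_inner_smul_left, real_inner_smul_right, inner_add_right, inner_add_left,
      hAA, ← hf, hBA]
    rw [hAA] at hD2
    have : inner ℝ B B = (D ^ 2 + f ^ 2) / e ^ 2 := by rw [hD2]; field_simp; ring
    rw [this]; simp; field_simp; ring
  have dw : (w₁ 0 * w₂ 1 - w₁ 1 * w₂ 0) * D = 1 := by simp [w₁, w₂]; field_simp
  set S := fderiv ℝ (unitNormal F) p with hS
  have hsymm := inner_fderiv_unitNormal_symm hF hi
  obtain ⟨x, y, hxy, hrot⟩ := exists_rotation_diag (inner ℝ (S w₁) (T w₁))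
    (inner ℝ (S w₁) (T w₂)) (inner ℝ (S w₂) (T w₂))
  set v₁ := x • w₁ + y • w₂ with hv₁
  set v₂ := (-y) • w₁ + x • w₂ with hv₂
  have n21 : inner ℝ (T w₂) (T w₁) = 0 := by rw [real_inner_comm]; exact n12
  have s21 : inner ℝ (S w₂) (T w₁) = inner ℝ (S w₁) (T w₂) := hsymm _ _
  have m11 : inner ℝ (T v₁) (T v₁) = 1 := by
    simp only [v₁, map_add, map_smul, inner_add_left, inner_add_right, real_inner_smul_left,
      real_inner_smul_right, n11, n12, n22, n21]
    linear_combination hxy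
  have m22 : inner ℝ (T v₂) (T v₂) = 1 := by
    simp only [v₂, map_add, map_smul, inner_add_left, inner_add_right, real_inner_smul_left,
      real_inner_smul_right, n11, n12, n22, n21]
    linear_combination hxy
  have m12 : inner ℝ (T v₁) (T v₂) = 0 := by
    simp only [v₁, v₂, map_add, map_smul, inner_add_left, inner_add_right, real_inner_smul_left,
      real_inner_smul_right, n11, n12, n22, n21]
    ring
  have b12 : inner ℝ (S v₁) (T v₂) = 0 := by
    simp only [v₁, v₂, map_add, map_smul, inner_add_left, inner_add_right, real_inner_smul_left,
      real_inner_smul_right, s21]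
    linear_combination hrot
  have b21 : inner ℝ (S v₂) (T v₁) = 0 := by rw [← b12]; exact hsymm _ _
  have hdet : (v₁ 0 * v₂ 1 - v₁ 1 * v₂ 0) * D = 1 := by
    rw [← dw]
    simp only [v₁, v₂, PiLp.add_apply, PiLp.smul_apply, smul_eq_mul]
    linear_combination (w₁ 0 * w₂ 1 - w₁ 1 * w₂ 0) * D * hxy
  have hframe : IsFrame (T v₁) (T v₂) (unitNormal F p) := by
    refine ⟨m11, m22, m12, ?_⟩
    rw [cross_fderiv, cross_pd_eq hi, smul_smul, hdet, one_smul]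
  have dN1 : S v₁ = -(-inner ℝ (S v₁) (T v₁)) • T v₁ := by
    apply hframe.ext
    · rw [real_inner_smul_left, m11]; ring
    · rw [real_inner_smul_left, m12, b12]; ring
    · rw [real_inner_smul_left, hframe.h13, inner_fderiv_unitNormal_self hF hi]; ring
  have dN2 : S v₂ = -(-inner ℝ (S v₂) (T v₂)) • T v₂ := by
    apply hframe.ext
    · rw [real_inner_smul_left, hframe.h21, b21]; ring
    · rw [real_inner_smul_left, m22]; ring
    · rw [real_inner_smul_left, hframe.h23, inner_fderiv_unitNormal_self hF hi]; ring
  set W : Matrix (Fin 2) (Fin 2) ℝ := !![v₁ 0, v₂ 0; v₁ 1, v₂ 1] with hW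
  have hg : Wᵀ * firstForm F p * W = 1 := by
    rw [hTw v₁] at m11 m12
    rw [hTw v₂] at m12 m22
    simp only [inner_add_left, inner_add_right, real_inner_smul_left,
      real_inner_smul_right, hBA, ← hf] at m11 m12 m22
    simp only [real_inner_self_eq_norm_sq] at m11 m12 m22
    ext i j
    fin_cases i <;> fin_cases j <;>
      simp [W, Matrix.mul_apply, Fin.sum_univ_two, firstForm, ← hAdef, ← hBdef, hBA, ← hf]
    · linear_combination m11
    · linear_combination m12
    · linear_combination m12
    · linear_combination m22
  have hSw : ∀ v, S v = v 0 • pd 0 (unitNormal F) p + v 1 • pd 1 (unitNormal F) p :=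
    fun v => fderiv_eq_pd _ p v
  have hII : ∀ v w : Plane, inner ℝ (S v) (T w) =
      -(v 0 * w 0 * secondForm F p 0 0 + v 0 * w 1 * secondForm F p 0 1 +
        v 1 * w 0 * secondForm F p 1 0 + v 1 * w 1 * secondForm F p 1 1) := by
    intro v w
    rw [hSw, hTw]
    simp only [inner_add_left, inner_add_right, real_inner_smul_left, real_inner_smul_right,
      A, B, inner_pd_unitNormal_pd hF hi]
    ring
  have hb : Wᵀ * secondForm F p * W =
      !![-inner ℝ (S v₁) (T v₁), 0; 0, -inner ℝ (S v₂) (T v₂)] := by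
    rw [hII] at b12 b21
    rw [hII, hII]
    ext i j
    fin_cases i <;> fin_cases j <;> simp [W, Matrix.mul_apply, Fin.sum_univ_two]
    · ring
    · linear_combination -b12
    · linear_combination -b21
    · ring
  obtain ⟨hinv, htr, htr2⟩ := trace_shape_of_diagonalize hg hb
  refine ⟨v₁, v₂, _, _, hframe, dN1, dN2, htr, htr2, hdet, ?_, ?_⟩
  · by_contra! h
    nlinarith
  · intro φ
    rw [gradNormSq, hinv, fderiv_eq_pd, fderiv_eq_pd]
    simp [W, Matrix.mulVec, dotProduct, Matrix.mul_apply, Fin.sum_univ_two]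
    ring

theorem IsPrincipal.expand {F : Plane → Space} {p v₁ v₂ : Plane} {k₁ k₂ : ℝ}
    (hP : IsPrincipal F p v₁ v₂ k₁ k₂) (v : Plane) : ∃ a b : ℝ, v = a • v₁ + b • v₂ := by
  have hd := hP.det_pos.ne'
  refine ⟨(v 0 * v₂ 1 - v 1 * v₂ 0) / (v₁ 0 * v₂ 1 - v₁ 1 * v₂ 0),
    (v₁ 0 * v 1 - v₁ 1 * v 0) / (v₁ 0 * v₂ 1 - v₁ 1 * v₂ 0), ?_⟩
  ext i
  fin_cases i <;> simp <;>
    rw [div_mul_eq_mul_div, div_mul_eq_mul_div, ← add_div, eq_div_iff hd] <;> ring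

/-- The second fundamental form bounds the differential of the Gauss map. -/
theorem norm_fderiv_unitNormal_le {F : Plane → Space} (hF : ContDiff ℝ ∞ F) {p : Plane}
    (hi : Function.Injective (fderiv ℝ F p)) {C : ℝ} (hC : 0 ≤ C)
    (hA : normSqA F p ≤ 4 * C ^ 2) (v : Plane) :
    ‖fderiv ℝ (unitNormal F) p v‖ ≤ 2 * C * ‖fderiv ℝ F p v‖ := by
  obtain ⟨v₁, v₂, k₁, k₂, hP⟩ := exists_isPrincipal hF hi
  obtain ⟨a, b, rfl⟩ := hP.expand v
  rw [hP.normSq] at hA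
  apply (sq_le_sq₀ (norm_nonneg _) (by positivity)).mp
  rw [mul_pow, ← real_inner_self_eq_norm_sq, ← real_inner_self_eq_norm_sq]
  have h11 := hP.frame.h11; have h12 := hP.frame.h12
  have h22 := hP.frame.h22; have h21 := hP.frame.h21
  simp only [map_add, map_smul, hP.dN1, hP.dN2, inner_add_left, inner_add_right,
    real_inner_smul_left, real_inner_smul_right, h11, h12, h22, h21]
  nlinarith [mul_nonneg (sq_nonneg a) (sub_nonneg.2 hA), mul_nonneg (sq_nonneg b) (sub_nonneg.2 hA),
    mul_nonneg (sq_nonneg a) (sq_nonneg k₂), mul_nonneg (sq_nonneg b) (sq_nonneg k₁)]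

theorem sq_meanCurvature_le {F : Plane → Space} (hF : ContDiff ℝ ∞ F) {p : Plane}
    (hi : Function.Injective (fderiv ℝ F p)) : meanCurvature F p ^ 2 ≤ 2 * normSqA F p := by
  obtain ⟨v₁, v₂, k₁, k₂, hP⟩ := exists_isPrincipal hF hi
  rw [hP.normSq, hP.mean]
  nlinarith [sq_nonneg (k₁ - k₂)]

/-- The mean curvature as a ratio of alternating forms. Both sides are alternating in the two
directions, so the identity is invariant under changes of the parameter. -/
theorem cross_fderiv_unitNormal {F : Plane → Space} (hF : ContDiff ℝ ∞ F) {p : Plane}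
    (hi : Function.Injective (fderiv ℝ F p)) (v w : Plane) :
    cross (fderiv ℝ F p w) (fderiv ℝ (unitNormal F) p v) +
      cross (fderiv ℝ (unitNormal F) p w) (fderiv ℝ F p v) =
      meanCurvature F p • cross (fderiv ℝ F p v) (fderiv ℝ F p w) := by
  obtain ⟨v₁, v₂, k₁, k₂, hP⟩ := exists_isPrincipal hF hi
  obtain ⟨a, b, rfl⟩ := hP.expand v
  obtain ⟨c, d, rfl⟩ := hP.expand w
  rw [hP.mean]
  simp only [map_add, map_smul, hP.dN1, hP.dN2]
  apply space_ext <;>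
  simp [cross_apply_zero, cross_apply_one, cross_apply_two] <;> ring

/-! ### Graph charts over a plane -/

/-- The orthogonal projection of space to the plane spanned by `a₁, a₂`, in coordinates. -/
def proj (a₁ a₂ : Space) : Space →L[ℝ] Plane :=
  LinearMap.toContinuousLinearMap
    { toFun := fun x => WithLp.toLp 2 ![inner ℝ x a₁, inner ℝ x a₂]
      map_add' := fun x y => by ext i; fin_cases i <;> simp [inner_add_left]
      map_smul' := fun r x => by ext i; fin_cases i <;> simp [real_inner_smul_left] }

@[simp] theorem proj_apply_zero (a₁ a₂ x : Space) : proj a₁ a₂ x 0 = inner ℝ x a₁ := rfl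
@[simp] theorem proj_apply_one (a₁ a₂ x : Space) : proj a₁ a₂ x 1 = inner ℝ x a₂ := rfl

theorem plane_norm_sq (v : Plane) : ‖v‖ ^ 2 = v 0 ^ 2 + v 1 ^ 2 := by
  simp [EuclideanSpace.norm_sq_eq, Fin.sum_univ_two]

theorem plane_ext {v w : Plane} (h0 : v 0 = w 0) (h1 : v 1 = w 1) : v = w := by
  ext i; fin_cases i <;> assumption

namespace IsFrame

variable {a₁ a₂ ν : Space} (H : IsFrame a₁ a₂ ν)
include H

theorem norm_sq_eq_proj (x : Space) : ‖x‖ ^ 2 = ‖proj a₁ a₂ x‖ ^ 2 + inner ℝ x ν ^ 2 := by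
  rw [H.norm_sq, plane_norm_sq]; simp

theorem norm_proj_le (x : Space) : ‖proj a₁ a₂ x‖ ≤ ‖x‖ := by
  apply (sq_le_sq₀ (norm_nonneg _) (norm_nonneg _)).mp
  rw [H.norm_sq_eq_proj x]; nlinarith [sq_nonneg (inner ℝ x ν)]

theorem norm_eq : ‖ν‖ = 1 := by
  have := H.h33
  rw [real_inner_self_eq_norm_sq] at this
  nlinarith [norm_nonneg ν]

theorem eq_of_proj_eq {x y : Space} (h : proj a₁ a₂ x = proj a₁ a₂ y)
    (h3 : inner ℝ x ν = inner ℝ y ν) : x = y :=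
  H.ext (congrArg (fun v : Plane => v 0) h) (congrArg (fun v : Plane => v 1) h) h3

/-- A vector tangent to a plane with unit normal `n` is controlled by its projection to the plane
orthogonal to `ν`, if `n` and `ν` are not orthogonal. -/
theorem norm_le_of_orthogonal {n w : Space} (hn : ‖n‖ = 1) (hw : inner ℝ n w = 0) :
    inner ℝ n ν ^ 2 * ‖w‖ ^ 2 ≤ ‖proj a₁ a₂ w‖ ^ 2 := by
  have h1 : inner ℝ w ν = inner ℝ w (ν - inner ℝ n ν • n) := by
    rw [inner_sub_right, real_inner_smul_right, real_inner_comm n w, hw]; ring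
  have h2 : inner ℝ w ν ^ 2 ≤ ‖w‖ ^ 2 * (1 - inner ℝ n ν ^ 2) := by
    have := abs_real_inner_le_norm w (ν - inner ℝ n ν • n)
    rw [← h1] at this
    have h3 : ‖ν - inner ℝ n ν • n‖ ^ 2 = 1 - inner ℝ n ν ^ 2 := by
      rw [norm_sub_sq_real, norm_smul, hn, H.norm_eq, real_inner_smul_right, real_inner_comm n ν]
      simp; ring
    rw [← h3, ← mul_pow, ← sq_abs (inner ℝ w ν)]
    exact pow_le_pow_left₀ (abs_nonneg _) this 2
  have := H.norm_sq_eq_proj w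
  nlinarith

end IsFrame

namespace IsAdmissible

variable {F : Plane → Space} {h C L : ℝ} (A : IsAdmissible F h C L)
include A

theorem smooth : ContDiff ℝ ∞ F := A.embedded.smooth

theorem inj {p : Plane} (hp : p ∈ disk) : Function.Injective (fderiv ℝ F p) :=
  A.embedded.immersion p hp

theorem contDiffAt_normal {p : Plane} (hp : p ∈ disk) : ContDiffAt ℝ ∞ (unitNormal F) p :=
  contDiffAt_unitNormal A.smooth (A.inj hp)

theorem mem_ball_of_norm_lt {p : Plane} (hp : p ∈ disk) (hL : ‖F p‖ < L) : p ∈ ball (0 : Plane) 1 := by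
  have h1 : ‖p‖ ≤ 1 := by simpa [disk] using hp
  rcases h1.lt_or_eq with h1 | h1
  · simpa using h1
  · have : F p ∈ sphere (0 : Space) L := A.boundary ⟨p, by simpa [circle] using h1, rfl⟩
    simp at this; linarith

theorem norm_fderiv_normal_le {p : Plane} (hC : 0 ≤ C) (hp : p ∈ disk) (hL : ‖F p‖ < L) (v : Plane) :
    ‖fderiv ℝ (unitNormal F) p v‖ ≤ 2 * C * ‖fderiv ℝ F p v‖ :=
  norm_fderiv_unitNormal_le A.smooth (A.inj hp) hC (A.curvature_le p hp (by simpa using hL)) v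

end IsAdmissible

theorem ball_subset_disk {p : Plane} (hp : p ∈ ball (0 : Plane) 1) : p ∈ disk :=
  ball_subset_closedBall hp

/-- Where the surface is transversal to `ν`, its projection to the plane orthogonal to `ν` is a
local diffeomorphism. -/
theorem exists_local_inverse {F : Plane → Space} (hF : ContDiff ℝ ∞ F) {p : Plane}
    (hi : Function.Injective (fderiv ℝ F p)) {a₁ a₂ ν : Space} (H : IsFrame a₁ a₂ ν)
    (hν : inner ℝ (unitNormal F p) ν ≠ 0) :
    ∃ Φ : OpenPartialHomeomorph Plane Plane, p ∈ Φ.source ∧ (∀ x, Φ x = proj a₁ a₂ (F x)) ∧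
      ContDiffAt ℝ ∞ Φ.symm (proj a₁ a₂ (F p)) := by
  have hf : ContDiffAt ℝ ∞ (fun x => proj a₁ a₂ (F x)) p :=
    ((proj a₁ a₂).contDiff.comp hF).contDiffAt
  have hd : HasFDerivAt (fun x => proj a₁ a₂ (F x)) ((proj a₁ a₂).comp (fderiv ℝ F p)) p :=
    (proj a₁ a₂).hasFDerivAt.comp p (hF.contDiffAt.differentiableAt (by simp)).hasFDerivAt
  set T : Plane →ₗ[ℝ] Plane := ((proj a₁ a₂).comp (fderiv ℝ F p)).toLinearMap with hT
  have hinj : Function.Injective T := by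
    rw [injective_iff_map_eq_zero]
    intro v hv
    have h1 := H.norm_le_of_orthogonal (norm_unitNormal hi) (inner_unitNormal_fderiv F p v)
    have h2 : proj a₁ a₂ (fderiv ℝ F p v) = 0 := hv
    rw [h2, norm_zero] at h1
    have h3 : ‖fderiv ℝ F p v‖ = 0 := by
      by_contra hne
      have : 0 < inner ℝ (unitNormal F p) ν ^ 2 * ‖fderiv ℝ F p v‖ ^ 2 := by positivity
      linarith
    apply hi
    rw [norm_eq_zero.mp h3, map_zero]
  set e : Plane ≃L[ℝ] Plane := (LinearEquiv.ofInjectiveEndo T hinj).toContinuousLinearEquiv with he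
  have hd' : HasFDerivAt (fun x => proj a₁ a₂ (F x)) (e : Plane →L[ℝ] Plane) p := by
    convert! hd
  exact ⟨hf.toOpenPartialHomeomorph _ hd' (by simp),
    hf.mem_toOpenPartialHomeomorph_source hd' (by simp), fun x => rfl,
    hf.to_localInverse hd' (by simp)⟩

/-- A unique continuation principle for lifts through a locally injective map. -/
theorem eqOn_of_lift {X : Type*} [TopologicalSpace X] {s : Set X} (hs : IsPreconnected s)
    {f : Plane → Plane} {a b : X → Plane} (ha : ContinuousOn a s) (hb : ContinuousOn b s)
    (hf : ∀ x ∈ s, ∃ U ∈ nhds (a x), InjOn f U) (hab : ∀ x ∈ s, f (a x) = f (b x))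
    {x₀ : X} (hx₀ : x₀ ∈ s) (h0 : a x₀ = b x₀) : EqOn a b s := by
  have : PreconnectedSpace s := isPreconnected_iff_preconnectedSpace.mp hs
  have ha' : Continuous (fun x : s => a x) := continuousOn_iff_continuous_domRestrict.mp ha
  have hb' : Continuous (fun x : s => b x) := continuousOn_iff_continuous_domRestrict.mp hb
  have hclopen : IsClopen {x : s | a x = b x} := by
    refine ⟨isClosed_eq ha' hb', ?_⟩
    rw [isOpen_iff_mem_nhds]
    intro x hx
    obtain ⟨U, hU, hinj⟩ := hf x x.2
    have hx' : a x = b x := hx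
    filter_upwards [ha'.continuousAt.preimage_mem_nhds hU,
      hb'.continuousAt.preimage_mem_nhds (hx' ▸ hU)] with y hy1 hy2
    exact hinj hy1 hy2 (hab y y.2)
  have huniv := hclopen.eq_univ ⟨⟨x₀, hx₀⟩, h0⟩
  intro x hx
  have : (⟨x, hx⟩ : s) ∈ {x : s | a x = b x} := huniv ▸ mem_univ _
  exact this

/-- `σ` parametrizes, over the disk of radius `r` of the plane orthogonal to `ν`, the part of the
surface around the point with parameter `q` as a graph of small slope over that plane. -/
structure IsChart (F : Plane → Space) (C L : ℝ) (a₁ a₂ ν : Space) (q : Plane) (r : ℝ)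
    (σ : Plane → Plane) : Prop where
  zero : σ 0 = q
  smooth : ∀ ξ ∈ ball (0 : Plane) r, ContDiffAt ℝ ∞ σ ξ
  mem : ∀ ξ ∈ ball (0 : Plane) r, σ ξ ∈ ball (0 : Plane) 1
  proj_eq : ∀ ξ ∈ ball (0 : Plane) r, proj a₁ a₂ (F (σ ξ)) = proj a₁ a₂ (F q) + ξ
  tilt : ∀ ξ ∈ ball (0 : Plane) r, 9 / 10 < inner ℝ (unitNormal F (σ ξ)) ν
  normal_le : ∀ ξ ∈ ball (0 : Plane) r, ‖unitNormal F (σ ξ) - unitNormal F q‖ ≤ 3 * C * ‖ξ‖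
  norm_le : ∀ ξ ∈ ball (0 : Plane) r, ‖F (σ ξ) - F q‖ ≤ 2 * ‖ξ‖
  norm_lt : ∀ ξ ∈ ball (0 : Plane) r, ‖F (σ ξ)‖ < L

/-- A lift, starting at `q`, of the segment `[0, T] ∋ t ↦ P(F q) + t ξ`, with the natural
a priori bounds. -/
structure IsRayLift (F : Plane → Space) (C : ℝ) (a₁ a₂ : Space) (q ξ : Plane) (T : ℝ)
    (c : ℝ → Plane) : Prop where
  cont : ContinuousOn c (Icc 0 T)
  zero : c 0 = q
  mem : ∀ t ∈ Icc 0 T, c t ∈ disk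
  proj_eq : ∀ t ∈ Icc 0 T, proj a₁ a₂ (F (c t)) = proj a₁ a₂ (F q) + t • ξ
  normal_le : ∀ t ∈ Icc 0 T, ‖unitNormal F (c t) - unitNormal F q‖ ≤ 3 * C * ‖ξ‖ * t
  norm_le : ∀ t ∈ Icc 0 T, ‖F (c t) - F q‖ ≤ 2 * ‖ξ‖ * t

/-- The smallness of the radius `r` of graph charts, in terms of the curvature bound and of the
distance `ρ` to the boundary. -/
def IsSmallRadius (C ρ r : ℝ) : Prop := 0 < r ∧ 3 * C * r ≤ 1 / 20 ∧ 2 * r ≤ ρ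

theorem tilt_of_close {n n' ν : Space} (hν : ‖ν‖ = 1) {s : ℝ} (hn : ‖n' - n‖ ≤ s) :
    inner ℝ n ν - s ≤ inner ℝ n' ν := by
  have h1 := abs_real_inner_le_norm (n' - n) ν
  rw [hν, mul_one, inner_sub_left] at h1
  have := (abs_le.mp (h1.trans hn)).1
  linarith

section Lift

variable {F : Plane → Space} {h C L : ℝ} {a₁ a₂ ν : Space} {q : Plane} {ρ r : ℝ}

/-- A point that satisfies the a priori bounds of a ray lift is an interior point, of small tilt. -/
theorem bounds_of_close (A : IsAdmissible F h C L) (hC : 0 < C) (H : IsFrame a₁ a₂ ν)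
    (hr : IsSmallRadius C ρ r) (hqL : ‖F q‖ ≤ L - ρ)
    (hqν : 19 / 20 ≤ inner ℝ (unitNormal F q) ν) {k ξ : Plane} (hξ : ‖ξ‖ < r) {t : ℝ}
    (ht : t ∈ Icc (0 : ℝ) 1) (hk : k ∈ disk)
    (h1 : ‖unitNormal F k - unitNormal F q‖ ≤ 3 * C * ‖ξ‖ * t) (h2 : ‖F k - F q‖ ≤ 2 * ‖ξ‖ * t) :
    k ∈ ball (0 : Plane) 1 ∧ 9 / 10 < inner ℝ (unitNormal F k) ν ∧ ‖F k‖ < L := by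
  have hξ0 := norm_nonneg ξ
  have e1 : ‖F k‖ < L := by
    have := norm_sub_norm_le (F k) (F q)
    have : 2 * ‖ξ‖ * t ≤ 2 * ‖ξ‖ := by nlinarith [ht.2]
    linarith [hr.2.2]
  refine ⟨A.mem_ball_of_norm_lt hk e1, ?_, e1⟩
  have := tilt_of_close H.norm_eq h1
  have h3 : 3 * C * ‖ξ‖ * t ≤ 3 * C * ‖ξ‖ := by
    have : 0 ≤ 3 * C * ‖ξ‖ := by positivity
    nlinarith [ht.2]
  have h4 : 3 * C * ‖ξ‖ < 3 * C * r := by nlinarith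
  linarith [hr.2.1]

/-- The projection shrinks tangent vectors at most by the factor `9/10` where the tilt is small. -/
theorem norm_fderiv_le_of_tilt (H : IsFrame a₁ a₂ ν) {p v : Plane}
    (hi : Function.Injective (fderiv ℝ F p)) (hν : 9 / 10 < inner ℝ (unitNormal F p) ν) :
    ‖fderiv ℝ F p v‖ ≤ 10 / 9 * ‖proj a₁ a₂ (fderiv ℝ F p v)‖ := by
  have h1 := H.norm_le_of_orthogonal (norm_unitNormal hi) (inner_unitNormal_fderiv F p v)
  have h2 : (81 / 100 : ℝ) ≤ inner ℝ (unitNormal F p) ν ^ 2 := by nlinarith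
  apply (sq_le_sq₀ (norm_nonneg _) (by positivity)).mp
  nlinarith [sq_nonneg ‖fderiv ℝ F p v‖]

/-- Rays lift through the projection. The set of the times up to which a lift exists is closed by
compactness of the disk, and the a priori bounds keep the lift where the projection is a local
diffeomorphism, so that the lift can be continued. -/
theorem exists_rayLift (A : IsAdmissible F h C L) (hC : 0 < C) (H : IsFrame a₁ a₂ ν)
    (hr : IsSmallRadius C ρ r) (hq : q ∈ disk) (hqL : ‖F q‖ ≤ L - ρ)
    (hqν : 19 / 20 ≤ inner ℝ (unitNormal F q) ν) {ξ : Plane} (hξ : ‖ξ‖ < r) :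
    ∃ c, IsRayLift F C a₁ a₂ q ξ 1 c := by
  set S := {T : ℝ | T ∈ Icc (0 : ℝ) 1 ∧ ∃ c, IsRayLift F C a₁ a₂ q ξ T c} with hS
  have hξ0 := norm_nonneg ξ
  have h0S : (0 : ℝ) ∈ S := by
    refine ⟨by simp, fun _ => q, continuousOn_const, rfl, fun _ _ => hq, ?_, ?_, ?_⟩
    all_goals
      intro t ht
      simp at ht
      simp [ht]
  have hSb : BddAbove S := ⟨1, fun T hT => hT.1.2⟩
  obtain ⟨t, -, htT, htS⟩ := exists_seq_tendsto_sSup ⟨0, h0S⟩ hSb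
  set T := sSup S with hT
  choose ht01 c hc using htS
  have hT01 : T ∈ Icc (0 : ℝ) 1 := isClosed_Icc.mem_of_tendsto htT (Filter.Eventually.of_forall ht01)
  have hmem : ∀ n, t n ∈ Icc 0 (t n) := fun n => ⟨(ht01 n).1, le_rfl⟩
  -- a cluster point of the end points of the lifts
  have hcomp : IsCompact disk := isCompact_closedBall 0 1
  obtain ⟨k, hk, s, hs, hlim⟩ := hcomp.tendsto_subseq (fun n => (hc n).mem _ (hmem n))
  have hts : Filter.Tendsto (t ∘ s) Filter.atTop (nhds T) := htT.comp hs.tendsto_atTop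
  have hFk : Filter.Tendsto (fun n => F (c (s n) (t (s n)))) Filter.atTop (nhds (F k)) :=
    (A.smooth.continuous.tendsto k).comp hlim
  have hNk : Filter.Tendsto (fun n => unitNormal F (c (s n) (t (s n)))) Filter.atTop
      (nhds (unitNormal F k)) :=
    ((A.contDiffAt_normal hk).continuousAt.tendsto).comp hlim
  have k1 : proj a₁ a₂ (F k) = proj a₁ a₂ (F q) + T • ξ := by
    refine tendsto_nhds_unique (((proj a₁ a₂).continuous.tendsto _).comp hFk) ?_
    refine Filter.Tendsto.congr (fun n => ((hc (s n)).proj_eq _ (hmem _)).symm) ?_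
    exact tendsto_const_nhds.add (hts.smul_const ξ)
  have k2 : ‖unitNormal F k - unitNormal F q‖ ≤ 3 * C * ‖ξ‖ * T :=
    le_of_tendsto_of_tendsto' (hNk.sub_const _).norm (hts.const_mul _)
      (fun n => (hc (s n)).normal_le _ (hmem _))
  have k3 : ‖F k - F q‖ ≤ 2 * ‖ξ‖ * T :=
    le_of_tendsto_of_tendsto' (hFk.sub_const _).norm (hts.const_mul _)
      (fun n => (hc (s n)).norm_le _ (hmem _))
  obtain ⟨kb, kt, kL⟩ := bounds_of_close A hC H hr hqL hqν hξ hT01 hk k2 k3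
  -- the local inverse of the projection at the cluster point
  obtain ⟨Φ, hkΦ, hΦ, hΦs⟩ := exists_local_inverse A.smooth (A.inj hk) H (by linarith : inner ℝ (unitNormal F k) ν ≠ 0)
  set ℓ : ℝ → Plane := fun u => proj a₁ a₂ (F q) + u • ξ with hℓ
  have hℓc : Continuous ℓ := by fun_prop
  have hℓT : ℓ T = proj a₁ a₂ (F k) := k1.symm
  have hgk : Φ.symm (ℓ T) = k := by rw [hℓT, ← hΦ, Φ.left_inv hkΦ]
  have hgcont : ContinuousAt Φ.symm (ℓ T) := by rw [hℓT]; exact hΦs.continuousAt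
  have hB : ∀ᶠ x in nhds k, x ∈ ball (0 : Plane) 1 ∧ 9 / 10 < inner ℝ (unitNormal F x) ν ∧ ‖F x‖ < L := by
    refine (isOpen_ball.eventually_mem kb).and (Filter.Eventually.and ?_ ?_)
    · have : ContinuousAt (fun x => inner ℝ (unitNormal F x) ν) k :=
        (A.contDiffAt_normal hk).continuousAt.inner continuousAt_const
      exact this.eventually (lt_mem_nhds kt)
    · exact A.smooth.continuous.norm.continuousAt.eventually (gt_mem_nhds kL)
  have hev : ∀ᶠ u in nhds T, ℓ u ∈ Φ.target ∧ DifferentiableAt ℝ Φ.symm (ℓ u) ∧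
      (Φ.symm (ℓ u) ∈ ball (0 : Plane) 1 ∧ 9 / 10 < inner ℝ (unitNormal F (Φ.symm (ℓ u))) ν ∧
        ‖F (Φ.symm (ℓ u))‖ < L) := by
    refine Filter.Eventually.and ?_ (Filter.Eventually.and ?_ ?_)
    · have : ℓ T ∈ Φ.target := by rw [hℓT, ← hΦ]; exact Φ.map_source hkΦ
      exact hℓc.continuousAt.eventually (Φ.open_target.eventually_mem this)
    · have h1 : ContDiffAt ℝ 1 Φ.symm (ℓ T) := by rw [hℓT]; exact hΦs.of_le (by simp)
      have h2 : ∀ᶠ y in nhds (ℓ T), ContDiffAt ℝ 1 Φ.symm y := h1.eventually (by simp)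
      exact hℓc.continuousAt.eventually (h2.mono fun y hy => hy.differentiableAt (by simp))
    · have : Filter.Tendsto (fun u => Φ.symm (ℓ u)) (nhds T) (nhds k) := by
        have := hgcont.tendsto.comp hℓc.continuousAt.tendsto
        rwa [hgk] at this
      exact this.eventually hB
  obtain ⟨η, hη, hηB⟩ := Metric.eventually_nhds_iff.mp hev
  have hev2 : ∀ᶠ n in Filter.atTop, dist (t (s n)) T < η ∧ c (s n) (t (s n)) ∈ Φ.source :=
    (hts.eventually (ball_mem_nhds T hη)).and (hlim.eventually (Φ.open_source.eventually_mem hkΦ))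
  obtain ⟨n, hn1, hn2⟩ := hev2.exists
  set t₀ := t (s n) with ht₀
  set c₀ := c (s n) with hc₀
  have hL0 : IsRayLift F C a₁ a₂ q ξ t₀ c₀ := hc (s n)
  have ht₀01 : t₀ ∈ Icc (0 : ℝ) 1 := ht01 (s n)
  have hjoin : c₀ t₀ = Φ.symm (ℓ t₀) := by
    rw [← Φ.left_inv hn2, hΦ, hL0.proj_eq _ (hmem _)]
  have ht₀T : t₀ ≤ T := le_csSup hSb ⟨ht₀01, c₀, hL0⟩
  -- The lift up to `t₀ ≤ T` is continued by the local inverse up to `T'`, which exceeds `T` unless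
  -- `T' = 1`.
  set T' := min (T + η / 2) 1 with hT'
  have hTT' : T ≤ T' := le_min (by linarith) hT01.2
  have hin : ∀ u ∈ Icc t₀ T', dist u T < η := by
    intro u hu
    rw [Real.dist_eq, abs_lt] at hn1 ⊢
    have := hu.2.trans (min_le_left _ _)
    constructor <;> linarith [hu.1]
  set g : ℝ → Plane := fun u => Φ.symm (ℓ u) with hg
  have hproj : ∀ u ∈ Icc t₀ T', proj a₁ a₂ (F (g u)) = ℓ u := by
    intro u hu
    rw [← hΦ]; exact Φ.right_inv (hηB (hin u hu)).1
  -- the derivative along the extended lift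
  have hgd : ∀ u ∈ Icc t₀ T', HasDerivAt g (fderiv ℝ Φ.symm (ℓ u) ξ) u := by
    intro u hu
    have h1 : HasDerivAt ℓ ξ u := by
      simpa [hℓ] using ((hasDerivAt_id u).smul_const ξ).const_add (proj a₁ a₂ (F q))
    exact (hηB (hin u hu)).2.1.hasFDerivAt.comp_hasDerivAt u h1
  have hFd : ∀ u ∈ Icc t₀ T', HasDerivAt (fun u => F (g u))
      (fderiv ℝ F (g u) (fderiv ℝ Φ.symm (ℓ u) ξ)) u := fun u hu =>
    (show HasFDerivAt F (fderiv ℝ F (g u)) (g u) from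
      (A.smooth.contDiffAt.differentiableAt (by simp)).hasFDerivAt).comp_hasDerivAt u (hgd u hu)
  have hNd : ∀ u ∈ Icc t₀ T', HasDerivAt (fun u => unitNormal F (g u))
      (fderiv ℝ (unitNormal F) (g u) (fderiv ℝ Φ.symm (ℓ u) ξ)) u := fun u hu =>
    (show HasFDerivAt (unitNormal F) (fderiv ℝ (unitNormal F) (g u)) (g u) from
      ((A.contDiffAt_normal (ball_subset_disk (hηB (hin u hu)).2.2.1)).differentiableAt
        (by simp)).hasFDerivAt).comp_hasDerivAt u (hgd u hu)
  have hPd : ∀ u ∈ Icc t₀ T',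
      proj a₁ a₂ (fderiv ℝ F (g u) (fderiv ℝ Φ.symm (ℓ u) ξ)) = ξ := by
    intro u hu
    have h1 := (proj a₁ a₂).hasFDerivAt.comp_hasDerivAt u (hFd u hu)
    have h2 : HasDerivAt ℓ ξ u := by
      simpa [hℓ] using ((hasDerivAt_id u).smul_const ξ).const_add (proj a₁ a₂ (F q))
    refine h1.unique (h2.congr_of_eventuallyEq ?_)
    have : ∀ᶠ w in nhds u, dist w T < η :=
      isOpen_ball.eventually_mem (show u ∈ ball T η from hin u hu)
    filter_upwards [this] with w hw
    change proj a₁ a₂ (F (g w)) = ℓ w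
    rw [← hΦ]; exact Φ.right_inv (hηB hw).1
  have hFb : ∀ u ∈ Icc t₀ T',
      ‖fderiv ℝ F (g u) (fderiv ℝ Φ.symm (ℓ u) ξ)‖ ≤ 10 / 9 * ‖ξ‖ := by
    intro u hu
    have := norm_fderiv_le_of_tilt (v := fderiv ℝ Φ.symm (ℓ u) ξ) H
      (A.inj (ball_subset_disk (hηB (hin u hu)).2.2.1)) (hηB (hin u hu)).2.2.2.1
    rwa [hPd u hu] at this
  have hNb : ∀ u ∈ Icc t₀ T',
      ‖fderiv ℝ (unitNormal F) (g u) (fderiv ℝ Φ.symm (ℓ u) ξ)‖ ≤ 3 * C * ‖ξ‖ := by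
    intro u hu
    have h1 := A.norm_fderiv_normal_le hC.le (ball_subset_disk (hηB (hin u hu)).2.2.1)
      (hηB (hin u hu)).2.2.2.2 (fderiv ℝ Φ.symm (ℓ u) ξ)
    have h2 := hFb u hu
    have h3 : 0 ≤ C * ‖ξ‖ := by positivity
    nlinarith
  have hFinc : ∀ u ∈ Icc t₀ T', ‖F (g u) - F (g t₀)‖ ≤ 2 * ‖ξ‖ * (u - t₀) := by
    intro u hu
    have := (convex_Icc t₀ T').norm_image_sub_le_of_norm_hasDerivWithin_le
      (fun u hu => (hFd u hu).hasDerivWithinAt) hFb ⟨le_rfl, hu.1.trans hu.2⟩ hu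
    rw [Real.norm_of_nonneg (by linarith [hu.1])] at this
    have h3 : 0 ≤ ‖ξ‖ * (u - t₀) := mul_nonneg hξ0 (by linarith [hu.1])
    nlinarith
  have hNinc : ∀ u ∈ Icc t₀ T', ‖unitNormal F (g u) - unitNormal F (g t₀)‖ ≤
      3 * C * ‖ξ‖ * (u - t₀) := by
    intro u hu
    have := (convex_Icc t₀ T').norm_image_sub_le_of_norm_hasDerivWithin_le
      (fun u hu => (hNd u hu).hasDerivWithinAt) hNb ⟨le_rfl, hu.1.trans hu.2⟩ hu
    rwa [Real.norm_of_nonneg (by linarith [hu.1])] at this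
  have hnew : IsRayLift F C a₁ a₂ q ξ T' (fun u => if u ≤ t₀ then c₀ u else g u) := by
    have hcase : ∀ u ∈ Icc 0 T', ¬ u ≤ t₀ → u ∈ Icc t₀ T' := fun u hu hn =>
      ⟨(not_le.mp hn).le, hu.2⟩
    refine ⟨?_, ?_, ?_, ?_, ?_, ?_⟩
    · apply ContinuousOn.if
      · rintro u ⟨hu, hf⟩
        have : u = t₀ := frontier_le_subset_eq continuous_id continuous_const hf
        rw [this]; exact hjoin
      · refine hL0.cont.mono ?_
        rintro u ⟨hu, hf⟩
        have h1 : u ∈ closure (Iic t₀) := hf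
        rw [isClosed_Iic.closure_eq] at h1
        exact ⟨hu.1, h1⟩
      · intro u hu
        have h1 : u ∈ closure {a | t₀ < a} := by simpa only [not_le] using hu.2
        have h2 := closure_lt_subset_le continuous_const continuous_id h1
        exact (hgd u ⟨h2, hu.1.2⟩).continuousAt.continuousWithinAt
    · simp [ht₀01.1, hL0.zero]
    · intro u hu
      by_cases hle : u ≤ t₀
      · simp only [hle, if_true]; exact hL0.mem u ⟨hu.1, hle⟩
      · simp only [hle, if_false]; exact ball_subset_disk (hηB (hin u (hcase u hu hle))).2.2.1
    · intro u hu
      by_cases hle : u ≤ t₀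
      · simp only [hle, if_true]; exact hL0.proj_eq u ⟨hu.1, hle⟩
      · simp only [hle, if_false]; exact hproj u (hcase u hu hle)
    · intro u hu
      by_cases hle : u ≤ t₀
      · simp only [hle, if_true]; exact hL0.normal_le u ⟨hu.1, hle⟩
      · simp only [hle, if_false]
        have e1 := hNinc u (hcase u hu hle)
        have e2 := hL0.normal_le t₀ (hmem _)
        rw [hjoin] at e2
        have e3 := norm_sub_le_norm_sub_add_norm_sub (unitNormal F (g u)) (unitNormal F (g t₀)) (unitNormal F q)
        have : 3 * C * ‖ξ‖ * u = 3 * C * ‖ξ‖ * (u - t₀) + 3 * C * ‖ξ‖ * t₀ := by ring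
        rw [this]
        exact e3.trans (add_le_add e1 e2)
    · intro u hu
      by_cases hle : u ≤ t₀
      · simp only [hle, if_true]; exact hL0.norm_le u ⟨hu.1, hle⟩
      · simp only [hle, if_false]
        have e1 := hFinc u (hcase u hu hle)
        have e2 := hL0.norm_le t₀ (hmem _)
        rw [hjoin] at e2
        have e3 := norm_sub_le_norm_sub_add_norm_sub (F (g u)) (F (g t₀)) (F q)
        have : 2 * ‖ξ‖ * u = 2 * ‖ξ‖ * (u - t₀) + 2 * ‖ξ‖ * t₀ := by ring
        rw [this]
        exact e3.trans (add_le_add e1 e2)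
  have hT'S : T' ∈ S := ⟨⟨hT01.1.trans hTT', min_le_right _ _⟩, _, hnew⟩
  have h1 : T' ≤ T := le_csSup hSb hT'S
  have h2 : T' = 1 := by
    rcases min_choice (T + η / 2) 1 with h | h
    · rw [← hT'] at h; linarith
    · exact h
  rw [h2] at hnew
  exact ⟨_, hnew⟩

end Lift

section Chart

variable {F : Plane → Space} {h C L : ℝ} {a₁ a₂ ν : Space} {q : Plane} {ρ r : ℝ}

/-- Near every interior point, at a scale that depends only on the curvature bound and on the
distance to the boundary, the surface is a graph over any plane close to its tangent plane. -/
theorem exists_chart (A : IsAdmissible F h C L) (hC : 0 < C) (H : IsFrame a₁ a₂ ν)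
    (hr : IsSmallRadius C ρ r) (hq : q ∈ disk) (hqL : ‖F q‖ ≤ L - ρ)
    (hqν : 19 / 20 ≤ inner ℝ (unitNormal F q) ν) :
    ∃ σ, IsChart F C L a₁ a₂ ν q r σ := by
  have hlift : ∀ ξ : ball (0 : Plane) r, ∃ c, IsRayLift F C a₁ a₂ q ξ.1 1 c := fun ξ =>
    exists_rayLift A hC H hr hq hqL hqν (mem_ball_zero_iff.mp ξ.2)
  choose c hc using hlift
  have hb : ∀ (ξ : ball (0 : Plane) r) (t : ℝ), t ∈ Icc (0 : ℝ) 1 →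
      c ξ t ∈ ball (0 : Plane) 1 ∧ 9 / 10 < inner ℝ (unitNormal F (c ξ t)) ν ∧ ‖F (c ξ t)‖ < L :=
    fun ξ t ht => bounds_of_close A hC H hr hqL hqν (mem_ball_zero_iff.mp ξ.2) ht ((hc ξ).mem t ht)
      ((hc ξ).normal_le t ht) ((hc ξ).norm_le t ht)
  -- the projection is a local homeomorphism on the region of small tilt
  set M : Set Plane := {p | p ∈ ball (0 : Plane) 1 ∧ 9 / 10 < inner ℝ (unitNormal F p) ν} with hM
  have hMo : IsOpen M := by
    rw [isOpen_iff_mem_nhds]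
    rintro p ⟨hp1, hp2⟩
    have : ContinuousAt (fun x => inner ℝ (unitNormal F x) ν) p :=
      (A.contDiffAt_normal (ball_subset_disk hp1)).continuousAt.inner continuousAt_const
    exact (isOpen_ball.eventually_mem hp1).and (this.eventually (lt_mem_nhds hp2))
  have hloc : IsLocalHomeomorphOn (fun x => proj a₁ a₂ (F x)) M := by
    apply IsLocalHomeomorphOn.mk
    rintro p ⟨hp1, hp2⟩
    obtain ⟨Φ, h1, h2, -⟩ := exists_local_inverse A.smooth (A.inj (ball_subset_disk hp1)) H
      (by linarith : inner ℝ (unitNormal F p) ν ≠ 0)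
    exact ⟨Φ, h1, fun x _ => (h2 x).symm⟩
  -- The end points of the lifts depend continuously on the ray, by the theorem on lifts of homotopies
  -- through a separated local homeomorphism.
  set π : M → Plane := fun p => proj a₁ a₂ (F p.1) with hπ
  have hπloc : IsLocalHomeomorph π := by
    rw [isLocalHomeomorph_iff_isLocalHomeomorphOn_univ]
    exact hloc.comp (hMo.isOpenEmbedding_subtypeVal.isLocalHomeomorph.isLocalHomeomorphOn.mono
      (subset_univ _)) (fun x _ => x.2)
  set f : C(unitInterval × ball (0 : Plane) r, Plane) :=
    ⟨fun x => proj a₁ a₂ (F q) + (x.1 : ℝ) • x.2.1, by fun_prop⟩ with hf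
  set g : unitInterval × ball (0 : Plane) r → M := fun x =>
    ⟨c x.2 x.1, (hb x.2 x.1 x.1.2).1, (hb x.2 x.1 x.1.2).2.1⟩ with hg
  have hgc : Continuous g := by
    apply hπloc.continuous_lift (T2Space.isSeparatedMap π) f
    · ext1 x
      exact (hc x.2).proj_eq x.1 x.1.2
    · have : ∀ ξ : ball (0 : Plane) r, c ξ ((0 : unitInterval) : ℝ) = q := fun ξ => (hc ξ).zero
      refine Continuous.subtype_mk ?_ _
      simp only [this]
      exact continuous_const
    · intro ξ
      refine Continuous.subtype_mk ?_ _
      exact (hc ξ).cont.comp_continuous continuous_subtype_val (fun t => t.2)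
  classical
  set σ : Plane → Plane := fun ξ => if hξ : ξ ∈ ball (0 : Plane) r then c ⟨ξ, hξ⟩ 1 else q with hσ
  have hσe : ∀ ξ (hξ : ξ ∈ ball (0 : Plane) r), σ ξ = c ⟨ξ, hξ⟩ 1 := fun ξ hξ => dif_pos hξ
  have hσc : ContinuousOn σ (ball (0 : Plane) r) := by
    rw [continuousOn_iff_continuous_domRestrict]
    have h1 : Continuous (fun ξ : ball (0 : Plane) r => (g (1, ξ)).1) := by fun_prop
    refine h1.congr fun ξ => ?_
    exact (hσe ξ.1 ξ.2).symm
  have h11 : (1 : ℝ) ∈ Icc (0 : ℝ) 1 := by simp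
  have hproj : ∀ ξ ∈ ball (0 : Plane) r, proj a₁ a₂ (F (σ ξ)) = proj a₁ a₂ (F q) + ξ := by
    intro ξ hξ
    rw [hσe ξ hξ, (hc _).proj_eq 1 h11, one_smul]
  have hmem : ∀ ξ ∈ ball (0 : Plane) r, σ ξ ∈ ball (0 : Plane) 1 := fun ξ hξ => by
    rw [hσe ξ hξ]; exact (hb _ 1 h11).1
  have htilt : ∀ ξ ∈ ball (0 : Plane) r, 9 / 10 < inner ℝ (unitNormal F (σ ξ)) ν := fun ξ hξ => by
    rw [hσe ξ hξ]; exact (hb _ 1 h11).2.1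
  refine ⟨σ, ?_, ?_, hmem, hproj, htilt, ?_, ?_, ?_⟩
  · have h0 : (0 : Plane) ∈ ball (0 : Plane) r := by simpa using hr.1
    have := (hc ⟨0, h0⟩).norm_le 1 h11
    simp only [norm_zero, mul_zero, zero_mul, norm_le_zero_iff, sub_eq_zero] at this
    rw [hσe 0 h0]
    exact A.embedded.injOn (ball_subset_disk (hb _ 1 h11).1) hq this
  · intro ξ hξ
    obtain ⟨Φ, h1, h2, h3⟩ := exists_local_inverse A.smooth (A.inj (ball_subset_disk (hmem ξ hξ))) H
      (by linarith [htilt ξ hξ] : inner ℝ (unitNormal F (σ ξ)) ν ≠ 0)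
    rw [hproj ξ hξ] at h3
    have h4 : ContDiffAt ℝ ∞ (fun η : Plane => Φ.symm (proj a₁ a₂ (F q) + η)) ξ :=
      ContDiffAt.comp ξ h3 (by fun_prop)
    refine h4.congr_of_eventuallyEq ?_
    have h5 : ContinuousAt σ ξ := hσc.continuousAt (isOpen_ball.mem_nhds hξ)
    filter_upwards [isOpen_ball.mem_nhds hξ, h5.eventually (Φ.open_source.eventually_mem h1)]
      with η hη1 hη2
    rw [← hproj η hη1, ← h2, Φ.left_inv hη2]
  · intro ξ hξ
    rw [hσe ξ hξ]
    simpa using (hc _).normal_le 1 h11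
  · intro ξ hξ
    rw [hσe ξ hξ]
    simpa using (hc _).norm_le 1 h11
  · intro ξ hξ
    rw [hσe ξ hξ]; exact (hb _ 1 h11).2.2

theorem exists_nhds_injOn_proj (A : IsAdmissible F h C L) (H : IsFrame a₁ a₂ ν) {p : Plane}
    (hp : p ∈ disk) (hν : inner ℝ (unitNormal F p) ν ≠ 0) :
    ∃ U ∈ nhds p, InjOn (fun x => proj a₁ a₂ (F x)) U := by
  obtain ⟨Φ, h1, h2, -⟩ := exists_local_inverse A.smooth (A.inj hp) H hν
  refine ⟨Φ.source, Φ.open_source.mem_nhds h1, fun x hx y hy hxy => Φ.injOn hx hy ?_⟩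
  rw [h2, h2]; exact hxy

namespace IsChart

variable {σ : Plane → Plane} (X : IsChart F C L a₁ a₂ ν q r σ)
include X

theorem disk_mem {ξ : Plane} (hξ : ξ ∈ ball (0 : Plane) r) : σ ξ ∈ disk :=
  ball_subset_disk (X.mem ξ hξ)

theorem continuousOn : ContinuousOn σ (ball (0 : Plane) r) := fun ξ hξ =>
  (X.smooth ξ hξ).continuousAt.continuousWithinAt

theorem locallyInjective (A : IsAdmissible F h C L) (H : IsFrame a₁ a₂ ν) {ξ : Plane}
    (hξ : ξ ∈ ball (0 : Plane) r) : ∃ U ∈ nhds (σ ξ), InjOn (fun x => proj a₁ a₂ (F x)) U :=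
  exists_nhds_injOn_proj A H (X.disk_mem hξ) (by linarith [X.tilt ξ hξ])

/-- Two graph charts over the same disk that meet have the same base point. -/
theorem base_eq_of_meet (A : IsAdmissible F h C L) (H : IsFrame a₁ a₂ ν) {q' : Plane}
    {σ' : Plane → Plane} (X' : IsChart F C L a₁ a₂ ν q' r σ')
    (hqq : proj a₁ a₂ (F q) = proj a₁ a₂ (F q')) {ξ : Plane} (hξ : ξ ∈ ball (0 : Plane) r)
    (hm : σ ξ = σ' ξ) : q = q' := by
  have h1 := eqOn_of_lift (convex_ball (0 : Plane) r).isPreconnected X.continuousOn X'.continuousOn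
    (f := fun x => proj a₁ a₂ (F x)) (fun η hη => X.locallyInjective A H hη)
    (fun η hη => by rw [X.proj_eq η hη, X'.proj_eq η hη, hqq]) hξ hm
  have h0 : (0 : Plane) ∈ ball (0 : Plane) r := by
    simp only [mem_ball, dist_zero_right, norm_zero] at hξ ⊢
    exact (norm_nonneg ξ).trans_lt hξ
  rw [← X.zero, ← X'.zero]
  exact h1 h0

/-- A path in the surface whose projection stays over the disk of a chart, and which meets the
chart, stays in the chart. -/
theorem path_mem (A : IsAdmissible F h C L) (H : IsFrame a₁ a₂ ν) {γ : ℝ → Plane} {s : Set ℝ}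
    (hs : IsPreconnected s) (hγ : ContinuousOn γ s)
    (hclose : ∀ u ∈ s, ‖F (γ u) - F q‖ < r) {u₀ : ℝ} (hu₀ : u₀ ∈ s)
    (h0 : σ (proj a₁ a₂ (F (γ u₀) - F q)) = γ u₀) {u : ℝ} (hu : u ∈ s) :
    γ u = σ (proj a₁ a₂ (F (γ u) - F q)) := by
  have hball : ∀ u ∈ s, proj a₁ a₂ (F (γ u) - F q) ∈ ball (0 : Plane) r := fun u hu => by
    simpa using (H.norm_proj_le _).trans_lt (hclose u hu)
  have hFγ : ContinuousOn (fun u => F (γ u)) s := A.smooth.continuous.comp_continuousOn hγ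
  have hP : ContinuousOn (fun u => proj a₁ a₂ (F (γ u) - F q)) s :=
    (proj a₁ a₂).continuous.comp_continuousOn (hFγ.sub continuousOn_const)
  refine (eqOn_of_lift hs (X.continuousOn.comp hP hball) hγ (f := fun x => proj a₁ a₂ (F x))
    (fun u hu => X.locallyInjective A H (hball u hu)) (fun u hu => ?_) hu₀ h0 hu).symm
  simp only [Function.comp_apply]
  rw [X.proj_eq _ (hball u hu), map_sub]; abel

theorem hasFDerivAt (A : IsAdmissible F h C L) {ξ : Plane} (hξ : ξ ∈ ball (0 : Plane) r) :
    HasFDerivAt (fun η => F (σ η)) ((fderiv ℝ F (σ ξ)).comp (fderiv ℝ σ ξ)) ξ :=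
  (show HasFDerivAt F (fderiv ℝ F (σ ξ)) (σ ξ) from
    (A.smooth.contDiffAt.differentiableAt (by simp)).hasFDerivAt).comp ξ
    ((X.smooth ξ hξ).differentiableAt (by simp)).hasFDerivAt

theorem hasFDerivAt_normal (A : IsAdmissible F h C L) {ξ : Plane} (hξ : ξ ∈ ball (0 : Plane) r) :
    HasFDerivAt (fun η => unitNormal F (σ η))
      ((fderiv ℝ (unitNormal F) (σ ξ)).comp (fderiv ℝ σ ξ)) ξ :=
  (show HasFDerivAt (unitNormal F) (fderiv ℝ (unitNormal F) (σ ξ)) (σ ξ) from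
    ((A.contDiffAt_normal (X.disk_mem hξ)).differentiableAt (by simp)).hasFDerivAt).comp ξ
    ((X.smooth ξ hξ).differentiableAt (by simp)).hasFDerivAt

theorem proj_fderiv (A : IsAdmissible F h C L) {ξ : Plane} (hξ : ξ ∈ ball (0 : Plane) r)
    (w : Plane) : proj a₁ a₂ (fderiv ℝ F (σ ξ) (fderiv ℝ σ ξ w)) = w := by
  have h1 := (proj a₁ a₂).hasFDerivAt.comp ξ (X.hasFDerivAt A hξ)
  have h2 : HasFDerivAt (fun η : Plane => proj a₁ a₂ (F q) + η) (ContinuousLinearMap.id ℝ Plane) ξ :=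
    (hasFDerivAt_id ξ).const_add _
  have h3 : (fun η => proj a₁ a₂ (F (σ η))) =ᶠ[nhds ξ] fun η => proj a₁ a₂ (F q) + η := by
    filter_upwards [isOpen_ball.mem_nhds hξ] with η hη using X.proj_eq η hη
  have h4 := h1.unique (h2.congr_of_eventuallyEq h3)
  exact congrArg (fun T : Plane →L[ℝ] Plane => T w) h4

theorem norm_fderiv_le (A : IsAdmissible F h C L) (H : IsFrame a₁ a₂ ν) {ξ : Plane}
    (hξ : ξ ∈ ball (0 : Plane) r) (w : Plane) :
    ‖fderiv ℝ F (σ ξ) (fderiv ℝ σ ξ w)‖ ≤ 10 / 9 * ‖w‖ := by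
  have := norm_fderiv_le_of_tilt (v := fderiv ℝ σ ξ w) H (A.inj (X.disk_mem hξ)) (X.tilt ξ hξ)
  rwa [X.proj_fderiv A hξ] at this

theorem norm_fderiv_normal_le (A : IsAdmissible F h C L) (hC : 0 < C) (H : IsFrame a₁ a₂ ν)
    {ξ : Plane} (hξ : ξ ∈ ball (0 : Plane) r) (w : Plane) :
    ‖fderiv ℝ (unitNormal F) (σ ξ) (fderiv ℝ σ ξ w)‖ ≤ 20 / 9 * C * ‖w‖ := by
  have h1 := A.norm_fderiv_normal_le hC.le (X.disk_mem hξ) (X.norm_lt ξ hξ) (fderiv ℝ σ ξ w)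
  have h2 := X.norm_fderiv_le A H hξ w
  nlinarith

/-- Over its own tangent plane, the surface is a graph of quadratically small height. -/
theorem height_le (A : IsAdmissible F h C L) (hC : 0 < C) (H : IsFrame a₁ a₂ ν)
    (hν : unitNormal F q = ν) {ξ : Plane} (hξ : ξ ∈ ball (0 : Plane) r) :
    |inner ℝ (F (σ ξ) - F q) ν| ≤ 4 * C * ‖ξ‖ ^ 2 := by
  have hξ' : ‖ξ‖ < r := by simpa using hξ
  have hmem : ∀ t ∈ Icc (0 : ℝ) 1, t • ξ ∈ ball (0 : Plane) r := by
    intro t ht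
    simp only [mem_ball, dist_zero_right, norm_smul, Real.norm_of_nonneg ht.1]
    nlinarith [norm_nonneg ξ, ht.2]
  have hd : ∀ t ∈ Icc (0 : ℝ) 1, HasDerivAt (fun t : ℝ => inner ℝ (F (σ (t • ξ)) - F q) ν)
      (inner ℝ (fderiv ℝ F (σ (t • ξ)) (fderiv ℝ σ (t • ξ) ξ)) ν) t := by
    intro t ht
    have h1 : HasDerivAt (fun t : ℝ => t • ξ) ξ t := by
      simpa using (hasDerivAt_id t).smul_const ξ
    have h2 := (X.hasFDerivAt A (hmem t ht)).comp_hasDerivAt t h1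
    have h3 := (h2.sub_const (F q)).inner ℝ (hasDerivAt_const t ν)
    simpa using h3
  have hb : ∀ t ∈ Icc (0 : ℝ) 1, ‖inner ℝ (fderiv ℝ F (σ (t • ξ)) (fderiv ℝ σ (t • ξ) ξ)) ν‖ ≤
      4 * C * ‖ξ‖ ^ 2 := by
    intro t ht
    set w := fderiv ℝ F (σ (t • ξ)) (fderiv ℝ σ (t • ξ) ξ) with hw
    set n := unitNormal F (σ (t • ξ)) with hn
    have h1 : inner ℝ w ν = -inner ℝ w (n - ν) := by
      have : inner ℝ n w = 0 := inner_unitNormal_fderiv F _ _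
      rw [inner_sub_right, real_inner_comm n w, this]; ring
    have h2 := abs_real_inner_le_norm w (n - ν)
    have h3 := X.norm_fderiv_le A H (hmem t ht) ξ
    have h4 := X.normal_le _ (hmem t ht)
    rw [hν] at h4
    have h5 : ‖t • ξ‖ ≤ ‖ξ‖ := by
      rw [norm_smul, Real.norm_of_nonneg ht.1]; nlinarith [norm_nonneg ξ, ht.2]
    rw [Real.norm_eq_abs, h1, abs_neg]
    have h6 : ‖n - ν‖ ≤ 3 * C * ‖ξ‖ := h4.trans (by gcongr)
    calc |inner ℝ w (n - ν)| ≤ ‖w‖ * ‖n - ν‖ := h2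
      _ ≤ (10 / 9 * ‖ξ‖) * (3 * C * ‖ξ‖) := by gcongr
      _ ≤ 4 * C * ‖ξ‖ ^ 2 := by nlinarith [mul_nonneg hC.le (sq_nonneg ‖ξ‖)]
  have := (convex_Icc (0 : ℝ) 1).norm_image_sub_le_of_norm_hasDerivWithin_le
    (fun t ht => (hd t ht).hasDerivWithinAt) hb (left_mem_Icc.2 zero_le_one)
    (right_mem_Icc.2 zero_le_one)
  simpa [X.zero] using this

end IsChart

end Chart

/-! ### The constant mean curvature equation for graphs -/

theorem IsFrame.inner_cross_normal {a₁ a₂ ν : Space} (H : IsFrame a₁ a₂ ν) (u v : Space) :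
    inner ℝ (cross u v) ν = inner ℝ u a₁ * inner ℝ v a₂ - inner ℝ u a₂ * inner ℝ v a₁ := by
  rw [← H.hc, inner_cross_cross]

/-- The height over the plane orthogonal to `ν` through `b` of the graph chart `σ`. -/
def height (F : Plane → Space) (σ : Plane → Plane) (b ν : Space) (ξ : Plane) : ℝ :=
  inner ℝ (F (σ ξ) - b) ν

/-- The principal part of the equation of graphs of prescribed mean curvature, frozen at the
gradient `(a, b)`, applied to `v`. -/
def graphOp (a b : ℝ) (v : Plane → ℝ) (ξ : Plane) : ℝ :=
  pd 0 (pd 0 v) ξ + pd 1 (pd 1 v) ξ + (b ^ 2 * pd 0 (pd 0 v) ξ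
    - a * b * (pd 1 (pd 0 v) ξ + pd 0 (pd 1 v) ξ) + a ^ 2 * pd 1 (pd 1 v) ξ)

section Height

variable {F : Plane → Space} {h C L : ℝ} {a₁ a₂ ν : Space} {q : Plane} {r : ℝ} {σ : Plane → Plane}

namespace IsChart

theorem contDiffAt_height (X : IsChart F C L a₁ a₂ ν q r σ) (A : IsAdmissible F h C L) (b : Space)
    {ξ : Plane} (hξ : ξ ∈ ball (0 : Plane) r) : ContDiffAt ℝ ∞ (height F σ b ν) ξ := by
  have h1 : ContDiffAt ℝ ∞ (fun η => F (σ η)) ξ := A.smooth.contDiffAt.comp ξ (X.smooth ξ hξ)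
  exact (h1.sub contDiffAt_const).inner ℝ contDiffAt_const

theorem fderiv_height (X : IsChart F C L a₁ a₂ ν q r σ) (A : IsAdmissible F h C L) (b : Space)
    {ξ : Plane} (hξ : ξ ∈ ball (0 : Plane) r) (w : Plane) :
    fderiv ℝ (height F σ b ν) ξ w = inner ℝ (fderiv ℝ F (σ ξ) (fderiv ℝ σ ξ w)) ν := by
  have h1 := ((X.hasFDerivAt A hξ).sub_const b).inner ℝ (hasFDerivAt_const ν ξ)
  have h2 : HasFDerivAt (height F σ b ν) _ ξ := h1
  rw [h2.fderiv]
  simp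

/-- The part along the plane of a tangent vector of the graph. -/
theorem fderiv_graph (X : IsChart F C L a₁ a₂ ν q r σ) (A : IsAdmissible F h C L)
    {ξ : Plane} (hξ : ξ ∈ ball (0 : Plane) r) (w : Plane) :
    inner ℝ (fderiv ℝ F (σ ξ) (fderiv ℝ σ ξ w)) a₁ = w 0 ∧
    inner ℝ (fderiv ℝ F (σ ξ) (fderiv ℝ σ ξ w)) a₂ = w 1 := by
  have h1 := X.proj_fderiv A hξ w
  exact ⟨congrArg (fun v : Plane => v 0) h1, congrArg (fun v : Plane => v 1) h1⟩

/-- The normal of the graph is proportional to `ν - f₀ a₁ - f₁ a₂`, where `f` is the height. -/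
theorem normal_eq (X : IsChart F C L a₁ a₂ ν q r σ) (A : IsAdmissible F h C L)
    (H : IsFrame a₁ a₂ ν) (b : Space) {ξ : Plane} (hξ : ξ ∈ ball (0 : Plane) r) (i : Fin 2) :
    inner ℝ (unitNormal F (σ ξ)) (![a₁, a₂] i) +
      pd i (height F σ b ν) ξ * inner ℝ (unitNormal F (σ ξ)) ν = 0 := by
  have h1 := inner_unitNormal_fderiv F (σ ξ) (fderiv ℝ σ ξ (EuclideanSpace.single i 1))
  obtain ⟨h2, h3⟩ := X.fderiv_graph A hξ (EuclideanSpace.single i 1)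
  rw [H.inner_eq, h2, h3, ← X.fderiv_height A b hξ] at h1
  rw [← h1]
  fin_cases i <;> simp [pd] <;> ring

/-- The derivative of `IsChart.normal_eq`: the derivative of the normal determines the second
derivatives of the height. -/
theorem fderiv_normal_eq (X : IsChart F C L a₁ a₂ ν q r σ) (A : IsAdmissible F h C L)
    (H : IsFrame a₁ a₂ ν) (b : Space) {ξ : Plane} (hξ : ξ ∈ ball (0 : Plane) r) (i : Fin 2)
    (w : Plane) :
    inner ℝ (fderiv ℝ (unitNormal F) (σ ξ) (fderiv ℝ σ ξ w)) (![a₁, a₂] i) +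
      (fderiv ℝ (pd i (height F σ b ν)) ξ w * inner ℝ (unitNormal F (σ ξ)) ν +
      pd i (height F σ b ν) ξ *
        inner ℝ (fderiv ℝ (unitNormal F) (σ ξ) (fderiv ℝ σ ξ w)) ν) = 0 := by
  have hN := X.hasFDerivAt_normal A hξ
  have hf : DifferentiableAt ℝ (pd i (height F σ b ν)) ξ := by
    have h1 : ContDiffAt ℝ 1 (fderiv ℝ (height F σ b ν)) ξ :=
      (X.contDiffAt_height A b hξ).fderiv_right (m := 1) (WithTop.coe_le_coe.2 le_top)
    exact (h1.clm_apply contDiffAt_const).differentiableAt (by simp)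
  have h1 := (hN.inner ℝ (hasFDerivAt_const (![a₁, a₂] i) ξ)).add
    (hf.hasFDerivAt.mul (hN.inner ℝ (hasFDerivAt_const ν ξ)))
  have h2 : HasFDerivAt (fun _ : Plane => (0 : ℝ)) (0 : Plane →L[ℝ] ℝ) ξ := hasFDerivAt_const _ _
  have h3 := h1.unique (h2.congr_of_eventuallyEq (by
    filter_upwards [isOpen_ball.mem_nhds hξ] with η hη using X.normal_eq A H b hη i))
  have h4 := congrArg (fun T : Plane →L[ℝ] ℝ => T w) h3
  simp at h4
  linarith

/-- The slope bound: the third component of the normal determines the length of the gradient. -/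
theorem normal_sq_mul (X : IsChart F C L a₁ a₂ ν q r σ) (A : IsAdmissible F h C L)
    (H : IsFrame a₁ a₂ ν) (b : Space) {ξ : Plane} (hξ : ξ ∈ ball (0 : Plane) r) :
    inner ℝ (unitNormal F (σ ξ)) ν ^ 2 *
      (1 + pd 0 (height F σ b ν) ξ ^ 2 + pd 1 (height F σ b ν) ξ ^ 2) = 1 := by
  have h0 := X.normal_eq A H b hξ 0
  have h1 := X.normal_eq A H b hξ 1
  have hn := H.norm_sq (unitNormal F (σ ξ))
  rw [norm_unitNormal (A.inj (X.disk_mem hξ))] at hn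
  simp at h0 h1
  have e0 : inner ℝ (unitNormal F (σ ξ)) a₁ = -(pd 0 (height F σ b ν) ξ * inner ℝ (unitNormal F (σ ξ)) ν) := by linarith
  have e1 : inner ℝ (unitNormal F (σ ξ)) a₂ = -(pd 1 (height F σ b ν) ξ * inner ℝ (unitNormal F (σ ξ)) ν) := by linarith
  rw [e0, e1] at hn
  linarith

theorem grad_sq_le (X : IsChart F C L a₁ a₂ ν q r σ) (A : IsAdmissible F h C L)
    (H : IsFrame a₁ a₂ ν) (b : Space) {ξ : Plane} (hξ : ξ ∈ ball (0 : Plane) r) :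
    pd 0 (height F σ b ν) ξ ^ 2 + pd 1 (height F σ b ν) ξ ^ 2 ≤ 1 / 4 := by
  have h1 := X.normal_sq_mul A H b hξ
  have h2 := X.tilt ξ hξ
  by_contra! hc
  nlinarith

theorem abs_pd_height_le (X : IsChart F C L a₁ a₂ ν q r σ) (A : IsAdmissible F h C L)
    (H : IsFrame a₁ a₂ ν) (b : Space) {ξ : Plane} (hξ : ξ ∈ ball (0 : Plane) r) (i : Fin 2) :
    |pd i (height F σ b ν) ξ| ≤ 1 / 2 := by
  have := X.grad_sq_le A H b hξ
  apply abs_le_of_sq_le_sq _ (by norm_num)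
  fin_cases i <;> simp <;>
    nlinarith [sq_nonneg (pd 0 (height F σ b ν) ξ), sq_nonneg (pd 1 (height F σ b ν) ξ)]

theorem abs_pd_pd_height_le (X : IsChart F C L a₁ a₂ ν q r σ) (A : IsAdmissible F h C L)
    (hC : 0 < C) (H : IsFrame a₁ a₂ ν) (b : Space) {ξ : Plane} (hξ : ξ ∈ ball (0 : Plane) r)
    (i j : Fin 2) : |pd j (pd i (height F σ b ν)) ξ| ≤ 4 * C := by
  have h1 := X.fderiv_normal_eq A H b hξ i (EuclideanSpace.single j 1)
  have h2 := X.norm_fderiv_normal_le A hC H hξ (EuclideanSpace.single j 1)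
  have h3 := X.tilt ξ hξ
  have h4 := X.abs_pd_height_le A H b hξ i
  set u := fderiv ℝ (unitNormal F) (σ ξ) (fderiv ℝ σ ξ (EuclideanSpace.single j 1))
  have e1 : |inner ℝ u (![a₁, a₂] i)| ≤ 20 / 9 * C := by
    have := abs_real_inner_le_norm u (![a₁, a₂] i)
    have ha : ‖(![a₁, a₂] i)‖ = 1 := by
      have := H.h11; have := H.h22
      rw [real_inner_self_eq_norm_sq] at *
      fin_cases i <;> simp <;> nlinarith [norm_nonneg a₁, norm_nonneg a₂]
    rw [ha] at this
    simp at h2; linarith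
  have e2 : |inner ℝ u ν| ≤ 20 / 9 * C := by
    have := abs_real_inner_le_norm u ν
    rw [H.norm_eq] at this
    simp at h2; linarith
  have e3 : |pd i (height F σ b ν) ξ * inner ℝ u ν| ≤ 1 / 2 * (20 / 9 * C) := by
    rw [abs_mul]; gcongr
  change _ + (pd j (pd i (height F σ b ν)) ξ * _ + _) = 0 at h1
  have e4 : |pd j (pd i (height F σ b ν)) ξ| * inner ℝ (unitNormal F (σ ξ)) ν ≤ 10 / 3 * C := by
    rw [← abs_of_pos (show 0 < inner ℝ (unitNormal F (σ ξ)) ν by linarith), ← abs_mul]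
    have : pd j (pd i (height F σ b ν)) ξ * inner ℝ (unitNormal F (σ ξ)) ν =
      -(inner ℝ u (![a₁, a₂] i) + pd i (height F σ b ν) ξ * inner ℝ u ν) := by linarith
    rw [this, abs_neg]
    have := abs_add_le (inner ℝ u (![a₁, a₂] i)) (pd i (height F σ b ν) ξ * inner ℝ u ν)
    linarith
  have := abs_nonneg (pd j (pd i (height F σ b ν)) ξ)
  nlinarith

/-- The equation of a graph of constant mean curvature. -/
theorem graphOp_height (X : IsChart F C L a₁ a₂ ν q r σ) (A : IsAdmissible F h C L)
    (H : IsFrame a₁ a₂ ν) (b : Space) {ξ : Plane} (hξ : ξ ∈ ball (0 : Plane) r) :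
    inner ℝ (unitNormal F (σ ξ)) ν * graphOp (pd 0 (height F σ b ν) ξ) (pd 1 (height F σ b ν) ξ)
      (height F σ b ν) ξ =
      h * (1 + pd 0 (height F σ b ν) ξ ^ 2 + pd 1 (height F σ b ν) ξ ^ 2) := by
  have hi := A.inj (X.disk_mem hξ)
  have hc := cross_fderiv_unitNormal A.smooth hi
    (fderiv ℝ σ ξ (EuclideanSpace.single 0 1)) (fderiv ℝ σ ξ (EuclideanSpace.single 1 1))
  rw [A.cmc _ (X.disk_mem hξ)] at hc
  have hc' := congrArg (fun x => inner ℝ x ν) hc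
  obtain ⟨g1, g2⟩ := X.fderiv_graph A hξ (EuclideanSpace.single 0 1)
  obtain ⟨g3, g4⟩ := X.fderiv_graph A hξ (EuclideanSpace.single 1 1)
  simp only [inner_add_left, real_inner_smul_left, H.inner_cross_normal, g1, g2, g3, g4] at hc'
  have d00 := X.fderiv_normal_eq A H b hξ 0 (EuclideanSpace.single 0 1)
  have d01 := X.fderiv_normal_eq A H b hξ 0 (EuclideanSpace.single 1 1)
  have d10 := X.fderiv_normal_eq A H b hξ 1 (EuclideanSpace.single 0 1)
  have d11 := X.fderiv_normal_eq A H b hξ 1 (EuclideanSpace.single 1 1)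
  have o0 := inner_fderiv_unitNormal_self A.smooth hi (fderiv ℝ σ ξ (EuclideanSpace.single 0 1))
  have o1 := inner_fderiv_unitNormal_self A.smooth hi (fderiv ℝ σ ξ (EuclideanSpace.single 1 1))
  have h0 := X.normal_eq A H b hξ 0
  have h1 := X.normal_eq A H b hξ 1
  rw [H.inner_eq] at o0 o1
  set n := unitNormal F (σ ξ)
  set u₀ := fderiv ℝ (unitNormal F) (σ ξ) (fderiv ℝ σ ξ (EuclideanSpace.single 0 1))
  set u₁ := fderiv ℝ (unitNormal F) (σ ξ) (fderiv ℝ σ ξ (EuclideanSpace.single 1 1))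
  set f := height F σ b ν
  have hn3 : inner ℝ n ν ≠ 0 := by linarith [X.tilt ξ hξ]
  change _ + (pd 0 (pd 0 f) ξ * _ + _) = 0 at d00
  change _ + (pd 1 (pd 0 f) ξ * _ + _) = 0 at d01
  change _ + (pd 0 (pd 1 f) ξ * _ + _) = 0 at d10
  change _ + (pd 1 (pd 1 f) ξ * _ + _) = 0 at d11
  simp at hc' d00 d01 d10 d11 h0 h1
  set n3 := inner ℝ n ν
  set z0 := pd 0 f ξ
  set z1 := pd 1 f ξ
  have e0 : inner ℝ n a₁ = -(z0 * n3) := by linarith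
  have e1 : inner ℝ n a₂ = -(z1 * n3) := by linarith
  rw [e0, e1] at o0 o1
  have p0 : inner ℝ u₀ ν = z0 * inner ℝ u₀ a₁ + z1 * inner ℝ u₀ a₂ := by
    apply mul_right_cancel₀ hn3; linarith
  have p1 : inner ℝ u₁ ν = z0 * inner ℝ u₁ a₁ + z1 * inner ℝ u₁ a₂ := by
    apply mul_right_cancel₀ hn3; linarith
  have x00 : inner ℝ u₀ a₁ = -(pd 0 (pd 0 f) ξ * n3) - z0 * inner ℝ u₀ ν := by linarith
  have x01 : inner ℝ u₁ a₁ = -(pd 1 (pd 0 f) ξ * n3) - z0 * inner ℝ u₁ ν := by linarith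
  have x10 : inner ℝ u₀ a₂ = -(pd 0 (pd 1 f) ξ * n3) - z1 * inner ℝ u₀ ν := by linarith
  have x11 : inner ℝ u₁ a₂ = -(pd 1 (pd 1 f) ξ * n3) - z1 * inner ℝ u₁ ν := by linarith
  have q0 : inner ℝ u₀ ν * (1 + z0 ^ 2 + z1 ^ 2) =
      -(n3 * (z0 * pd 0 (pd 0 f) ξ + z1 * pd 0 (pd 1 f) ξ)) := by
    rw [x00, x10] at p0; linear_combination p0
  have q1 : inner ℝ u₁ ν * (1 + z0 ^ 2 + z1 ^ 2) =
      -(n3 * (z0 * pd 1 (pd 0 f) ξ + z1 * pd 1 (pd 1 f) ξ)) := by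
    rw [x01, x11] at p1; linear_combination p1
  have hh : h = n3 * (pd 0 (pd 0 f) ξ + pd 1 (pd 1 f) ξ) + z0 * inner ℝ u₀ ν + z1 * inner ℝ u₁ ν := by
    rw [x00, x11] at hc'; linear_combination -hc'
  rw [graphOp, hh]
  linear_combination -z0 * q0 - z1 * q1

end IsChart

/-- The properties of the difference `v` of the heights of two sheets of the surface over the same
disk of radius `R`: it is Lipschitz and satisfies an elliptic differential inequality without a
term of order zero. -/
structure IsSheetGap (K R : ℝ) (v : Plane → ℝ) : Prop where
  smooth : ∀ ξ ∈ ball (0 : Plane) R, ContDiffAt ℝ 2 v ξ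
  lip : ∀ ξ ∈ ball (0 : Plane) R, ∀ i, |pd i v ξ| ≤ 1
  ineq : ∀ ξ ∈ ball (0 : Plane) R, ∃ a b : ℝ, |a| ≤ 1 ∧ |b| ≤ 1 ∧
    |graphOp a b v ξ| ≤ K * (|pd 0 v ξ| + |pd 1 v ξ|)

theorem IsAdmissible.abs_le (A : IsAdmissible F h C L) (hC : 0 < C) {p : Plane} (hp : p ∈ disk)
    (hL : ‖F p‖ < L) : |h| ≤ 3 * C := by
  have h1 := sq_meanCurvature_le A.smooth (A.inj hp)
  rw [A.cmc p hp] at h1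
  have h2 := A.curvature_le p hp (by simpa using hL)
  apply abs_le_of_sq_le_sq _ (by positivity)
  nlinarith [sq_nonneg C]

theorem pd_sub {f g : Plane → ℝ} {ξ : Plane} (hf : DifferentiableAt ℝ f ξ)
    (hg : DifferentiableAt ℝ g ξ) (i : Fin 2) :
    pd i (fun η => f η - g η) ξ = pd i f ξ - pd i g ξ := by
  unfold pd; rw [fderiv_fun_sub hf hg]; rfl

theorem differentiableAt_pd {f : Plane → ℝ} {ξ : Plane} (hf : ContDiffAt ℝ 2 f ξ) (i : Fin 2) :
    DifferentiableAt ℝ (pd i f) ξ := by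
  have h1 : ContDiffAt ℝ 1 (fderiv ℝ f) ξ := hf.fderiv_right (m := 1) (by norm_num)
  exact (h1.clm_apply contDiffAt_const).differentiableAt (by simp)

theorem pd_pd_sub {f g : Plane → ℝ} {ξ : Plane} (hf : ContDiffAt ℝ 2 f ξ)
    (hg : ContDiffAt ℝ 2 g ξ) (i j : Fin 2) :
    pd j (pd i (fun η => f η - g η)) ξ = pd j (pd i f) ξ - pd j (pd i g) ξ := by
  have h1 : pd i (fun η => f η - g η) =ᶠ[nhds ξ] fun η => pd i f η - pd i g η := by
    filter_upwards [hf.eventually (by simp), hg.eventually (by simp)] with η h1 h2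
    exact pd_sub (h1.differentiableAt (by simp)) (h2.differentiableAt (by simp)) i
  rw [pd, h1.fderiv_eq]
  exact pd_sub (differentiableAt_pd hf i) (differentiableAt_pd hg i) j

/-- The function `(1 + |z|²)^{3/2}` is Lipschitz on the gradients of small length; `a` and `b` are
the values of `(1 + |z|²)^{1/2}` at two of them. -/
theorem abs_sub_cube_le {a b z0 z1 y0 y1 : ℝ} (ha : 1 ≤ a) (hb : 1 ≤ b) (ha' : a ≤ 10 / 9)
    (hb' : b ≤ 10 / 9) (ea : a ^ 2 = 1 + z0 ^ 2 + z1 ^ 2) (eb : b ^ 2 = 1 + y0 ^ 2 + y1 ^ 2)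
    (hz0 : |z0| ≤ 1 / 2) (hz1 : |z1| ≤ 1 / 2) (hy0 : |y0| ≤ 1 / 2) (hy1 : |y1| ≤ 1 / 2) :
    |a ^ 3 - b ^ 3| ≤ 2 * (|z0 - y0| + |z1 - y1|) := by
  have h1 : |a ^ 2 - b ^ 2| ≤ |z0 - y0| + |z1 - y1| := by
    have : a ^ 2 - b ^ 2 = (z0 - y0) * (z0 + y0) + (z1 - y1) * (z1 + y1) := by rw [ea, eb]; ring
    rw [this]
    refine (abs_add_le _ _).trans ?_
    rw [abs_mul, abs_mul]
    have e0 : |z0 + y0| ≤ 1 := (abs_add_le _ _).trans (by linarith)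
    have e1 : |z1 + y1| ≤ 1 := (abs_add_le _ _).trans (by linarith)
    nlinarith [abs_nonneg (z0 - y0), abs_nonneg (z1 - y1)]
  have h2 : |a ^ 2 - b ^ 2| = |a - b| * (a + b) := by
    rw [show a ^ 2 - b ^ 2 = (a - b) * (a + b) by ring, abs_mul, abs_of_pos (by linarith : 0 < a + b)]
  have h3 : |a ^ 3 - b ^ 3| = |a - b| * (a ^ 2 + a * b + b ^ 2) := by
    rw [show a ^ 3 - b ^ 3 = (a - b) * (a ^ 2 + a * b + b ^ 2) by ring, abs_mul,
      abs_of_pos (by positivity : 0 < a ^ 2 + a * b + b ^ 2)]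
  have h4 : a ^ 2 + a * b + b ^ 2 ≤ 4 := by nlinarith
  rw [h3]
  have := abs_nonneg (a - b)
  nlinarith

/-- The algebra of the difference of two solutions of the graph equation: `y, z` are the two
gradients, `fᵢⱼ, gᵢⱼ` the second derivatives, `n, m` the third components of the normals. -/
theorem abs_graph_difference_le {C h n m y0 y1 z0 z1 f00 f01 f10 f11 g00 g01 g10 g11 : ℝ}
    (hh : |h| ≤ 3 * C) (t1 : 9 / 10 < n) (t2 : 9 / 10 < m)
    (m1 : n ^ 2 * (1 + y0 ^ 2 + y1 ^ 2) = 1) (m2 : m ^ 2 * (1 + z0 ^ 2 + z1 ^ 2) = 1)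
    (b0 : |y0| ≤ 1 / 2) (b1 : |y1| ≤ 1 / 2) (c0 : |z0| ≤ 1 / 2) (c1 : |z1| ≤ 1 / 2)
    (hf00 : |f00| ≤ 4 * C) (hf01 : |f01| ≤ 4 * C) (hf10 : |f10| ≤ 4 * C) (hf11 : |f11| ≤ 4 * C)
    (e1 : n * (f00 + f11 + (y1 ^ 2 * f00 - y0 * y1 * (f01 + f10) + y0 ^ 2 * f11)) =
      h * (1 + y0 ^ 2 + y1 ^ 2))
    (e2 : m * (g00 + g11 + (z1 ^ 2 * g00 - z0 * z1 * (g01 + g10) + z0 ^ 2 * g11)) =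
      h * (1 + z0 ^ 2 + z1 ^ 2)) :
    |g00 - f00 + (g11 - f11) + (z1 ^ 2 * (g00 - f00) - z0 * z1 * (g01 - f01 + (g10 - f10)) +
      z0 ^ 2 * (g11 - f11))| ≤ 14 * C * (|z0 - y0| + |z1 - y1|) := by
  have hn : 0 < n := by linarith
  have hm : 0 < m := by linarith
  have hC : 0 ≤ C := by linarith [abs_nonneg h]
  have hinv : ∀ x w : ℝ, 9 / 10 < x → 0 ≤ w → x ^ 2 * (1 + w) = 1 →
      1 ≤ x⁻¹ ∧ x⁻¹ ≤ 10 / 9 ∧ x⁻¹ ^ 2 = 1 + w := by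
    intro x w hx hw hxw
    have hx0 : 0 < x := by linarith
    refine ⟨?_, ?_, ?_⟩
    · rw [one_le_inv₀ hx0]; nlinarith
    · rw [inv_le_comm₀ hx0 (by norm_num)]; norm_num; linarith
    · field_simp; linarith
  obtain ⟨i1, i2, i3⟩ := hinv n (y0 ^ 2 + y1 ^ 2) t1 (by positivity) (by linarith)
  obtain ⟨j1, j2, j3⟩ := hinv m (z0 ^ 2 + z1 ^ 2) t2 (by positivity) (by linarith)
  have hcube := abs_sub_cube_le (z0 := z0) (z1 := z1) (y0 := y0) (y1 := y1) j1 i1 j2 i2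
    (by linarith) (by linarith) c0 c1 b0 b1
  -- Since `n (1 + |y|²)^{1/2} = 1`, the equation prescribes the mean curvature operator.
  have E1 : f00 + f11 + (y1 ^ 2 * f00 - y0 * y1 * (f01 + f10) + y0 ^ 2 * f11) = h * n⁻¹ ^ 3 := by
    apply mul_left_cancel₀ hn.ne'
    rw [e1, show n * (h * n⁻¹ ^ 3) = h * n⁻¹ ^ 2 * (n * n⁻¹) by ring, i3, mul_inv_cancel₀ hn.ne']
    ring
  have E2 : g00 + g11 + (z1 ^ 2 * g00 - z0 * z1 * (g01 + g10) + z0 ^ 2 * g11) = h * m⁻¹ ^ 3 := by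
    apply mul_left_cancel₀ hm.ne'
    rw [e2, show m * (h * m⁻¹ ^ 3) = h * m⁻¹ ^ 2 * (m * m⁻¹) by ring, j3, mul_inv_cancel₀ hm.ne']
    ring
  -- The coefficients of the operator are frozen at `z`, and the error falls on the second derivatives
  -- of the first graph.
  have key : g00 - f00 + (g11 - f11) + (z1 ^ 2 * (g00 - f00) - z0 * z1 * (g01 - f01 + (g10 - f10)) +
      z0 ^ 2 * (g11 - f11)) = h * (m⁻¹ ^ 3 - n⁻¹ ^ 3) + (-((z1 ^ 2 - y1 ^ 2) * f00)
        + ((z0 * z1 - y0 * y1) * (f01 + f10) + -((z0 ^ 2 - y0 ^ 2) * f11))) := by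
    linear_combination E2 - E1
  rw [key]
  set D0 := |z0 - y0| with hD0e
  set D1 := |z1 - y1| with hD1e
  have hD0 : 0 ≤ D0 := abs_nonneg _
  have hD1 : 0 ≤ D1 := abs_nonneg _
  have k1 : |z1 ^ 2 - y1 ^ 2| ≤ D1 := by
    rw [show z1 ^ 2 - y1 ^ 2 = (z1 - y1) * (z1 + y1) by ring, abs_mul]
    exact mul_le_of_le_one_right hD1 ((abs_add_le _ _).trans (by linarith))
  have k0 : |z0 ^ 2 - y0 ^ 2| ≤ D0 := by
    rw [show z0 ^ 2 - y0 ^ 2 = (z0 - y0) * (z0 + y0) by ring, abs_mul]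
    exact mul_le_of_le_one_right hD0 ((abs_add_le _ _).trans (by linarith))
  have k01 : |z0 * z1 - y0 * y1| ≤ D0 * (1 / 2) + 1 / 2 * D1 := by
    rw [show z0 * z1 - y0 * y1 = (z0 - y0) * z1 + y0 * (z1 - y1) by ring]
    refine (abs_add_le _ _).trans ?_
    rw [abs_mul, abs_mul]
    gcongr
  have B1 : |h * (m⁻¹ ^ 3 - n⁻¹ ^ 3)| ≤ 3 * C * (2 * (D0 + D1)) := by
    rw [abs_mul]; gcongr
  have B2 : |-((z1 ^ 2 - y1 ^ 2) * f00)| ≤ D1 * (4 * C) := by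
    rw [abs_neg, abs_mul]; gcongr
  have B3 : |-((z0 ^ 2 - y0 ^ 2) * f11)| ≤ D0 * (4 * C) := by
    rw [abs_neg, abs_mul]; gcongr
  have B4 : |(z0 * z1 - y0 * y1) * (f01 + f10)| ≤
      (D0 * (1 / 2) + 1 / 2 * D1) * (4 * C + 4 * C) := by
    rw [abs_mul]
    gcongr
    exact (abs_add_le _ _).trans (add_le_add hf01 hf10)
  calc _ ≤ |h * (m⁻¹ ^ 3 - n⁻¹ ^ 3)| + (|-((z1 ^ 2 - y1 ^ 2) * f00)| +
        (|(z0 * z1 - y0 * y1) * (f01 + f10)| + |-((z0 ^ 2 - y0 ^ 2) * f11)|)) :=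
        (abs_add_le _ _).trans (by gcongr; exact (abs_add_le _ _).trans (by gcongr; exact abs_add_le _ _))
    _ ≤ 3 * C * (2 * (D0 + D1)) + (D1 * (4 * C) +
        ((D0 * (1 / 2) + 1 / 2 * D1) * (4 * C + 4 * C) + D0 * (4 * C))) := by gcongr
    _ = 14 * C * (D0 + D1) := by ring

/-- Two graphs of the same constant mean curvature differ by a solution of an elliptic inequality in
which the mean curvature no longer appears. -/
theorem isSheetGap_height (A : IsAdmissible F h C L) (hC : 0 < C) (H : IsFrame a₁ a₂ ν) (b : Space)
    {q' : Plane} {σ' : Plane → Plane} (X : IsChart F C L a₁ a₂ ν q r σ)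
    (X' : IsChart F C L a₁ a₂ ν q' r σ') :
    IsSheetGap (14 * C) r (fun ξ => height F σ' b ν ξ - height F σ b ν ξ) := by
  have hle : (2 : ℕ∞ω) ≤ (∞ : ℕ∞ω) := WithTop.coe_le_coe.2 le_top
  have s1 := fun ξ (hξ : ξ ∈ ball (0 : Plane) r) => (X'.contDiffAt_height A b hξ).of_le hle
  have s2 := fun ξ (hξ : ξ ∈ ball (0 : Plane) r) => (X.contDiffAt_height A b hξ).of_le hle
  refine ⟨fun ξ hξ => (s1 ξ hξ).sub (s2 ξ hξ), ?_, ?_⟩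
  · intro ξ hξ i
    rw [pd_sub ((s1 ξ hξ).differentiableAt (by simp)) ((s2 ξ hξ).differentiableAt (by simp))]
    have h1 := X.abs_pd_height_le A H b hξ i
    have h2 := X'.abs_pd_height_le A H b hξ i
    exact (abs_sub _ _).trans (by linarith)
  · intro ξ hξ
    have b0 := X.abs_pd_height_le A H b hξ 0
    have b1 := X.abs_pd_height_le A H b hξ 1
    have c0 := X'.abs_pd_height_le A H b hξ 0
    have c1 := X'.abs_pd_height_le A H b hξ 1
    refine ⟨pd 0 (height F σ' b ν) ξ, pd 1 (height F σ' b ν) ξ, by linarith, by linarith, ?_⟩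
    have hh : |h| ≤ 3 * C := A.abs_le hC (X.disk_mem hξ) (X.norm_lt ξ hξ)
    have e1 := X.graphOp_height A H b hξ
    have e2 := X'.graphOp_height A H b hξ
    have m1 := X.normal_sq_mul A H b hξ
    have m2 := X'.normal_sq_mul A H b hξ
    have t1 := X.tilt ξ hξ
    have t2 := X'.tilt ξ hξ
    have f00 := X.abs_pd_pd_height_le A hC H b hξ 0 0
    have f01 := X.abs_pd_pd_height_le A hC H b hξ 0 1
    have f10 := X.abs_pd_pd_height_le A hC H b hξ 1 0
    have f11 := X.abs_pd_pd_height_le A hC H b hξ 1 1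
    have dd := fun i j => pd_pd_sub (s1 ξ hξ) (s2 ξ hξ) i j
    have d := fun i => pd_sub ((s1 ξ hξ).differentiableAt (by simp))
      ((s2 ξ hξ).differentiableAt (by simp)) i
    unfold graphOp at e1 e2 ⊢
    rw [dd, dd, dd, dd, d, d]
    exact abs_graph_difference_le hh t1 t2 m1 m2 b0 b1 c0 c1 f00 f01 f10 f11 e1 e2

end Height

/-! ### A quantitative strong maximum principle -/

/-- The necessary second order condition at a local minimum. -/
theorem second_derivative_nonneg {w : Plane → ℝ} {x : Plane} (hw : ContDiffAt ℝ 2 w x)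
    (hmin : IsLocalMin w x) (s t : ℝ) :
    0 ≤ s ^ 2 * pd 0 (pd 0 w) x + s * t * (pd 1 (pd 0 w) x + pd 0 (pd 1 w) x)
      + t ^ 2 * pd 1 (pd 1 w) x := by
  set d : Plane := WithLp.toLp 2 ![s, t] with hd
  set ℓ : ℝ → Plane := fun u => x + u • d with hℓ
  have hℓ0 : ℓ 0 = x := by simp [hℓ]
  have hℓd : ∀ u, HasDerivAt ℓ d u := fun u => by
    simpa [hℓ] using ((hasDerivAt_id u).smul_const d).const_add x
  have hℓc : ContinuousAt ℓ 0 := (hℓd 0).continuousAt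
  set g : ℝ → ℝ := fun u => w (ℓ u) with hg
  have hgmin : IsLocalMin g 0 := by
    have : ∀ᶠ y in nhds (ℓ 0), w x ≤ w y := by rw [hℓ0]; exact hmin
    have h2 := hℓc.eventually this
    simpa [IsLocalMin, IsMinFilter, hg, hℓ0] using h2
  have hev : ∀ᶠ u in nhds (0 : ℝ), HasDerivAt g (s * pd 0 w (ℓ u) + t * pd 1 w (ℓ u)) u := by
    have h1 : ∀ᶠ y in nhds (ℓ 0), ContDiffAt ℝ 2 w y := by rw [hℓ0]; exact hw.eventually (by simp)
    filter_upwards [hℓc.eventually h1] with u hu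
    have h2 := (hu.differentiableAt (by simp)).hasFDerivAt.comp_hasDerivAt u (hℓd u)
    rw [fderiv_eq_pd] at h2
    exact h2.congr_deriv (by simp [hd])
  have hderiv : deriv g =ᶠ[nhds 0] fun u => s * pd 0 w (ℓ u) + t * pd 1 w (ℓ u) :=
    hev.mono fun u hu => hu.deriv
  have hp : ∀ i, HasDerivAt (fun u => pd i w (ℓ u)) (s * pd 0 (pd i w) x + t * pd 1 (pd i w) x) 0 := by
    intro i
    have h1 : DifferentiableAt ℝ (pd i w) (ℓ 0) := by rw [hℓ0]; exact differentiableAt_pd hw i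
    have h2 := h1.hasFDerivAt.comp_hasDerivAt 0 (hℓd 0)
    rw [fderiv_eq_pd, hℓ0] at h2
    exact h2.congr_deriv (by simp [hd])
  have hdd : deriv (deriv g) 0 = s * (s * pd 0 (pd 0 w) x + t * pd 1 (pd 0 w) x)
      + t * (s * pd 0 (pd 1 w) x + t * pd 1 (pd 1 w) x) := by
    rw [hderiv.deriv_eq]
    exact (((hp 0).const_mul s).add ((hp 1).const_mul t)).deriv
  -- A minimum with negative second derivative would be a maximum too, and `g` locally constant.
  by_contra! hneg
  have hlt : deriv (deriv g) 0 < 0 := by rw [hdd]; linarith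
  have hmax := isLocalMax_of_deriv_deriv_neg hlt hgmin.deriv_eq_zero hev.self_of_nhds.continuousAt
  have hconst : g =ᶠ[nhds 0] fun _ => g 0 := by
    filter_upwards [hgmin, hmax] with u h1 h2 using le_antisymm h2 h1
  have h1 : deriv g =ᶠ[nhds 0] fun _ => (0 : ℝ) := by
    have := hconst.deriv
    simpa using this
  rw [h1.deriv_eq] at hlt
  simp at hlt

/-- The Hopf barrier `c e^{-λ |ξ - y|²} - k`. -/
def hopf (y : Plane) (c l k : ℝ) (ξ : Plane) : ℝ :=
  c * Real.exp (-l * ((ξ 0 - y 0) ^ 2 + (ξ 1 - y 1) ^ 2)) - k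

theorem hasFDerivAt_coord (i : Fin 2) (y ξ : Plane) :
    HasFDerivAt (fun η : Plane => η i - y i) (EuclideanSpace.proj i : Plane →L[ℝ] ℝ) ξ :=
  (EuclideanSpace.proj i : Plane →L[ℝ] ℝ).hasFDerivAt.sub_const _

theorem contDiff_hopf (y : Plane) (c l k : ℝ) : ContDiff ℝ ∞ (hopf y c l k) := by
  have h : ∀ i : Fin 2, ContDiff ℝ ∞ (fun η : Plane => η i) := fun i =>
    (EuclideanSpace.proj i : Plane →L[ℝ] ℝ).contDiff
  have h0 := h 0
  have h1 := h 1
  unfold hopf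
  fun_prop

theorem hasFDerivAt_gauss (y : Plane) (l : ℝ) (ξ : Plane) :
    HasFDerivAt (fun ξ : Plane => Real.exp (-l * ((ξ 0 - y 0) ^ 2 + (ξ 1 - y 1) ^ 2)))
      (Real.exp (-l * ((ξ 0 - y 0) ^ 2 + (ξ 1 - y 1) ^ 2)) •
        ((-2 * l * (ξ 0 - y 0)) • (EuclideanSpace.proj 0 : Plane →L[ℝ] ℝ) +
         (-2 * l * (ξ 1 - y 1)) • (EuclideanSpace.proj 1 : Plane →L[ℝ] ℝ))) ξ := by
  have h0 := (hasFDerivAt_coord 0 y ξ).pow 2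
  have h1 := (hasFDerivAt_coord 1 y ξ).pow 2
  refine ((h0.add h1).const_mul (-l)).exp.congr_fderiv ?_
  ext v
  simp
  ring

theorem pd_hopf (y : Plane) (c l k : ℝ) (ξ : Plane) (i : Fin 2) :
    pd i (hopf y c l k) ξ = -2 * l * (ξ i - y i) *
      (c * Real.exp (-l * ((ξ 0 - y 0) ^ 2 + (ξ 1 - y 1) ^ 2))) := by
  have h := ((hasFDerivAt_gauss y l ξ).const_mul c).sub_const k
  have h' : HasFDerivAt (hopf y c l k) _ ξ := h
  rw [pd, h'.fderiv]
  fin_cases i <;> simp <;> ring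

theorem pd_pd_hopf (y : Plane) (c l k : ℝ) (ξ : Plane) (i j : Fin 2) :
    pd j (pd i (hopf y c l k)) ξ =
      (4 * l ^ 2 * (ξ i - y i) * (ξ j - y j) - 2 * l * (if i = j then 1 else 0)) *
      (c * Real.exp (-l * ((ξ 0 - y 0) ^ 2 + (ξ 1 - y 1) ^ 2))) := by
  have h0 : pd i (hopf y c l k) = fun ξ => -2 * l * (ξ i - y i) *
      (c * Real.exp (-l * ((ξ 0 - y 0) ^ 2 + (ξ 1 - y 1) ^ 2))) := by
    ext ξ; exact pd_hopf y c l k ξ i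
  have h := ((hasFDerivAt_coord i y ξ).const_mul (-2 * l)).mul ((hasFDerivAt_gauss y l ξ).const_mul c)
  rw [h0]
  unfold pd
  have h' : HasFDerivAt (fun ξ : Plane => -2 * l * (ξ i - y i) *
      (c * Real.exp (-l * ((ξ 0 - y 0) ^ 2 + (ξ 1 - y 1) ^ 2)))) _ ξ := h
  rw [h'.fderiv]
  fin_cases i <;> fin_cases j <;> simp <;> ring

/-- With `λ` large enough in terms of `K`, `R` and `r₀`, the barrier is a strict subsolution outside
the disk of radius `r₀`. -/
theorem graphOp_hopf_gt {K R r₀ a b c l k : ℝ} {y ξ : Plane} (hK : 0 ≤ K) (hR : 0 < R) (hc : 0 < c)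
    (hr₀ : 0 < r₀) (hl : l = (4 + K * R) / r₀ ^ 2) (ha : |a| ≤ 1) (hb : |b| ≤ 1)
    (h1 : r₀ < ‖ξ - y‖) (h2 : ‖ξ - y‖ < R / 2) :
    K * (|pd 0 (hopf y c l k) ξ| + |pd 1 (hopf y c l k) ξ|) < graphOp a b (hopf y c l k) ξ := by
  have hsq : ‖ξ - y‖ ^ 2 = (ξ 0 - y 0) ^ 2 + (ξ 1 - y 1) ^ 2 := by
    rw [plane_norm_sq]; simp
  rw [graphOp]
  simp only [pd_hopf, pd_pd_hopf]
  simp only [if_true, if_neg (by decide : ¬ (0 : Fin 2) = 1), if_neg (by decide : ¬ (1 : Fin 2) = 0)]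
  set E := c * Real.exp (-l * ((ξ 0 - y 0) ^ 2 + (ξ 1 - y 1) ^ 2)) with hE
  have hEpos : 0 < E := by positivity
  set x0 := ξ 0 - y 0
  set x1 := ξ 1 - y 1
  have hlpos : 0 < l := by rw [hl]; positivity
  have hlr : l * r₀ ^ 2 = 4 + K * R := by rw [hl]; field_simp
  have hs : r₀ ^ 2 < x0 ^ 2 + x1 ^ 2 := by rw [← hsq]; gcongr
  have hx0 : |x0| ≤ R / 2 := by
    apply abs_le_of_sq_le_sq _ (by positivity)
    have : ‖ξ - y‖ ^ 2 ≤ (R / 2) ^ 2 := by gcongr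
    nlinarith [sq_nonneg x1]
  have hx1 : |x1| ≤ R / 2 := by
    apply abs_le_of_sq_le_sq _ (by positivity)
    have : ‖ξ - y‖ ^ 2 ≤ (R / 2) ^ 2 := by gcongr
    nlinarith [sq_nonneg x0]
  have habs : ∀ x : ℝ, |-2 * l * x * E| = 2 * l * E * |x| := fun x => by
    rw [abs_mul, abs_mul, abs_mul, abs_of_pos hEpos, abs_of_pos hlpos]; norm_num; ring
  rw [habs, habs]
  have ha2 : a ^ 2 ≤ 1 := by rw [← sq_abs]; nlinarith [abs_nonneg a]
  have hb2 : b ^ 2 ≤ 1 := by rw [← sq_abs]; nlinarith [abs_nonneg b]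
  have lower : 2 * l * E * (2 * l * r₀ ^ 2 - 4) <
      (4 * l ^ 2 * x0 * x0 - 2 * l * 1) * E + (4 * l ^ 2 * x1 * x1 - 2 * l * 1) * E +
      (b ^ 2 * ((4 * l ^ 2 * x0 * x0 - 2 * l * 1) * E) - a * b * ((4 * l ^ 2 * x0 * x1 - 2 * l * 0) * E +
        (4 * l ^ 2 * x1 * x0 - 2 * l * 0) * E) + a ^ 2 * ((4 * l ^ 2 * x1 * x1 - 2 * l * 1) * E)) := by
    have e : (4 * l ^ 2 * x0 * x0 - 2 * l * 1) * E + (4 * l ^ 2 * x1 * x1 - 2 * l * 1) * E +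
      (b ^ 2 * ((4 * l ^ 2 * x0 * x0 - 2 * l * 1) * E) - a * b * ((4 * l ^ 2 * x0 * x1 - 2 * l * 0) * E +
        (4 * l ^ 2 * x1 * x0 - 2 * l * 0) * E) + a ^ 2 * ((4 * l ^ 2 * x1 * x1 - 2 * l * 1) * E)) =
        2 * l * E * (2 * l * (x0 ^ 2 + x1 ^ 2 + (b * x0 - a * x1) ^ 2) - (2 + a ^ 2 + b ^ 2)) := by ring
    rw [e]
    apply mul_lt_mul_of_pos_left _ (by positivity)
    nlinarith [sq_nonneg (b * x0 - a * x1), mul_nonneg hlpos.le (sq_nonneg (b * x0 - a * x1))]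
  refine lt_of_le_of_lt ?_ lower
  have : K * (2 * l * E * |x0| + 2 * l * E * |x1|) = 2 * l * E * (K * (|x0| + |x1|)) := by ring
  rw [this]
  apply mul_le_mul_of_nonneg_left _ (by positivity)
  have : K * (|x0| + |x1|) ≤ K * R := by gcongr; linarith
  nlinarith [mul_nonneg hK hR.le]

theorem graphOp_sub {v β : Plane → ℝ} {x : Plane} (hv : ContDiffAt ℝ 2 v x)
    (hβ : ContDiffAt ℝ 2 β x) (a b : ℝ) :
    graphOp a b (fun η => v η - β η) x = graphOp a b v x - graphOp a b β x := by
  simp only [graphOp, pd_pd_sub hv hβ]; ring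

theorem IsSheetGap.lipschitz {K R : ℝ} {v : Plane → ℝ} (G : IsSheetGap K R v) {x y : Plane}
    (hx : x ∈ ball (0 : Plane) R) (hy : y ∈ ball (0 : Plane) R) : |v x - v y| ≤ 2 * ‖x - y‖ := by
  have h := (convex_ball (0 : Plane) R).norm_image_sub_le_of_norm_hasFDerivWithin_le (f := v)
    (f' := fun x => fderiv ℝ v x) (C := 2)
    (fun z hz => ((G.smooth z hz).differentiableAt (by simp)).hasFDerivAt.hasFDerivWithinAt)
    (fun z hz => ?_) hy hx
  · simpa using h
  · apply ContinuousLinearMap.opNorm_le_bound _ (by norm_num)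
    intro w
    rw [fderiv_eq_pd, Real.norm_eq_abs, smul_eq_mul, smul_eq_mul]
    refine (abs_add_le _ _).trans ?_
    rw [abs_mul, abs_mul]
    have h0 := G.lip z hz 0
    have h1 := G.lip z hz 1
    have n0 : |w 0| ≤ ‖w‖ := PiLp.norm_apply_le w 0
    have n1 : |w 1| ≤ ‖w‖ := PiLp.norm_apply_le w 1
    nlinarith [abs_nonneg (w 0), abs_nonneg (w 1)]

/-- A weak Harnack inequality: the gap between two sheets is small around every point at which it
is small, with a modulus that depends only on the structure constants. The proof compares the gap
with a Hopf barrier centred at a point where the gap is at least `m`; that the gap is Lipschitz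
keeps it above `m / 2` on a disk of definite radius around this point. -/
theorem exists_gap_lower_bound {K R m : ℝ} (hK : 0 ≤ K) (hR : 0 < R) (hm : 0 < m) :
    ∃ θ > 0, ∀ v : Plane → ℝ, IsSheetGap K R v → (∀ ξ ∈ ball (0 : Plane) R, 0 < v ξ) →
      ∀ y : Plane, ‖y‖ ≤ R / 4 → m ≤ v y → θ ≤ v 0 := by
  set r₀ := m / 4 with hr₀
  set l := (4 + K * R) / r₀ ^ 2 with hl
  have hr₀pos : 0 < r₀ := by positivity
  have hlpos : 0 < l := by positivity
  set c := m / 2 with hc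
  have hcpos : 0 < c := by positivity
  set θ := c * Real.exp (-l * (R / 4) ^ 2) - c * Real.exp (-l * (R / 2) ^ 2) with hθ
  have hexp : Real.exp (-l * (R / 2) ^ 2) < Real.exp (-l * (R / 4) ^ 2) := by
    apply Real.exp_lt_exp.mpr
    nlinarith [mul_pos hlpos (sq_pos_of_pos hR)]
  refine ⟨θ, by rw [hθ]; nlinarith, ?_⟩
  intro v G hpos y hy hmy
  have hyR : y ∈ ball (0 : Plane) R := by simp; linarith
  have h0R : (0 : Plane) ∈ ball (0 : Plane) R := by simpa using hR
  have hnear : ∀ x ∈ ball (0 : Plane) R, ‖x - y‖ ≤ r₀ → c ≤ v x := by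
    intro x hx hxy
    have := (abs_le.mp (G.lipschitz hx hyR)).1
    linarith
  set k := c * Real.exp (-l * (R / 2) ^ 2) with hk
  set β := hopf y c l k with hβ
  have hβe : ∀ x, β x = c * Real.exp (-l * ‖x - y‖ ^ 2) - k := by
    intro x
    rw [hβ, hopf, plane_norm_sq]; simp
  have hkpos : 0 < k := by positivity
  have hβc : ∀ x, β x ≤ c := by
    intro x
    rw [hβe]
    have : Real.exp (-l * ‖x - y‖ ^ 2) ≤ 1 := by
      rw [Real.exp_le_one_iff]
      nlinarith [mul_nonneg hlpos.le (sq_nonneg ‖x - y‖)]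
    nlinarith
  set S : Set Plane := closedBall y (R / 2) \ ball y r₀ with hS
  have hSc : IsCompact S := (isCompact_closedBall y (R / 2)).diff isOpen_ball
  have hSR : S ⊆ ball (0 : Plane) R := by
    rintro x ⟨hx, -⟩
    rw [mem_closedBall, dist_eq_norm] at hx
    rw [mem_ball_zero_iff]
    have := norm_sub_norm_le x y
    linarith
  have hcont : ContinuousOn (fun x => v x - β x) S := by
    intro x hx
    exact ((G.smooth x (hSR hx)).continuousAt.sub
      (contDiff_hopf y c l k).continuous.continuousAt).continuousWithinAt
  have hle2 : (2 : ℕ∞ω) ≤ (∞ : ℕ∞ω) := WithTop.coe_le_coe.2 le_top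
  -- The barrier is at most `v` on the annulus: `v - β` is nonnegative on both boundary circles, and a
  -- negative interior minimum contradicts the strict subsolution property.
  have main : ∀ x ∈ S, β x ≤ v x := by
    by_contra! hcon
    obtain ⟨x₁, hx₁, hlt₁⟩ := hcon
    obtain ⟨x, hx, hmin⟩ := hSc.exists_isMinOn ⟨x₁, hx₁⟩ hcont
    have hneg : v x - β x < 0 := by
      have : v x - β x ≤ v x₁ - β x₁ := hmin hx₁
      linarith
    have hxR := hSR hx
    have hx1 : ‖x - y‖ ≤ R / 2 := by simpa [dist_eq_norm] using hx.1
    have hx2 : r₀ ≤ ‖x - y‖ := by simpa [dist_eq_norm] using hx.2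
    have hin : r₀ < ‖x - y‖ := by
      rcases hx2.lt_or_eq with hlt | heq
      · exact hlt
      · have h1 := hnear x hxR heq.symm.le
        have h2 := hβc x
        linarith
    have hout : ‖x - y‖ < R / 2 := by
      rcases hx1.lt_or_eq with hlt | heq
      · exact hlt
      · have h1 := hpos x hxR
        have h2 := hβe x
        rw [heq] at h2
        linarith
    have hloc : IsLocalMin (fun x => v x - β x) x := by
      have h1 : ContinuousAt (fun z : Plane => ‖z - y‖) x := by fun_prop
      filter_upwards [h1.eventually (lt_mem_nhds hin), h1.eventually (gt_mem_nhds hout)] with z hz1 hz2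
      exact hmin (show z ∈ S from ⟨by rw [mem_closedBall, dist_eq_norm]; exact hz2.le,
        by rw [mem_ball, dist_eq_norm]; exact not_lt.mpr hz1.le⟩)
    have hv2 := G.smooth x hxR
    have hβ2 : ContDiffAt ℝ 2 β x := (contDiff_hopf y c l k).contDiffAt.of_le hle2
    have hw2 : ContDiffAt ℝ 2 (fun x => v x - β x) x := hv2.sub hβ2
    obtain ⟨a, b, ha, hb, hineq⟩ := G.ineq x hxR
    have hnonneg : 0 ≤ graphOp a b (fun x => v x - β x) x := by
      -- The operator is the sum of the second derivatives in the directions `e₀`, `e₁`, `(b, -a)`.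
      have e1 := second_derivative_nonneg hw2 hloc 1 0
      have e2 := second_derivative_nonneg hw2 hloc 0 1
      have e3 := second_derivative_nonneg hw2 hloc b (-a)
      rw [graphOp]; nlinarith
    rw [graphOp_sub hv2 hβ2] at hnonneg
    have hgrad : ∀ i, pd i v x = pd i β x := by
      intro i
      have h1 := pd_sub (hv2.differentiableAt (by simp)) (hβ2.differentiableAt (by simp)) i
      have h2 : pd i (fun x => v x - β x) x = 0 := by
        rw [pd, hloc.fderiv_eq_zero]; rfl
      linarith
    have hstrict := graphOp_hopf_gt (k := k) hK hR hcpos hr₀pos hl ha hb hin hout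
    rw [hgrad, hgrad] at hineq
    have := (abs_le.mp hineq).2
    linarith
  rcases lt_or_ge ‖y‖ r₀ with hlt | hge
  · have h1 := hnear 0 h0R (by simpa using hlt.le)
    have h2 : Real.exp (-l * (R / 4) ^ 2) ≤ 1 := by
      rw [Real.exp_le_one_iff]
      nlinarith [mul_nonneg hlpos.le (sq_nonneg (R / 4))]
    rw [hθ]; nlinarith
  · have h0S : (0 : Plane) ∈ S := by
      refine ⟨?_, ?_⟩
      · simp; linarith
      · simpa using hge
    have h1 := main 0 h0S
    rw [hβe] at h1
    refine le_trans ?_ h1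
    have : Real.exp (-l * (R / 4) ^ 2) ≤ Real.exp (-l * ‖(0 : Plane) - y‖ ^ 2) := by
      apply Real.exp_le_exp.mpr
      have h3 : ‖(0 : Plane) - y‖ ≤ R / 4 := by simpa using hy
      have h4 : ‖(0 : Plane) - y‖ ^ 2 ≤ (R / 4) ^ 2 := by gcongr
      nlinarith
    rw [hθ]
    have := mul_le_mul_of_nonneg_left this hcpos.le
    linarith

/-! ### Neighbouring sheets -/

section Sheets

variable {F : Plane → Space} {h C L : ℝ} {ρ r : ℝ}

/-- Nearby points of different sheets with normals in the same half space have nearly the same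
normal: otherwise the ray of steepest ascent in the second sheet would carry it through the first
one, against embeddedness. -/
theorem exists_tilt_bound (hC : 0 < C) (hr : 0 < r) {e : ℝ} (he : 0 < e) (he1 : e ≤ 1) :
    ∃ α > 0, ∀ {F : Plane → Space} {h L : ℝ}, IsAdmissible F h C L →
      ∀ {a₁ a₂ b₁ b₂ : Space} {p q : Plane} {σ τ : Plane → Plane},
      IsFrame a₁ a₂ (unitNormal F p) → IsFrame b₁ b₂ (unitNormal F q) →
      IsChart F C L a₁ a₂ (unitNormal F p) p r σ → IsChart F C L b₁ b₂ (unitNormal F q) q r τ →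
      ‖F q - F p‖ ≤ α → 0 ≤ inner ℝ (unitNormal F p) (unitNormal F q) →
      q ≠ σ (proj a₁ a₂ (F q - F p)) →
      1 - e ^ 2 ≤ inner ℝ (unitNormal F p) (unitNormal F q) := by
  set d := min (r / 4) (e / (80 * C)) with hd
  have hdpos : 0 < d := lt_min (by positivity) (by positivity)
  have hdr : d ≤ r / 4 := min_le_left _ _
  have hde : 80 * C * d ≤ e := by
    have : d ≤ e / (80 * C) := min_le_right _ _
    rw [le_div_iff₀ (by positivity)] at this; linarith
  refine ⟨d * e / 4, by positivity, ?_⟩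
  intro F h L A a₁ a₂ b₁ b₂ p q σ τ H K X Y hα hc0 hne
  by_contra! hlt
  set α := d * e / 4 with hαd
  have hαd' : α ≤ d := by rw [hαd]; nlinarith
  set n := unitNormal F p with hn
  set m := unitNormal F q with hm
  set c := inner ℝ n m with hc
  set S := Real.sqrt (1 - c ^ 2) with hS
  have hc1 : c < 1 := by nlinarith
  have hS2 : S ^ 2 = 1 - c ^ 2 := Real.sq_sqrt (by nlinarith)
  have hSe : e < S := by
    apply Real.lt_sqrt_of_sq_lt; nlinarith
  have hSpos : 0 < S := by linarith
  -- the direction of steepest ascent in the second tangent plane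
  obtain ⟨w, hw⟩ : ∃ w, w = S⁻¹ • (n - c • m) := ⟨_, rfl⟩
  have hnn : inner ℝ n n = 1 := H.h33
  have hmm : inner ℝ m m = 1 := K.h33
  have hmn : inner ℝ m n = c := by rw [real_inner_comm]
  have hwm : inner ℝ w m = 0 := by
    rw [hw, real_inner_smul_left, inner_sub_left, real_inner_smul_left, hmm, ← hc]; ring
  have hwn : inner ℝ w n = S := by
    rw [hw, real_inner_smul_left, inner_sub_left, real_inner_smul_left, hnn, hmn]
    rw [show (1 - c * c) = S ^ 2 by rw [hS2]; ring]; field_simp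
  have hww : ‖w‖ ^ 2 = 1 := by
    have h1 : S • w = n - c • m := by
      rw [hw, smul_smul, mul_inv_cancel₀ hSpos.ne', one_smul]
    have h2 : inner ℝ w (S • w) = S := by
      rw [h1, inner_sub_right, real_inner_smul_right, hwm, hwn]; ring
    rw [real_inner_smul_right, real_inner_self_eq_norm_sq] at h2
    exact mul_left_cancel₀ hSpos.ne' (h2.trans (mul_one S).symm)
  set η := proj b₁ b₂ w with hη
  have hηn : ‖η‖ = 1 := by
    have := K.norm_sq_eq_proj w
    rw [hww, hwm] at this
    have h0 := norm_nonneg η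
    nlinarith
  have hball : ∀ t ∈ Icc (-d) d, t • η ∈ ball (0 : Plane) r := by
    intro t ht
    rw [mem_ball_zero_iff, norm_smul, hηn, mul_one, Real.norm_eq_abs]
    have := abs_le.mpr ht
    linarith
  set x : ℝ → Space := fun t => F (τ (t • η)) with hx
  have hτc : ContinuousOn (fun t : ℝ => τ (t • η)) (Icc (-d) d) :=
    Y.continuousOn.comp (by fun_prop) hball
  have hxc : ContinuousOn x (Icc (-d) d) := A.smooth.continuous.comp_continuousOn hτc
  have hclose : ∀ t ∈ Icc (-d) d, ‖x t - F p‖ ≤ 3 * d := by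
    intro t ht
    have h1 := Y.norm_le _ (hball t ht)
    rw [norm_smul, hηn, mul_one, Real.norm_eq_abs] at h1
    have h2 := abs_le.mpr ht
    have h3 := norm_sub_le_norm_sub_add_norm_sub (x t) (F q) (F p)
    change ‖x t - F q‖ ≤ _ at h1
    linarith
  have hclose' : ∀ t ∈ Icc (-d) d, ‖x t - F p‖ < r := fun t ht => by
    have := hclose t ht; linarith
  have hξball : ∀ t ∈ Icc (-d) d, proj a₁ a₂ (x t - F p) ∈ ball (0 : Plane) r := fun t ht => by
    rw [mem_ball_zero_iff]; exact (H.norm_proj_le _).trans_lt (hclose' t ht)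
  -- Along the ray the height over the first tangent plane grows like `t S`, up to a quadratic error.
  have hexp : ∀ t ∈ Icc (-d) d, |inner ℝ (x t - F p) n - t * S| ≤ α + 4 * C * d ^ 2 := by
    intro t ht
    have h1 := Y.height_le A hC K rfl (hball t ht)
    have hp : proj b₁ b₂ (x t - F q) = t • η := by
      rw [map_sub, Y.proj_eq _ (hball t ht)]; abel
    have h2 : x t - F q = t • w + inner ℝ (x t - F q) m • m := by
      apply K.eq_of_proj_eq
      · have hpm : proj b₁ b₂ m = 0 := plane_ext (by simp [K.h31]) (by simp [K.h32])
        rw [hp, map_add, map_smul, map_smul, hpm]; simp [hη]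
      · rw [inner_add_left, real_inner_smul_left, real_inner_smul_left, hwm, hmm]; ring
    have h3 : inner ℝ (x t - F p) n - t * S = inner ℝ (F q - F p) n + inner ℝ (x t - F q) m * c := by
      have : x t - F p = (x t - F q) + (F q - F p) := by abel
      rw [this, inner_add_left, h2, inner_add_left, real_inner_smul_left, real_inner_smul_left, hwn, hmn]
      rw [← h2]; ring
    rw [h3]
    have h4 : |inner ℝ (F q - F p) n| ≤ α := by
      have := abs_real_inner_le_norm (F q - F p) n
      rw [H.norm_eq, mul_one] at this; linarith
    have h5 : |inner ℝ (x t - F q) m * c| ≤ 4 * C * d ^ 2 := by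
      rw [abs_mul, abs_of_nonneg hc0]
      have h6 : ‖t • η‖ ^ 2 ≤ d ^ 2 := by
        rw [norm_smul, hηn, mul_one, Real.norm_eq_abs]
        have := abs_le.mpr ht
        gcongr
      have h7 : |inner ℝ (x t - F q) m| ≤ 4 * C * d ^ 2 := h1.trans (by gcongr)
      have := abs_nonneg (inner ℝ (x t - F q) m)
      nlinarith
    exact (abs_add_le _ _).trans (add_le_add h4 h5)
  -- `k` is the height of the second sheet over the first one; it changes its sign along the ray.
  set k : ℝ → ℝ := fun t => inner ℝ (x t - F p) n -
    inner ℝ (F (σ (proj a₁ a₂ (x t - F p))) - F p) n with hk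
  have hkc : ContinuousOn k (Icc (-d) d) := by
    have h1 : ContinuousOn (fun t => x t - F p) (Icc (-d) d) := hxc.sub continuousOn_const
    have h2 : ContinuousOn (fun t => F (σ (proj a₁ a₂ (x t - F p)))) (Icc (-d) d) :=
      A.smooth.continuous.comp_continuousOn
        (X.continuousOn.comp ((proj a₁ a₂).continuous.comp_continuousOn h1) hξball)
    exact (h1.inner continuousOn_const).sub ((h2.sub continuousOn_const).inner continuousOn_const)
  have hkb : ∀ t ∈ Icc (-d) d, |k t - t * S| ≤ α + 40 * C * d ^ 2 := by
    intro t ht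
    have h1 := X.height_le A hC H rfl (hξball t ht)
    have h2 := hexp t ht
    have h3 : ‖proj a₁ a₂ (x t - F p)‖ ^ 2 ≤ (3 * d) ^ 2 := by
      gcongr; exact (H.norm_proj_le _).trans (hclose t ht)
    have h4 : |inner ℝ (F (σ (proj a₁ a₂ (x t - F p))) - F p) n| ≤ 4 * C * (3 * d) ^ 2 :=
      h1.trans (by gcongr)
    have h5 : k t - t * S = (inner ℝ (x t - F p) n - t * S) +
      -inner ℝ (F (σ (proj a₁ a₂ (x t - F p))) - F p) n := by rw [hk]; ring
    rw [h5]
    refine (abs_add_le _ _).trans ?_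
    rw [abs_neg]; linarith
  have hsmall : α + 40 * C * d ^ 2 < d * S := by
    have h1 := mul_le_mul_of_nonneg_left hde hdpos.le
    have h2 := mul_lt_mul_of_pos_left hSe hdpos
    have h3 : 0 < d * e := by positivity
    linarith
  have hIl : (-d) ∈ Icc (-d) d := ⟨le_rfl, by linarith⟩
  have hIr : d ∈ Icc (-d) d := ⟨by linarith, le_rfl⟩
  have hk1 : k (-d) ≤ 0 := by have := (abs_le.mp (hkb _ hIl)).2; linarith
  have hk2 : 0 ≤ k d := by have := (abs_le.mp (hkb _ hIr)).1; linarith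
  obtain ⟨t₀, ht₀, hk0⟩ := intermediate_value_Icc (by linarith) hkc ⟨hk1, hk2⟩
  -- the two sheets meet at the parameter `t₀`
  have hmeet : F (σ (proj a₁ a₂ (x t₀ - F p))) = x t₀ := by
    apply H.eq_of_proj_eq
    · rw [X.proj_eq _ (hξball t₀ ht₀), map_sub]; abel
    · have : inner ℝ (x t₀ - F p) n - inner ℝ (F (σ (proj a₁ a₂ (x t₀ - F p))) - F p) n = 0 := hk0
      rw [inner_sub_left, inner_sub_left] at this
      linarith
  have hσ : σ (proj a₁ a₂ (x t₀ - F p)) = τ (t₀ • η) :=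
    A.embedded.injOn (X.disk_mem (hξball t₀ ht₀)) (Y.disk_mem (hball t₀ ht₀)) hmeet
  have h0 : (0 : ℝ) ∈ Icc (-d) d := ⟨by linarith, by linarith⟩
  have := X.path_mem A H (γ := fun t => τ (t • η)) isPreconnected_Icc hτc hclose' ht₀ hσ h0
  simp only [zero_smul, Y.zero] at this
  exact hne this

/-- The point with parameter `q` lies on the normal line at `p`, at the signed height `t` of the
same sign as `s`, and the normals at the two points lie in the same half space. -/
structure IsSheetAt (F : Plane → Space) (s : ℝ) (p q : Plane) (t : ℝ) : Prop where
  mem : q ∈ disk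
  eq : F q = F p + t • unitNormal F p
  sign : 0 < s * t
  pos : 0 < inner ℝ (unitNormal F p) (unitNormal F q)

theorem IsAdmissible.exists_tangent_chart (A : IsAdmissible F h C L) (hC : 0 < C)
    (hr : IsSmallRadius C ρ r) {p : Plane} (hp : p ∈ disk) (hpL : ‖F p‖ ≤ L - ρ) :
    ∃ a₁ a₂ σ, IsFrame a₁ a₂ (unitNormal F p) ∧ IsChart F C L a₁ a₂ (unitNormal F p) p r σ := by
  obtain ⟨a₁, a₂, H⟩ := exists_isFrame _ (norm_unitNormal (A.inj hp))
  obtain ⟨σ, X⟩ := exists_chart A hC H hr hp hpL (by rw [H.h33]; norm_num)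
  exact ⟨a₁, a₂, σ, H, X⟩

theorem IsFrame.proj_normal {a₁ a₂ ν : Space} (H : IsFrame a₁ a₂ ν) : proj a₁ a₂ ν = 0 :=
  plane_ext (by simp [H.h31]) (by simp [H.h32])

theorem IsSheetAt.ne {s t : ℝ} {p q : Plane} (S : IsSheetAt F s p q t) {a₁ a₂ : Space}
    (H : IsFrame a₁ a₂ (unitNormal F p)) : q ≠ p := by
  rintro rfl
  have h1 := S.eq
  have h2 : t • unitNormal F q = 0 := by simpa using h1
  rcases smul_eq_zero.mp h2 with h3 | h3
  · have := S.sign; rw [h3] at this; simp at this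
  · have := H.norm_eq; rw [h3] at this; simp at this

/-- At a sheet at small height, the two normals are close. -/
theorem exists_sheet_tilt (hC : 0 < C) (hr : IsSmallRadius C ρ r) {e : ℝ} (he : 0 < e)
    (he1 : e ≤ 1) : ∃ α > 0, ∀ {F : Plane → Space} {h L : ℝ}, IsAdmissible F h C L →
      ∀ {s t : ℝ} {p q : Plane}, p ∈ disk → ‖F p‖ ≤ L - 2 * ρ → IsSheetAt F s p q t → |t| ≤ α →
      1 - e ^ 2 ≤ inner ℝ (unitNormal F p) (unitNormal F q) := by
  obtain ⟨α, hα, hα'⟩ := exists_tilt_bound hC hr.1 he he1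
  have hρ : 0 < ρ := by linarith [hr.1, hr.2.2]
  refine ⟨min α ρ, lt_min hα hρ, ?_⟩
  intro F h L A s t p q hp hpL S ht
  obtain ⟨a₁, a₂, σ, H, X⟩ := A.exists_tangent_chart hC hr hp (by linarith)
  have hdist : ‖F q - F p‖ ≤ |t| := by
    rw [S.eq, add_sub_cancel_left, norm_smul, H.norm_eq, mul_one, Real.norm_eq_abs]
  have hqL : ‖F q‖ ≤ L - ρ := by
    have := norm_sub_norm_le (F q) (F p)
    linarith [min_le_right α ρ]
  obtain ⟨b₁, b₂, τ, K, Y⟩ := A.exists_tangent_chart hC hr S.mem hqL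
  refine hα' A H K X Y (hdist.trans (ht.trans (min_le_left _ _))) S.pos.le ?_
  have : proj a₁ a₂ (F q - F p) = 0 := by
    rw [S.eq, add_sub_cancel_left, map_smul, H.proj_normal, smul_zero]
  rw [this, X.zero]
  exact S.ne H

theorem IsFrame.inner_pos_of_tilt {a₁ a₂ ν n m : Space} (H : IsFrame a₁ a₂ ν) (hn : ‖n‖ = 1)
    (hm : ‖m‖ = 1) (h1 : 9 / 10 < inner ℝ n ν) (h2 : 9 / 10 < inner ℝ m ν) : 0 < inner ℝ n m := by
  have e1 := H.norm_sq n
  have e2 := H.norm_sq m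
  rw [H.inner_eq]
  rw [hn] at e1; rw [hm] at e2
  nlinarith [sq_nonneg (inner ℝ n a₁ + inner ℝ m a₁), sq_nonneg (inner ℝ n a₂ + inner ℝ m a₂)]

theorem IsChart.lipschitz_height {a₁ a₂ ν : Space} {q : Plane} {σ : Plane → Plane}
    (X : IsChart F C L a₁ a₂ ν q r σ) (A : IsAdmissible F h C L) (H : IsFrame a₁ a₂ ν) (b : Space)
    {x y : Plane} (hx : x ∈ ball (0 : Plane) r) (hy : y ∈ ball (0 : Plane) r) :
    |height F σ b ν x - height F σ b ν y| ≤ ‖x - y‖ := by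
  have h := (convex_ball (0 : Plane) r).norm_image_sub_le_of_norm_hasFDerivWithin_le
    (f := height F σ b ν) (f' := fun x => fderiv ℝ (height F σ b ν) x) (C := 1)
    (fun z hz => ((X.contDiffAt_height A b hz).differentiableAt
      (by simp)).hasFDerivAt.hasFDerivWithinAt)
    (fun z hz => ?_) hy hx
  · simpa using h
  · apply ContinuousLinearMap.opNorm_le_bound _ (by norm_num)
    intro w
    rw [fderiv_eq_pd, Real.norm_eq_abs, smul_eq_mul, smul_eq_mul]
    refine (abs_add_le _ _).trans ?_
    rw [abs_mul, abs_mul]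
    have h0 := X.abs_pd_height_le A H b hz 0
    have h1 := X.abs_pd_height_le A H b hz 1
    have n0 : |w 0| ≤ ‖w‖ := PiLp.norm_apply_le w 0
    have n1 : |w 1| ≤ ‖w‖ := PiLp.norm_apply_le w 1
    nlinarith [abs_nonneg (w 0), abs_nonneg (w 1)]

/-- A normal line of the first sheet hits a second sheet that is close to the first one over a
common plane. -/
theorem exists_normal_hit (A : IsAdmissible F h C L) {a₁ a₂ ν : Space} (H : IsFrame a₁ a₂ ν)
    {p q : Plane} {σ τ : Plane → Plane} (X : IsChart F C L a₁ a₂ ν p r σ)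
    (Y : IsChart F C L a₁ a₂ ν q r τ) (hpq : proj a₁ a₂ (F q) = proj a₁ a₂ (F p)) {s m : ℝ}
    (hs : s = 1 ∨ s = -1) {ξ : Plane} (hξ : ‖ξ‖ ≤ r / 4) (hm : m ≤ r / 10)
    (hv0 : 0 < s * (height F τ (F p) ν ξ - height F σ (F p) ν ξ))
    (hvm : s * (height F τ (F p) ν ξ - height F σ (F p) ν ξ) < m) :
    ∃ q' t', IsSheetAt F s (σ ξ) q' t' ∧ |t'| ≤ 3 * m := by
  have hmpos : 0 < m := hv0.trans hvm
  have hrpos : 0 < r := by linarith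
  have hs2 : s * s = 1 := by rcases hs with h | h <;> rw [h] <;> norm_num
  have hsabs : |s| = 1 := by rcases hs with h | h <;> rw [h] <;> norm_num
  have hξb : ξ ∈ ball (0 : Plane) r := by rw [mem_ball_zero_iff]; linarith
  set N := unitNormal F (σ ξ) with hN
  have hNn : ‖N‖ = 1 := norm_unitNormal (A.inj (X.disk_mem hξb))
  have hNν : 9 / 10 < inner ℝ N ν := X.tilt ξ hξb
  have hNp : ‖proj a₁ a₂ N‖ ≤ 1 / 2 := by
    have := H.norm_sq_eq_proj N
    rw [hNn] at this
    nlinarith [norm_nonneg (proj a₁ a₂ N)]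
  set x : ℝ → Space := fun u => F (σ ξ) + (s * u) • N with hx
  have hP : ∀ u, proj a₁ a₂ (x u - F p) = ξ + (s * u) • proj a₁ a₂ N := by
    intro u
    rw [hx]
    simp only [map_sub, map_add, map_smul, X.proj_eq ξ hξb]
    abel
  have hPd : ∀ u ∈ Icc 0 (3 * m), ‖(s * u) • proj a₁ a₂ N‖ ≤ u / 2 := by
    intro u hu
    rw [norm_smul, Real.norm_eq_abs, abs_mul, hsabs, one_mul, abs_of_nonneg hu.1]
    nlinarith [hu.1]
  have hball : ∀ u ∈ Icc 0 (3 * m), ξ + (s * u) • proj a₁ a₂ N ∈ ball (0 : Plane) r := by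
    intro u hu
    rw [mem_ball_zero_iff]
    have h1 := norm_add_le ξ ((s * u) • proj a₁ a₂ N)
    have h2 := hPd u hu
    linarith [hu.2]
  set f₂ := height F τ (F p) ν with hf₂
  -- `k` is the height, on the side given by `s`, of the normal line over the second sheet. It is
  -- nonpositive at `σ ξ` and nonnegative at the distance `3 m`, as the normal line rises faster than
  -- the slope of the second sheet allows.
  set k : ℝ → ℝ := fun u => s * (inner ℝ (x u - F p) ν - f₂ (ξ + (s * u) • proj a₁ a₂ N)) with hk
  have hkc : ContinuousOn k (Icc 0 (3 * m)) := by
    have h1 : ContinuousOn f₂ (ball (0 : Plane) r) := fun z hz =>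
      (Y.contDiffAt_height A (F p) hz).continuousAt.continuousWithinAt
    have h2 : ContinuousOn (fun u : ℝ => f₂ (ξ + (s * u) • proj a₁ a₂ N)) (Icc 0 (3 * m)) :=
      h1.comp (by fun_prop) hball
    have h3 : Continuous (fun u => inner ℝ (x u - F p) ν) :=
      Continuous.inner (by fun_prop) continuous_const
    exact continuousOn_const.mul (h3.continuousOn.sub h2)
  have hk0 : k 0 ≤ 0 := by
    have : inner ℝ (x 0 - F p) ν = height F σ (F p) ν ξ := by simp [hx, height]
    simp only [hk, mul_zero, zero_smul, add_zero]
    simp only [this]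
    linarith
  have hkm : 0 ≤ k (3 * m) := by
    have hmem : 3 * m ∈ Icc 0 (3 * m) := ⟨by linarith, le_rfl⟩
    have h1 : inner ℝ (x (3 * m) - F p) ν = height F σ (F p) ν ξ + s * (3 * m) * inner ℝ N ν := by
      simp only [hx, height]
      rw [add_sub_right_comm, inner_add_left, real_inner_smul_left]
    have h2 := Y.lipschitz_height A H (F p) (hball _ hmem) hξb
    rw [add_sub_cancel_left] at h2
    have h3 := h2.trans (hPd _ hmem)
    have h4 : |s * (f₂ (ξ + (s * (3 * m)) • proj a₁ a₂ N) - f₂ ξ)| ≤ 3 * m / 2 := by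
      rw [abs_mul, hsabs, one_mul]; exact h3
    have h5 : k (3 * m) = -(s * (f₂ ξ - height F σ (F p) ν ξ)) + s * s * (3 * m) * inner ℝ N ν
        - s * (f₂ (ξ + (s * (3 * m)) • proj a₁ a₂ N) - f₂ ξ) := by
      simp only [hk]; rw [h1]; ring
    rw [h5, hs2]
    have := (abs_le.mp h4).2
    nlinarith
  obtain ⟨u, hu, hku⟩ := intermediate_value_Icc (by linarith) hkc ⟨hk0, hkm⟩
  have hsne : s ≠ 0 := by rcases hs with h | h <;> rw [h] <;> norm_num
  have hku' : inner ℝ (x u - F p) ν = f₂ (ξ + (s * u) • proj a₁ a₂ N) := by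
    rcases mul_eq_zero.mp hku with h | h
    · exact absurd h hsne
    · linarith
  set ζ := ξ + (s * u) • proj a₁ a₂ N with hζ
  have hζb := hball u hu
  have hFx : F (τ ζ) = x u := by
    apply H.eq_of_proj_eq
    · have := hP u
      rw [Y.proj_eq _ hζb, hpq, ← this, map_sub]; abel
    · rw [hf₂, height, inner_sub_left, inner_sub_left] at hku'
      linarith
  refine ⟨τ ζ, s * u, ⟨Y.disk_mem hζb, hFx, ?_, ?_⟩, ?_⟩
  · have hune : u ≠ 0 := by
      intro h0
      have : k 0 < 0 := by
        have : inner ℝ (x 0 - F p) ν = height F σ (F p) ν ξ := by simp [hx, height]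
        simp only [hk, mul_zero, zero_smul, add_zero]
        simp only [this]
        linarith
      rw [h0] at hku
      linarith
    have : 0 < u := lt_of_le_of_ne hu.1 (Ne.symm hune)
    rw [← mul_assoc, hs2, one_mul]; exact this
  · exact H.inner_pos_of_tilt hNn (norm_unitNormal (A.inj (Y.disk_mem hζb))) hNν (Y.tilt ζ hζb)
  · rw [abs_mul, hsabs, one_mul, abs_of_nonneg hu.1]; exact hu.2

/-- Propagation of a neighbouring sheet at small height from a point to the points of its graph
chart. -/
theorem exists_sheet_propagation (hC : 0 < C) (hr : IsSmallRadius C ρ r) {τ₀ : ℝ} (hτ₀ : 0 < τ₀) :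
    ∃ θ > 0, ∀ {F : Plane → Space} {h L : ℝ}, IsAdmissible F h C L →
      ∀ {s t : ℝ} {p q : Plane}, (s = 1 ∨ s = -1) → p ∈ disk → ‖F p‖ ≤ L - 2 * ρ →
      IsSheetAt F s p q t → |t| ≤ θ → ∀ {a₁ a₂ : Space} {σ : Plane → Plane},
      IsFrame a₁ a₂ (unitNormal F p) → IsChart F C L a₁ a₂ (unitNormal F p) p r σ →
      ∀ {ξ : Plane}, ‖ξ‖ ≤ r / 4 → ∃ q' t', IsSheetAt F s (σ ξ) q' t' ∧ |t'| ≤ τ₀ := by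
  obtain ⟨α, hα, hα'⟩ := exists_sheet_tilt hC hr (e := 1 / 5) (by norm_num) (by norm_num)
  have hρ : 0 < ρ := by linarith [hr.1, hr.2.2]
  have hrpos := hr.1
  set m := min (τ₀ / 3) (r / 10) with hm
  have hmpos : 0 < m := lt_min (by positivity) (by positivity)
  obtain ⟨θ, hθ, hθ'⟩ := exists_gap_lower_bound (K := 14 * C) (by positivity) hrpos hmpos
  refine ⟨min (min α ρ) (θ / 2), by positivity, ?_⟩
  intro F h L A s t p q hs hp hpL S ht a₁ a₂ σ H X ξ hξ
  have ht1 : |t| ≤ α := ht.trans ((min_le_left _ _).trans (min_le_left _ _))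
  have ht2 : |t| ≤ ρ := ht.trans ((min_le_left _ _).trans (min_le_right _ _))
  have ht3 : |t| < θ := by have := ht.trans (min_le_right _ _); linarith
  have hdist : ‖F q - F p‖ ≤ |t| := by
    rw [S.eq, add_sub_cancel_left, norm_smul, H.norm_eq, mul_one, Real.norm_eq_abs]
  have hqL : ‖F q‖ ≤ L - ρ := by
    have := norm_sub_norm_le (F q) (F p)
    linarith
  have htilt := hα' A hp hpL S ht1
  rw [real_inner_comm] at htilt
  obtain ⟨τ, Y⟩ := exists_chart A hC H hr S.mem hqL (by linarith)
  set ν := unitNormal F p with hν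
  have hpq : proj a₁ a₂ (F q) = proj a₁ a₂ (F p) := by
    rw [S.eq, map_add, map_smul, H.proj_normal, smul_zero, add_zero]
  have hsne : s ≠ 0 := by rcases hs with h | h <;> rw [h] <;> norm_num
  have hsabs : |s| = 1 := by rcases hs with h | h <;> rw [h] <;> norm_num
  set v : Plane → ℝ := fun ξ => s * (height F τ (F p) ν ξ - height F σ (F p) ν ξ) with hv
  have h0 : (0 : Plane) ∈ ball (0 : Plane) r := by simpa using hrpos
  have hv0 : v 0 = s * t := by
    simp only [hv, height, X.zero, Y.zero, S.eq]
    rw [add_sub_cancel_left, real_inner_smul_left, H.h33]; simp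
  have hvc : ContinuousOn v (ball (0 : Plane) r) := fun z hz =>
    (continuousAt_const.mul ((Y.contDiffAt_height A (F p) hz).continuousAt.sub
      (X.contDiffAt_height A (F p) hz).continuousAt)).continuousWithinAt
  -- The gap has no zero, because the two sheets are disjoint.
  have hvne : ∀ z ∈ ball (0 : Plane) r, v z ≠ 0 := by
    intro z hz h0'
    have h1 : height F τ (F p) ν z = height F σ (F p) ν z := by
      rcases mul_eq_zero.mp h0' with h | h
      · exact absurd h hsne
      · linarith
    have h2 : F (σ z) = F (τ z) := by
      apply H.eq_of_proj_eq
      · rw [X.proj_eq z hz, Y.proj_eq z hz, hpq]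
      · rw [height, height, inner_sub_left, inner_sub_left] at h1; linarith
    have h3 := A.embedded.injOn (X.disk_mem hz) (Y.disk_mem hz) h2
    exact S.ne H (X.base_eq_of_meet A H Y hpq.symm hz h3).symm
  have hvpos : ∀ z ∈ ball (0 : Plane) r, 0 < v z := by
    intro z hz
    by_contra! hle
    obtain ⟨y, hy, hy0⟩ := (convex_ball (0 : Plane) r).isPreconnected.intermediate_value hz h0 hvc
      ⟨hle, (by rw [hv0]; exact S.sign.le : (0 : ℝ) ≤ v 0)⟩
    exact hvne y hy hy0
  have hgap : IsSheetGap (14 * C) r v := by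
    rcases hs with h | h
    · have := isSheetGap_height A hC H (F p) X Y
      simpa [hv, h] using this
    · have := isSheetGap_height A hC H (F p) Y X
      simpa [hv, h] using this
  have hξb : ξ ∈ ball (0 : Plane) r := by rw [mem_ball_zero_iff]; linarith
  have hvm : v ξ < m := by
    by_contra! hge
    have h1 := hθ' v hgap hvpos ξ hξ hge
    have h2 : v 0 = |t| := by
      rw [hv0, ← abs_of_pos S.sign, abs_mul, hsabs, one_mul]
    linarith
  obtain ⟨q', t', h1, h2⟩ := exists_normal_hit A H X Y hpq hs hξ (min_le_right _ _) (hvpos ξ hξb) hvm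
  refine ⟨q', t', h1, h2.trans ?_⟩
  have := min_le_left (τ₀ / 3) (r / 10)
  linarith

/-- Propagation of a neighbouring sheet along a path, by as many steps as the bound on its length
requires; `ℓ` is the arc length or any other function that controls the distances. -/
theorem exists_sheet_chain (hC : 0 < C) (hr : IsSmallRadius C ρ r) (n : ℕ) :
    ∀ {τ₀ : ℝ}, 0 < τ₀ → ∃ θ > 0, ∀ {F : Plane → Space} {h L : ℝ}, IsAdmissible F h C L →
      ∀ {s t : ℝ} {q : Plane} {γ : ℝ → Plane} {ℓ : ℝ → ℝ}, (s = 1 ∨ s = -1) →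
      ContinuousOn γ (Icc 0 1) → ContinuousOn ℓ (Icc 0 1) → ℓ 0 = 0 →
      (∀ u ∈ Icc (0 : ℝ) 1, γ u ∈ disk ∧ ‖F (γ u)‖ ≤ L - 2 * ρ) →
      (∀ u ∈ Icc (0 : ℝ) 1, ∀ w ∈ Icc u 1, ‖F (γ w) - F (γ u)‖ ≤ ℓ w - ℓ u) →
      IsSheetAt F s (γ 0) q t → |t| ≤ θ → ∀ u ∈ Icc (0 : ℝ) 1, ℓ u ≤ n * (r / 4) →
      ∃ q' t', IsSheetAt F s (γ u) q' t' ∧ |t'| ≤ τ₀ := by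
  have hrpos := hr.1
  have hρ : 0 < ρ := by linarith [hr.1, hr.2.2]
  -- one step: the points within distance `r / 4` along the path lie in the chart
  have step : ∀ {τ₀ : ℝ}, 0 < τ₀ → ∃ θ > 0, ∀ {F : Plane → Space} {h L : ℝ}, IsAdmissible F h C L →
      ∀ {s t : ℝ} {q : Plane} {γ : ℝ → Plane} {ℓ : ℝ → ℝ}, (s = 1 ∨ s = -1) →
      ContinuousOn γ (Icc 0 1) →
      (∀ u ∈ Icc (0 : ℝ) 1, γ u ∈ disk ∧ ‖F (γ u)‖ ≤ L - 2 * ρ) →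
      (∀ u ∈ Icc (0 : ℝ) 1, ∀ w ∈ Icc u 1, ‖F (γ w) - F (γ u)‖ ≤ ℓ w - ℓ u) →
      ∀ u₀ ∈ Icc (0 : ℝ) 1, IsSheetAt F s (γ u₀) q t → |t| ≤ θ → ∀ u ∈ Icc u₀ 1,
      ℓ u - ℓ u₀ ≤ r / 4 → ∃ q' t', IsSheetAt F s (γ u) q' t' ∧ |t'| ≤ τ₀ := by
    intro τ₀ hτ₀
    obtain ⟨θ, hθ, hθ'⟩ := exists_sheet_propagation hC hr hτ₀
    refine ⟨θ, hθ, ?_⟩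
    intro F h L A s t q γ ℓ hs hγ hdisk hdist u₀ hu₀ S ht u hu hlen
    obtain ⟨a₁, a₂, σ, H, X⟩ := A.exists_tangent_chart hC hr (hdisk u₀ hu₀).1
      (by have := (hdisk u₀ hu₀).2; linarith)
    have hsub : Icc u₀ u ⊆ Icc 0 1 := Icc_subset_Icc hu₀.1 hu.2
    have hclose : ∀ w ∈ Icc u₀ u, ‖F (γ w) - F (γ u₀)‖ ≤ r / 4 := by
      intro w hw
      have h1 := hdist u₀ hu₀ w ⟨hw.1, hw.2.trans hu.2⟩
      have h2 := (norm_nonneg _).trans (hdist w (hsub hw) u ⟨hw.2, hu.2⟩)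
      linarith
    have hself : σ (proj a₁ a₂ (F (γ u₀) - F (γ u₀))) = γ u₀ := by
      rw [sub_self, map_zero, X.zero]
    have h1 := X.path_mem A H (γ := γ) isPreconnected_Icc (hγ.mono hsub)
      (fun w hw => (hclose w hw).trans_lt (by linarith)) (left_mem_Icc.2 hu.1) hself
      (right_mem_Icc.2 hu.1)
    rw [h1]
    exact hθ' A hs (hdisk u₀ hu₀).1 (hdisk u₀ hu₀).2 S ht H X
      ((H.norm_proj_le _).trans (hclose u (right_mem_Icc.2 hu.1)))
  induction n with
  | zero =>
    intro τ₀ hτ₀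
    obtain ⟨θ, hθ, hθ'⟩ := step hτ₀
    refine ⟨θ, hθ, ?_⟩
    intro F h L A s t q γ ℓ hs hγ hℓ hℓ0 hdisk hdist S ht u hu hlen
    refine hθ' A hs hγ hdisk hdist 0 (by simp) S ht u hu ?_
    rw [hℓ0]
    simp at hlen; linarith
  | succ n ih =>
    intro τ₀ hτ₀
    obtain ⟨θ₁, hθ₁, hθ₁'⟩ := step hτ₀
    obtain ⟨θ₂, hθ₂, hθ₂'⟩ := ih hθ₁
    refine ⟨θ₂, hθ₂, ?_⟩
    intro F h L A s t q γ ℓ hs hγ hℓ hℓ0 hdisk hdist S ht u hu hlen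
    -- a point of the path at most `r / 4` before `u`, within the range of the induction hypothesis
    obtain ⟨u₀, hu₀, hu₀l, hu₀u⟩ : ∃ u₀ ∈ Icc 0 u, ℓ u₀ ≤ n * (r / 4) ∧ ℓ u - ℓ u₀ ≤ r / 4 := by
      rcases le_or_gt (ℓ u) (n * (r / 4)) with hle | hgt
      · exact ⟨u, right_mem_Icc.2 hu.1, hle, by rw [sub_self]; positivity⟩
      · have h1 : (n : ℝ) * (r / 4) ∈ Icc (ℓ 0) (ℓ u) := ⟨by rw [hℓ0]; positivity, hgt.le⟩
        obtain ⟨u₀, hu₀, he⟩ := intermediate_value_Icc hu.1 (hℓ.mono (Icc_subset_Icc le_rfl hu.2)) h1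
        refine ⟨u₀, hu₀, he.le, ?_⟩
        rw [he]
        push_cast at hlen
        linarith
    have hu₀1 : u₀ ∈ Icc (0 : ℝ) 1 := ⟨hu₀.1, hu₀.2.trans hu.2⟩
    obtain ⟨q₁, t₁, S₁, ht₁⟩ := hθ₂' A hs hγ hℓ hℓ0 hdisk hdist S ht u₀ hu₀1 hu₀l
    exact hθ₁' A hs hγ hdisk hdist u₀ hu₀1 S₁ ht₁ u ⟨hu₀.2, hu.2⟩ hu₀u

end Sheets

/-! ### Neighbouring sheets over geodesic balls -/

section Reach

variable {F : Plane → Space} {h C L : ℝ} {ρ r : ℝ}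

/-- A nearby point of a different sheet yields a point of this sheet on the normal line. -/
theorem exists_initial_sheet (hC : 0 < C) (hr : IsSmallRadius C ρ r) {θ : ℝ} (hθ : 0 < θ) :
    ∃ α > 0, ∀ {F : Plane → Space} {h L : ℝ}, IsAdmissible F h C L →
      ∀ {a₁ a₂ : Space} {p q : Plane} {σ : Plane → Plane}, p ∈ disk → q ∈ disk →
      ‖F p‖ ≤ L - 2 * ρ → IsFrame a₁ a₂ (unitNormal F p) →
      IsChart F C L a₁ a₂ (unitNormal F p) p r σ → ‖F q - F p‖ ≤ α →
      0 < inner ℝ (unitNormal F p) (unitNormal F q) → q ≠ σ (proj a₁ a₂ (F q - F p)) →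
      ∃ s q' t, (s = 1 ∨ s = -1) ∧ IsSheetAt F s p q' t ∧ |t| ≤ θ := by
  have hrpos := hr.1
  have hρ : 0 < ρ := by linarith [hr.1, hr.2.2]
  obtain ⟨α, hα, hα'⟩ := exists_tilt_bound hC hrpos (e := 1 / 5) (by norm_num) (by norm_num)
  refine ⟨min (min α ρ) (min (r / 4) (θ / 3)), by positivity, ?_⟩
  intro F h L A a₁ a₂ p q σ hp hq hpL H X hd hpos hne
  have hd1 : ‖F q - F p‖ ≤ α := hd.trans ((min_le_left _ _).trans (min_le_left _ _))
  have hd2 : ‖F q - F p‖ ≤ ρ := hd.trans ((min_le_left _ _).trans (min_le_right _ _))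
  have hd3 : ‖F q - F p‖ ≤ r / 4 := hd.trans ((min_le_right _ _).trans (min_le_left _ _))
  have hd4 : ‖F q - F p‖ ≤ θ / 3 := hd.trans ((min_le_right _ _).trans (min_le_right _ _))
  have hqL : ‖F q‖ ≤ L - ρ := by
    have := norm_sub_norm_le (F q) (F p)
    linarith
  obtain ⟨b₁, b₂, τ₀, K, Y₀⟩ := A.exists_tangent_chart hC hr hq hqL
  have htilt := hα' A H K X Y₀ hd1 hpos.le hne
  rw [real_inner_comm] at htilt
  obtain ⟨τ, Y⟩ := exists_chart A hC H hr hq hqL (by linarith)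
  set ξ := proj a₁ a₂ (F q - F p) with hξ
  have hξn : ‖ξ‖ ≤ ‖F q - F p‖ := H.norm_proj_le _
  have hball : ∀ u ∈ Icc (0 : ℝ) 1, u • (-ξ) ∈ ball (0 : Plane) r := by
    intro u hu
    rw [mem_ball_zero_iff, norm_smul, norm_neg, Real.norm_of_nonneg hu.1]
    nlinarith [hu.2, norm_nonneg ξ]
  have h1I : (1 : ℝ) ∈ Icc (0 : ℝ) 1 := by simp
  have h0I : (0 : ℝ) ∈ Icc (0 : ℝ) 1 := by simp
  have hb : -ξ ∈ ball (0 : Plane) r := by simpa using hball 1 h1I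
  -- the point of the second sheet over the base point of the first one
  set q' := τ (-ξ) with hq'
  have hproj : proj a₁ a₂ (F q' - F p) = 0 := by
    rw [map_sub, Y.proj_eq _ hb, hξ, map_sub]; abel
  set t := inner ℝ (F q' - F p) (unitNormal F p) with ht
  have hFq' : F q' - F p = t • unitNormal F p := by
    apply H.eq_of_proj_eq
    · rw [hproj, map_smul, H.proj_normal, smul_zero]
    · rw [real_inner_smul_left, H.h33, mul_one]
  have htle : |t| ≤ θ := by
    have h1 : |t| = ‖F q' - F p‖ := by
      rw [hFq', norm_smul, H.norm_eq, mul_one, Real.norm_eq_abs]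
    have h2 := Y.norm_le _ hb
    rw [norm_neg] at h2
    have h3 := norm_sub_le_norm_sub_add_norm_sub (F q') (F q) (F p)
    rw [h1]; linarith
  -- Otherwise the second sheet would pass through the base point of the first one, and its segment
  -- from there to `q` would stay in the first chart.
  have htne : t ≠ 0 := by
    intro h0
    rw [h0, zero_smul, sub_eq_zero] at hFq'
    have hqp : q' = p := A.embedded.injOn (Y.disk_mem hb) hp hFq'
    have hclose : ∀ u ∈ Icc (0 : ℝ) 1, ‖F (τ (u • (-ξ))) - F p‖ < r := by
      intro u hu
      have h2 := Y.norm_le _ (hball u hu)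
      have h3 := norm_sub_le_norm_sub_add_norm_sub (F (τ (u • (-ξ)))) (F q) (F p)
      have h4 : ‖u • (-ξ)‖ ≤ ‖ξ‖ := by
        rw [norm_smul, norm_neg, Real.norm_of_nonneg hu.1]
        nlinarith [hu.2, norm_nonneg ξ]
      linarith
    have h5 := X.path_mem A H (γ := fun u : ℝ => τ (u • (-ξ))) isPreconnected_Icc
      (Y.continuousOn.comp (by fun_prop) hball) hclose h1I
      (by simp only [one_smul]; rw [← hq', hproj, X.zero, hqp]) h0I
    simp only [zero_smul, Y.zero] at h5
    exact hne h5
  have key : ∀ s : ℝ, 0 < s * t → IsSheetAt F s p q' t := fun s hs =>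
    ⟨Y.disk_mem hb, by rw [← hFq']; abel, hs, by
      rw [real_inner_comm]; linarith [Y.tilt _ hb]⟩
  rcases lt_or_gt_of_ne htne with hneg | hpos'
  · exact ⟨-1, q', t, Or.inr rfl, key _ (by linarith), htle⟩
  · exact ⟨1, q', t, Or.inl rfl, key _ (by linarith), htle⟩

/-- The points of a graph chart are at small intrinsic distance from its base point. The curve in the
definition of the distance has to be differentiable on the whole line, so the segment is run through
back and forth with the parameter `sin²`. -/
theorem intrinsicDist_chart_lt (A : IsAdmissible F h C L) {a₁ a₂ ν : Space}
    (H : IsFrame a₁ a₂ ν) {p : Plane} {σ : Plane → Plane} (X : IsChart F C L a₁ a₂ ν p r σ)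
    {ξ : Plane} (hξ : ‖ξ‖ ≤ r / 2) (hr : 0 < r) :
    intrinsicDist F p (σ ξ) < ENNReal.ofReal (4 * r) := by
  set s : ℝ → ℝ := fun t => Real.sin (t * (Real.pi / 2)) ^ 2 with hs
  have hsd : ∀ t, HasDerivAt s
      (2 * Real.sin (t * (Real.pi / 2)) * (Real.cos (t * (Real.pi / 2)) * (Real.pi / 2))) t := by
    intro t
    have h1 : HasDerivAt (fun t : ℝ => t * (Real.pi / 2)) (Real.pi / 2) t := by
      simpa using (hasDerivAt_id t).mul_const (Real.pi / 2)
    have h2 : HasDerivAt s _ t := (h1.sin).pow 2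
    exact h2.congr_deriv (by norm_num)
  have hs01 : ∀ t, 0 ≤ s t ∧ s t ≤ 1 := fun t => ⟨sq_nonneg _, Real.sin_sq_le_one _⟩
  have hball : ∀ t, s t • ξ ∈ ball (0 : Plane) r := by
    intro t
    rw [mem_ball_zero_iff, norm_smul, Real.norm_of_nonneg (hs01 t).1]
    nlinarith [(hs01 t).2, norm_nonneg ξ]
  set γ : ℝ → Plane := fun t => σ (s t • ξ) with hγ
  have hγ1 : ContDiff ℝ 1 γ := by
    rw [contDiff_iff_contDiffAt]
    intro t
    have h1 : ContDiffAt ℝ 1 (fun t : ℝ => s t • ξ) t := by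
      have : ContDiff ℝ 1 s := by fun_prop
      exact (this.smul contDiff_const).contDiffAt
    exact ((X.smooth _ (hball t)).of_le (by simp)).comp t h1
  have hd : ∀ t, ‖deriv (fun u => F (γ u)) t‖ ≤ 3 * r := by
    intro t
    have h1 := (X.hasFDerivAt A (hball t)).comp_hasDerivAt t ((hsd t).smul_const ξ)
    have h2 : HasDerivAt (fun u => F (γ u)) _ t := h1
    rw [h2.deriv]
    have h3 := X.norm_fderiv_le A H (hball t)
      ((2 * Real.sin (t * (Real.pi / 2)) * (Real.cos (t * (Real.pi / 2)) * (Real.pi / 2))) • ξ)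
    refine le_trans h3 ?_
    rw [norm_smul, Real.norm_eq_abs]
    have h4 : |2 * Real.sin (t * (Real.pi / 2)) * (Real.cos (t * (Real.pi / 2)) * (Real.pi / 2))| ≤ 4 := by
      rw [show 2 * Real.sin (t * (Real.pi / 2)) * (Real.cos (t * (Real.pi / 2)) * (Real.pi / 2)) =
        Real.sin (t * (Real.pi / 2)) * Real.cos (t * (Real.pi / 2)) * Real.pi by ring,
        abs_mul, abs_mul, abs_of_pos Real.pi_pos]
      have := Real.abs_sin_le_one (t * (Real.pi / 2))
      have := Real.abs_cos_le_one (t * (Real.pi / 2))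
      have h5 : |Real.sin (t * (Real.pi / 2))| * |Real.cos (t * (Real.pi / 2))| ≤ 1 :=
        mul_le_one₀ (by assumption) (abs_nonneg _) (by assumption)
      nlinarith [Real.pi_le_four, Real.pi_pos]
    have : |2 * Real.sin (t * (Real.pi / 2)) * (Real.cos (t * (Real.pi / 2)) * (Real.pi / 2))| * ‖ξ‖
        ≤ 4 * (r / 2) := by gcongr
    linarith
  have hle : intrinsicDist F p (σ ξ) ≤ ∫⁻ t in Icc (0 : ℝ) 1, ‖deriv (fun u => F (γ u)) t‖ₑ := by
    refine iInf_le_of_le γ (iInf_le_of_le hγ1 (iInf_le_of_le (fun t _ => X.disk_mem (hball t))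
      (iInf_le_of_le ?_ (iInf_le_of_le ?_ le_rfl))))
    · simp [hγ, hs, X.zero]
    · simp [hγ, hs]
  refine hle.trans_lt ?_
  have h1 : ∫⁻ t in Icc (0 : ℝ) 1, ‖deriv (fun u => F (γ u)) t‖ₑ ≤
      ∫⁻ _ in Icc (0 : ℝ) 1, ENNReal.ofReal (3 * r) := by
    apply lintegral_mono
    intro t
    beta_reduce
    rw [← ofReal_norm]
    exact ENNReal.ofReal_le_ofReal (hd t)
  refine h1.trans_lt ?_
  rw [lintegral_const]
  simp only [Measure.restrict_apply MeasurableSet.univ, univ_inter, Real.volume_Icc, sub_zero,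
    ENNReal.ofReal_one, mul_one]
  exact (ENNReal.ofReal_lt_ofReal_iff (by positivity)).mpr (by linarith)

/-- Points of a geodesic ball are reached by paths whose arc length `ℓ` is controlled. -/
theorem exists_path_of_mem_geodesicBall (hF : ContDiff ℝ ∞ F) {p p' : Plane} {l : ℝ}
    (hp' : p' ∈ geodesicBall F p l) : ∃ (γ : ℝ → Plane) (ℓ : ℝ → ℝ), Continuous γ ∧ Continuous ℓ ∧
      ℓ 0 = 0 ∧ γ 0 = p ∧ γ 1 = p' ∧ (∀ u ∈ Icc (0 : ℝ) 1, γ u ∈ disk) ∧ ℓ 1 < l ∧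
      ∀ u w, u ≤ w → ‖F (γ w) - F (γ u)‖ ≤ ℓ w - ℓ u := by
  have h1 : intrinsicDist F p p' < ENNReal.ofReal l := hp'.2
  simp only [intrinsicDist, iInf_lt_iff] at h1
  obtain ⟨γ, hγ, hdisk, h0, h1, hlen⟩ := h1
  set f : ℝ → Space := fun u => F (γ u) with hf
  have hf1 : ContDiff ℝ 1 f := (hF.of_le (by simp)).comp hγ
  have hdc : Continuous (deriv f) := hf1.continuous_deriv (by simp)
  have hnc : Continuous (fun t => ‖deriv f t‖) := hdc.norm
  have hint : ∀ a b, IntervalIntegrable (fun t => ‖deriv f t‖) volume a b := fun a b =>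
    hnc.intervalIntegrable a b
  refine ⟨γ, fun t => ∫ u in (0 : ℝ)..t, ‖deriv f u‖, hγ.continuous,
    intervalIntegral.continuous_primitive hint 0, by simp, h0, h1, hdisk, ?_, ?_⟩
  · have h2 : ENNReal.ofReal (∫ u in (0 : ℝ)..1, ‖deriv f u‖) < ENNReal.ofReal l := by
      rw [intervalIntegral.integral_of_le zero_le_one, ← integral_Icc_eq_integral_Ioc]
      rw [ofReal_integral_norm_eq_lintegral_enorm]
      · exact hlen
      · exact (hdc.continuousOn.integrableOn_compact isCompact_Icc)
    by_contra! hge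
    exact absurd h2 (not_lt.mpr (ENNReal.ofReal_le_ofReal hge))
  · intro u w huw
    rw [intervalIntegral.integral_interval_sub_left (hint _ _) (hint _ _)]
    have h3 : ∫ t in u..w, deriv f t = f w - f u :=
      intervalIntegral.integral_deriv_eq_sub (fun t _ => hf1.differentiable (by simp) t)
        (hdc.intervalIntegrable _ _)
    change ‖f w - f u‖ ≤ _
    rw [← h3]
    exact intervalIntegral.norm_integral_le_integral_norm huw

/-- Two nearby points that are far apart in the surface force a neighbouring sheet, at arbitrarily
small height, over the whole geodesic ball. -/
theorem exists_sheets_over_geodesicBall (hC : 0 < C) (hr : IsSmallRadius C ρ r) {l : ℝ}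
    (hl : 0 < l) {τ₀ : ℝ} (hτ₀ : 0 < τ₀) : ∃ α > 0, ∀ {F : Plane → Space} {h L : ℝ},
      IsAdmissible F h C L → ∀ {p q : Plane}, l + 1 + 2 * ρ ≤ L → p ∈ disk → q ∈ disk → ‖F p‖ < 1 →
      dist (F p) (F q) ≤ α → ENNReal.ofReal (4 * r) ≤ intrinsicDist F p q →
      0 < inner ℝ (unitNormal F p) (unitNormal F q) → ∃ s : ℝ, (s = 1 ∨ s = -1) ∧
        ∀ p' ∈ geodesicBall F p l, ‖F p'‖ ≤ L - 2 * ρ ∧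
          ∃ q' t', IsSheetAt F s p' q' t' ∧ |t'| ≤ τ₀ := by
  have hrpos := hr.1
  have hρ : 0 < ρ := by linarith [hr.1, hr.2.2]
  obtain ⟨n, hn⟩ := exists_nat_ge (l / (r / 4))
  rw [div_le_iff₀ (by positivity)] at hn
  obtain ⟨θ, hθ, hchain⟩ := exists_sheet_chain hC hr n hτ₀
  obtain ⟨α, hα, hinit⟩ := exists_initial_sheet hC hr hθ
  refine ⟨min α (r / 4), by positivity, ?_⟩
  intro F h L A p q hL hp hq hpn hd hfar hpos
  rw [dist_eq_norm, norm_sub_rev] at hd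
  have hpL : ‖F p‖ ≤ L - 2 * ρ := by linarith
  obtain ⟨a₁, a₂, σ, H, X⟩ := A.exists_tangent_chart hC hr hp (by linarith)
  have hne : q ≠ σ (proj a₁ a₂ (F q - F p)) := by
    intro heq
    have hle : ‖proj a₁ a₂ (F q - F p)‖ ≤ r / 2 := by
      have h1 := (H.norm_proj_le (F q - F p)).trans (hd.trans (min_le_right _ _))
      linarith
    have := intrinsicDist_chart_lt A H X hle hrpos
    rw [← heq] at this
    exact absurd this (not_lt.mpr hfar)
  obtain ⟨s, q₀, t, hs, S, ht⟩ := hinit A hp hq hpL H X (hd.trans (min_le_left _ _)) hpos hne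
  refine ⟨s, hs, ?_⟩
  intro p' hp'
  obtain ⟨γ, ℓ, hγ, hℓ, hℓ0, h0, h1, hdisk, hlen, hlip⟩ := exists_path_of_mem_geodesicBall A.smooth hp'
  have hmono : ∀ u w, u ≤ w → ℓ u ≤ ℓ w := fun u w huw => by
    have := (norm_nonneg _).trans (hlip u w huw); linarith
  have hbound : ∀ u ∈ Icc (0 : ℝ) 1, ‖F (γ u)‖ ≤ L - 2 * ρ := by
    intro u hu
    have e1 := hlip 0 u hu.1
    have e2 := hmono u 1 hu.2
    have e3 := norm_sub_norm_le (F (γ u)) (F (γ 0))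
    rw [h0] at e1 e3
    linarith
  have h1I : (1 : ℝ) ∈ Icc (0 : ℝ) 1 := by simp
  rw [← h1]
  refine ⟨hbound 1 h1I, ?_⟩
  refine hchain A hs hγ.continuousOn hℓ.continuousOn hℓ0 (fun u hu => ⟨hdisk u hu, hbound u hu⟩)
    (fun u _ w hw => hlip u w hw.1) (by rw [h0]; exact S) ht 1 h1I (by linarith)

end Reach

/-! ### The lowest sheet -/

section Lowest

open Filter Topology

variable {F : Plane → Space} {h C L : ℝ}

/-- The implicit function theorem for `F q = F p + t N p`, where `(q, t)` is the unknown. -/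
theorem exists_implicit_sheet (A : IsAdmissible F h C L) {p₀ q₀ : Plane} {t₀ : ℝ}
    (hp : p₀ ∈ disk) (hq : q₀ ∈ disk) (heq : F q₀ = F p₀ + t₀ • unitNormal F p₀)
    (hne : inner ℝ (unitNormal F p₀) (unitNormal F q₀) ≠ 0) :
    ∃ φ : Plane → Plane × ℝ, ContDiffAt ℝ ∞ φ p₀ ∧ φ p₀ = (q₀, t₀) ∧
      (∀ᶠ p in 𝓝 p₀, F (φ p).1 = F p + (φ p).2 • unitNormal F p) ∧
      ∀ᶠ x : Plane × (Plane × ℝ) in 𝓝 (p₀, (q₀, t₀)),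
        F x.2.1 = F x.1 + x.2.2 • unitNormal F x.1 → φ x.1 = x.2 := by
  set f : Plane × (Plane × ℝ) → Space := fun x => F x.2.1 - (F x.1 + x.2.2 • unitNormal F x.1) with hf
  have hN := A.contDiffAt_normal hp
  have cdf : ContDiffAt ℝ ∞ f (p₀, (q₀, t₀)) := by
    have h1 : ContDiffAt ℝ ∞ (fun x : Plane × (Plane × ℝ) => F x.2.1) (p₀, (q₀, t₀)) :=
      (A.smooth.comp (contDiff_fst.comp contDiff_snd)).contDiffAt
    have h2 : ContDiffAt ℝ ∞ (fun x : Plane × (Plane × ℝ) => F x.1) (p₀, (q₀, t₀)) :=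
      (A.smooth.comp contDiff_fst).contDiffAt
    have h3 : ContDiffAt ℝ ∞ (fun x : Plane × (Plane × ℝ) => unitNormal F x.1) (p₀, (q₀, t₀)) :=
      ContDiffAt.comp (p₀, (q₀, t₀)) (g := unitNormal F) hN contDiffAt_fst
    have h4 : ContDiffAt ℝ ∞ (fun x : Plane × (Plane × ℝ) => x.2.2) (p₀, (q₀, t₀)) :=
      (contDiff_snd.comp contDiff_snd).contDiffAt
    exact h1.sub (h2.add (h4.smul h3))
  have h0 : f (p₀, (q₀, t₀)) = 0 := by simp [hf, heq]
  have hder : ∀ y : Plane × ℝ, (fderiv ℝ f (p₀, (q₀, t₀)) ∘L .inr ℝ Plane (Plane × ℝ)) y =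
      fderiv ℝ F q₀ y.1 - y.2 • unitNormal F p₀ := by
    intro y
    have h1 : HasFDerivAt (fun y : Plane × ℝ => f (p₀, y))
        (fderiv ℝ f (p₀, (q₀, t₀)) ∘L .inr ℝ Plane (Plane × ℝ)) (q₀, t₀) :=
      HasFDerivAt.comp (q₀, t₀) (g := f) (cdf.differentiableAt (by simp)).hasFDerivAt
        (hasFDerivAt_prodMk_right p₀ (q₀, t₀))
    have h2 : HasFDerivAt (fun y : Plane × ℝ => f (p₀, y))
        (fderiv ℝ F q₀ ∘L .fst ℝ Plane ℝ -
          (ContinuousLinearMap.snd ℝ Plane ℝ).smulRight (unitNormal F p₀)) (q₀, t₀) := by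
      have h3 : HasFDerivAt (fun y : Plane × ℝ => F y.1) (fderiv ℝ F q₀ ∘L .fst ℝ Plane ℝ) (q₀, t₀) :=
        HasFDerivAt.comp (q₀, t₀) (g := F)
          ((A.smooth.contDiffAt.differentiableAt (by simp)).hasFDerivAt) hasFDerivAt_fst
      have h4 : HasFDerivAt (fun y : Plane × ℝ => F p₀ + y.2 • unitNormal F p₀)
          ((ContinuousLinearMap.snd ℝ Plane ℝ).smulRight (unitNormal F p₀)) (q₀, t₀) :=
        (HasFDerivAt.smul_const hasFDerivAt_snd _).const_add _
      exact h3.sub h4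
    rw [h1.unique h2]
    simp
  have hinj : Function.Injective (fderiv ℝ f (p₀, (q₀, t₀)) ∘L .inr ℝ Plane (Plane × ℝ)) := by
    rw [injective_iff_map_eq_zero]
    intro y hy
    rw [hder] at hy
    have h1 : inner ℝ (unitNormal F q₀) (fderiv ℝ F q₀ y.1 - y.2 • unitNormal F p₀) = 0 := by
      rw [hy, inner_zero_right]
    rw [inner_sub_right, inner_unitNormal_fderiv, real_inner_smul_right, real_inner_comm, zero_sub,
      neg_eq_zero] at h1
    have h2 : y.2 = 0 := (mul_eq_zero.mp h1).resolve_right hne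
    rw [h2, zero_smul, sub_zero] at hy
    have h3 : y.1 = 0 := A.inj hq (by rw [hy, map_zero])
    exact Prod.ext h3 h2
  have hinv : (fderiv ℝ f (p₀, (q₀, t₀)) ∘L .inr ℝ Plane (Plane × ℝ)).IsInvertible := by
    have hfr : Module.finrank ℝ (Plane × ℝ) = Module.finrank ℝ Space := by simp
    set T := (fderiv ℝ f (p₀, (q₀, t₀)) ∘L .inr ℝ Plane (Plane × ℝ)).toLinearMap with hT
    refine ⟨(LinearEquiv.ofBijective T ⟨hinj,
      (LinearMap.injective_iff_surjective_of_finrank_eq_finrank hfr).mp hinj⟩).toContinuousLinearEquiv, ?_⟩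
    exact ContinuousLinearMap.ext fun y => rfl
  have hn : (∞ : ℕ∞ω) ≠ 0 := by simp
  refine ⟨cdf.implicitFunction hn hinv, cdf.contDiffAt_implicitFunction hn hinv,
    cdf.implicitFunction_apply_self hn hinv, ?_, ?_⟩
  · filter_upwards [cdf.eventually_apply_implicitFunction hn hinv] with p hp'
    rw [h0] at hp'
    exact sub_eq_zero.mp hp'
  · filter_upwards [cdf.eventually_apply_eq_iff_implicitFunction hn hinv] with x hx hxeq
    apply hx.mp
    rw [h0]
    exact sub_eq_zero.mpr hxeq

/-- All sheets of height at most `α` over the points in the ball of radius `M` have normals that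
are close to those of the base points: their inner product is at least `1 - e²`. -/
def HasTiltBound (F : Plane → Space) (s M α e : ℝ) : Prop :=
  ∀ ⦃p q : Plane⦄ ⦃t : ℝ⦄, p ∈ disk → ‖F p‖ < M → IsSheetAt F s p q t → |t| ≤ α →
    1 - e ^ 2 ≤ inner ℝ (unitNormal F p) (unitNormal F q)

/-- Limits of sheets are sheets: the height of the limit is not zero, since a surface does not meet
itself at small heights along its own normals. -/
theorem isSheetAt_of_tendsto (A : IsAdmissible F h C L) {s M α e : ℝ}
    (hT : HasTiltBound F s M α e) (he : 0 < 1 - e ^ 2) {p q : ℕ → Plane} {t : ℕ → ℝ}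
    {p₀ q₀ : Plane} {t₀ : ℝ} (hp₀ : p₀ ∈ disk) (hpd : ∀ᶠ n in atTop, p n ∈ disk)
    (hpM : ∀ᶠ n in atTop, ‖F (p n)‖ < M) (hS : ∀ n, IsSheetAt F s (p n) (q n) (t n))
    (ht : ∀ᶠ n in atTop, |t n| ≤ α) (hp : Tendsto p atTop (𝓝 p₀)) (hq : Tendsto q atTop (𝓝 q₀))
    (htt : Tendsto t atTop (𝓝 t₀)) : IsSheetAt F s p₀ q₀ t₀ := by
  have hq₀ : q₀ ∈ disk := isClosed_closedBall.mem_of_tendsto hq (Eventually.of_forall fun n => (hS n).mem)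
  have hFp : Tendsto (fun n => F (p n)) atTop (𝓝 (F p₀)) := (A.smooth.continuous.tendsto p₀).comp hp
  have hFq : Tendsto (fun n => F (q n)) atTop (𝓝 (F q₀)) := (A.smooth.continuous.tendsto q₀).comp hq
  have hNp : Tendsto (fun n => unitNormal F (p n)) atTop (𝓝 (unitNormal F p₀)) :=
    (A.contDiffAt_normal hp₀).continuousAt.tendsto.comp hp
  have hNq : Tendsto (fun n => unitNormal F (q n)) atTop (𝓝 (unitNormal F q₀)) :=
    (A.contDiffAt_normal hq₀).continuousAt.tendsto.comp hq
  have heq : F q₀ = F p₀ + t₀ • unitNormal F p₀ :=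
    tendsto_nhds_unique hFq (by simp only [fun n => (hS n).eq]; exact hFp.add (htt.smul hNp))
  have hpos : 0 < inner ℝ (unitNormal F p₀) (unitNormal F q₀) := by
    refine lt_of_lt_of_le he (ge_of_tendsto (hNp.inner hNq) ?_)
    filter_upwards [hpd, hpM, ht] with n h1 h2 h3
    exact hT h1 h2 (hS n) h3
  have hnn : 0 ≤ s * t₀ := ge_of_tendsto (htt.const_mul s) (Eventually.of_forall fun n => (hS n).sign.le)
  refine ⟨hq₀, heq, lt_of_le_of_ne hnn ?_, hpos⟩
  intro hst
  -- In the excluded case the sheets collapse to the surface itself.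
  have ht0 : t₀ = 0 := by
    rcases mul_eq_zero.mp hst.symm with h1 | h1
    · have := (hS 0).sign
      rw [h1, zero_mul] at this
      exact absurd this (lt_irrefl _)
    · exact h1
  subst ht0
  rw [zero_smul, add_zero] at heq
  obtain rfl := A.embedded.injOn hq₀ hp₀ heq
  obtain ⟨φ, -, -, -, hφ⟩ := exists_implicit_sheet A (t₀ := 0) hq₀ hq₀ (by simp) hpos.ne'
  have e1 := (hp.prodMk_nhds (hq.prodMk_nhds htt)).eventually hφ
  have e2 := (hp.prodMk_nhds (hp.prodMk_nhds (tendsto_const_nhds (x := (0 : ℝ))))).eventually hφ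
  obtain ⟨n, h1, h2⟩ := (e1.and e2).exists
  have h3 := h1 (hS n).eq
  have h4 := h2 (by simp)
  have h5 : t n = 0 := congrArg Prod.snd (h3.symm.trans h4)
  have := (hS n).sign
  rw [h5, mul_zero] at this
  exact absurd this (lt_irrefl _)

/-- The sheet over `p`, on the side given by `s`, that is closest to `p`. -/
structure IsLowestSheet (F : Plane → Space) (s : ℝ) (p q : Plane) (t : ℝ) : Prop where
  sheet : IsSheetAt F s p q t
  le : ∀ ⦃q' t'⦄, IsSheetAt F s p q' t' → |t| ≤ |t'|

theorem eq_of_abs_eq_of_mul_pos {s a b : ℝ} (h1 : |a| = |b|) (ha : 0 < s * a) (hb : 0 < s * b) :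
    a = b := by
  rcases abs_eq_abs.mp h1 with h | h
  · exact h
  · rw [h, mul_neg] at ha
    linarith

theorem IsLowestSheet.unique (A : IsAdmissible F h C L) {s : ℝ} {p q q' : Plane} {t t' : ℝ}
    (S : IsLowestSheet F s p q t) (S' : IsLowestSheet F s p q' t') : (q, t) = (q', t') := by
  have ht : t = t' := eq_of_abs_eq_of_mul_pos (le_antisymm (S.le S'.sheet) (S'.le S.sheet))
    S.sheet.sign S'.sheet.sign
  subst ht
  rw [A.embedded.injOn S.sheet.mem S'.sheet.mem (S.sheet.eq.trans S'.sheet.eq.symm)]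

theorem exists_isLowestSheet (A : IsAdmissible F h C L) {s M α e : ℝ}
    (hT : HasTiltBound F s M α e) (he : 0 < 1 - e ^ 2) {p q : Plane} {t : ℝ} (hp : p ∈ disk)
    (hpM : ‖F p‖ < M) (S : IsSheetAt F s p q t) (ht : |t| ≤ α) :
    ∃ q' t', IsLowestSheet F s p q' t' := by
  set K : Set (Plane × ℝ) := {x | IsSheetAt F s p x.1 x.2 ∧ |x.2| ≤ α} with hK
  have hsub : K ⊆ disk ×ˢ Icc (-α) α := fun x hx => ⟨hx.1.mem, abs_le.mp hx.2⟩
  have hcl : IsClosed K := by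
    refine IsSeqClosed.isClosed ?_
    intro x y hx hxy
    have h1 := (continuous_fst.tendsto y).comp hxy
    have h2 := (continuous_snd.tendsto y).comp hxy
    refine ⟨isSheetAt_of_tendsto A hT he (p := fun _ => p) hp (Eventually.of_forall fun _ => hp)
      (Eventually.of_forall fun _ => hpM) (fun n => (hx n).1)
      (Eventually.of_forall fun n => (hx n).2) tendsto_const_nhds h1 h2, ?_⟩
    exact le_of_tendsto h2.abs (Eventually.of_forall fun n => (hx n).2)
  have hcomp : IsCompact K :=
    ((isCompact_closedBall (0 : Plane) 1).prod isCompact_Icc).of_isClosed_subset hcl hsub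
  obtain ⟨x, hx, hmin⟩ := hcomp.exists_isMinOn ⟨(q, t), S, ht⟩
    (continuous_abs.comp continuous_snd).continuousOn
  refine ⟨x.1, x.2, hx.1, ?_⟩
  intro q' t' S'
  by_cases h1 : |t'| ≤ α
  · exact hmin (show (q', t') ∈ K from ⟨S', h1⟩)
  · exact hx.2.trans (not_le.mp h1).le

/-- The lowest sheet depends smoothly on the base point. -/
theorem IsLowestSheet.exists_contDiffAt (A : IsAdmissible F h C L) {s M α e : ℝ}
    (hT : HasTiltBound F s M α e) (he : 0 < 1 - e ^ 2) {p₀ q₀ : Plane} {t₀ : ℝ}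
    (hp : p₀ ∈ ball (0 : Plane) 1) (hpM : ‖F p₀‖ < M) (S : IsLowestSheet F s p₀ q₀ t₀)
    (ht : |t₀| < α) (hM : M + α ≤ L) : ∃ φ : Plane → Plane × ℝ, ContDiffAt ℝ ∞ φ p₀ ∧
      ∀ᶠ p in 𝓝 p₀, IsLowestSheet F s p (φ p).1 (φ p).2 := by
  have hpd := ball_subset_disk hp
  obtain ⟨φ, hφ, hφ0, hφeq, hφu⟩ := exists_implicit_sheet A hpd S.sheet.mem S.sheet.eq S.sheet.pos.ne'
  refine ⟨φ, hφ, ?_⟩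
  have c1 : Tendsto (fun p => (φ p).1) (𝓝 p₀) (𝓝 q₀) := by
    have := hφ.continuousAt.fst
    rwa [ContinuousAt, hφ0] at this
  have c2 : Tendsto (fun p => (φ p).2) (𝓝 p₀) (𝓝 t₀) := by
    have := hφ.continuousAt.snd
    rwa [ContinuousAt, hφ0] at this
  have evp : ∀ᶠ p in 𝓝 p₀, p ∈ ball (0 : Plane) 1 := isOpen_ball.eventually_mem hp
  have evM : ∀ᶠ p in 𝓝 p₀, ‖F p‖ < M :=
    A.smooth.continuous.norm.continuousAt.eventually (gt_mem_nhds hpM)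
  have evα : ∀ᶠ p in 𝓝 p₀, |(φ p).2| < α := c2.abs.eventually (gt_mem_nhds ht)
  have evq : ∀ᶠ p in 𝓝 p₀, (φ p).1 ∈ disk := by
    have h1 : ‖F q₀‖ < L := by
      rw [S.sheet.eq]
      refine (norm_add_le _ _).trans_lt ?_
      rw [norm_smul, norm_unitNormal (A.inj hpd), mul_one, Real.norm_eq_abs]
      linarith
    exact (c1.eventually (isOpen_ball.eventually_mem (A.mem_ball_of_norm_lt S.sheet.mem h1))).mono
      fun _ hn => ball_subset_disk hn
  have evS : ∀ᶠ p in 𝓝 p₀, IsSheetAt F s p (φ p).1 (φ p).2 := by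
    have e1 : ∀ᶠ p in 𝓝 p₀, 0 < s * (φ p).2 :=
      (c2.const_mul s).eventually (lt_mem_nhds S.sheet.sign)
    have e2 : ∀ᶠ p in 𝓝 p₀, 0 < inner ℝ (unitNormal F p) (unitNormal F (φ p).1) :=
      ((A.contDiffAt_normal hpd).continuousAt.tendsto.inner
        ((A.contDiffAt_normal S.sheet.mem).continuousAt.tendsto.comp c1)).eventually
        (lt_mem_nhds S.sheet.pos)
    filter_upwards [e1, e2, evq, hφeq] with p h1 h2 h3 h4
    exact ⟨h3, h4, h1, h2⟩
  -- Near `p₀` no other sheet is as low as the implicit branch: a sequence of such sheets would tend to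
  -- a lowest sheet over `p₀`, hence to the given one, near which the branch is the only sheet.
  have key : ∀ᶠ p in 𝓝 p₀, ∀ q t, IsSheetAt F s p q t → |t| ≤ |(φ p).2| → φ p = (q, t) := by
    by_contra hcon
    obtain ⟨pn, hpn, hbad⟩ := exists_seq_forall_of_frequently (not_eventually.mp hcon)
    push Not at hbad
    choose qn tn hSn htn hne using hbad
    have hbd : ∀ᶠ n in atTop, (qn n, tn n) ∈ disk ×ˢ Icc (-α) α := by
      filter_upwards [hpn.eventually evα] with n hn
      exact ⟨(hSn n).mem, abs_le.mp ((htn n).trans hn.le)⟩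
    obtain ⟨⟨q, t⟩, -, κ, hκ, hlim⟩ :=
      ((isCompact_closedBall (0 : Plane) 1).prod isCompact_Icc).tendsto_subseq' hbd.frequently
    have hpk := hpn.comp hκ.tendsto_atTop
    have l1 := (continuous_fst.tendsto _).comp hlim
    have l2 := (continuous_snd.tendsto _).comp hlim
    have S' : IsSheetAt F s p₀ q t := by
      refine isSheetAt_of_tendsto A hT he (p := pn ∘ κ) hpd ?_ (hpk.eventually evM)
        (fun n => hSn (κ n)) ?_ hpk l1 l2
      · exact (hpk.eventually evp).mono fun n hn => ball_subset_disk hn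
      · filter_upwards [hpk.eventually evα] with n hn
        exact (htn (κ n)).trans hn.le
    have hle : |t| ≤ |t₀| := le_of_tendsto_of_tendsto' l2.abs (c2.comp hpk).abs fun n => htn (κ n)
    obtain rfl := eq_of_abs_eq_of_mul_pos (le_antisymm hle (S.le S')) S'.sign S.sheet.sign
    obtain rfl := A.embedded.injOn S'.mem S.sheet.mem (S'.eq.trans S.sheet.eq.symm)
    obtain ⟨n, hn⟩ := ((hpk.prodMk_nhds hlim).eventually hφu).exists
    exact hne (κ n) (hn (hSn (κ n)).eq)
  filter_upwards [key, evS, evp, evM, evα] with p h1 h2 h3 h4 h5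
  obtain ⟨q, t, Sl⟩ := exists_isLowestSheet A hT he (ball_subset_disk h3) h4 h2 h5.le
  rw [h1 q t Sl.sheet (Sl.le h2)]
  exact Sl

end Lowest

section SheetFunction

open Filter Topology

variable {F : Plane → Space} {h C L : ℝ}

/-- Near `p` the function `u` is the signed height, and `ψ` the parameter, of a sheet over the
surface. The sheet is close to the surface, with respect to the curvature bound `|kᵢ| ≤ 2C`, to the
order `τ`. -/
structure IsSheetFunction (F : Plane → Space) (C τ : ℝ) (u : Plane → ℝ) (ψ : Plane → Plane)
    (p : Plane) : Prop where
  smooth_height : ContDiffAt ℝ ∞ u p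
  smooth_param : ContDiffAt ℝ ∞ ψ p
  mem : ψ p ∈ disk
  eq : ∀ᶠ p' in 𝓝 p, F (ψ p') = F p' + u p' • unitNormal F p'
  ne : u p ≠ 0
  height_le : |u p| * (2 * C) ≤ τ
  tilt : 1 - τ ≤ inner ℝ (unitNormal F p) (unitNormal F (ψ p))

/-- The height and the parameter of the lowest sheet are sheet functions. -/
theorem exists_isSheetFunction (A : IsAdmissible F h C L) {s M α e τ θ : ℝ}
    (hT : HasTiltBound F s M α e) (he : 0 < 1 - e ^ 2) (heτ : e ^ 2 ≤ τ) (hθα : θ < α)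
    (hθτ : θ * (2 * C) ≤ τ) (hC : 0 < C) (hM : M + α ≤ L) {Ω : Set Plane}
    (hΩ : ∀ p ∈ Ω, p ∈ disk ∧ ‖F p‖ < M ∧ ∃ q t, IsSheetAt F s p q t ∧ |t| ≤ θ) :
    ∃ u ψ, ∀ p ∈ Ω, IsSheetFunction F C τ u ψ p := by
  classical
  have hex : ∀ p, ∃ x : Plane × ℝ, (∃ q t, IsLowestSheet F s p q t) → IsLowestSheet F s p x.1 x.2 := by
    intro p
    by_cases hp : ∃ q t, IsLowestSheet F s p q t
    · obtain ⟨q, t, S⟩ := hp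
      exact ⟨(q, t), fun _ => S⟩
    · exact ⟨(0, 0), fun hp' => absurd hp' hp⟩
  choose g hg using hex
  refine ⟨fun p => (g p).2, fun p => (g p).1, ?_⟩
  intro p hp
  obtain ⟨hpd, hpM, q, t, S, ht⟩ := hΩ p hp
  have Sl := hg p (exists_isLowestSheet A hT he hpd hpM S (ht.trans hθα.le))
  have hle : |(g p).2| ≤ θ := (Sl.le S).trans ht
  have hαnn : 0 < α := (abs_nonneg _).trans_lt (hle.trans_lt hθα)
  have hpb : p ∈ ball (0 : Plane) 1 := A.mem_ball_of_norm_lt hpd (by linarith)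
  obtain ⟨φ, hφ, hφS⟩ := Sl.exists_contDiffAt A hT he hpb hpM (hle.trans_lt hθα) hM
  have heq : g =ᶠ[𝓝 p] φ := by
    filter_upwards [hφS] with p' h1
    exact (hg p' ⟨_, _, h1⟩).unique A h1
  have hsm : ContDiffAt ℝ ∞ g p := hφ.congr_of_eventuallyEq heq
  refine ⟨hsm.snd, hsm.fst, Sl.sheet.mem, ?_, ?_, ?_, ?_⟩
  · filter_upwards [hφS] with p' h1
    exact (hg p' ⟨_, _, h1⟩).sheet.eq
  · intro h0
    have := Sl.sheet.sign
    rw [h0, mul_zero] at this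
    exact lt_irrefl _ this
  · exact (mul_le_mul_of_nonneg_right hle (by positivity)).trans hθτ
  · have := hT hpd hpM Sl.sheet (hle.trans hθα.le)
    linarith

end SheetFunction

/-! ### The divergence identity -/

section Divergence

open Filter Topology

variable {F : Plane → Space} {h C L : ℝ}

/-- The one-form `v ↦ ⟨N, dG v × N₂⟩` at `p`, where `G = F ∘ ψ` and `N₂ = N ∘ ψ`. -/
def sheetForm (F : Plane → Space) (ψ : Plane → Plane) (v p : Plane) : ℝ :=
  inner ℝ (unitNormal F p) (cross (fderiv ℝ (fun x => F (ψ x)) p v) (unitNormal F (ψ p)))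

/-- The exterior derivative of the one-form `⟨N, dG × N₂⟩`, evaluated on `(v, w)`: the derivative
of `N₂` enters only through the mean curvature. -/
def sheetDiv (F : Plane → Space) (ψ : Plane → Plane) (p v w : Plane) : ℝ :=
  inner ℝ (fderiv ℝ (unitNormal F) p v)
      (cross (fderiv ℝ (fun x => F (ψ x)) p w) (unitNormal F (ψ p))) -
    inner ℝ (fderiv ℝ (unitNormal F) p w)
      (cross (fderiv ℝ (fun x => F (ψ x)) p v) (unitNormal F (ψ p))) +
    meanCurvature F (ψ p) * inner ℝ (unitNormal F p)
      (cross (fderiv ℝ (fun x => F (ψ x)) p v) (fderiv ℝ (fun x => F (ψ x)) p w))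

theorem fderiv_cross {f g : Plane → Space} {p : Plane} (hf : DifferentiableAt ℝ f p)
    (hg : DifferentiableAt ℝ g p) (v : Plane) : fderiv ℝ (fun x => cross (f x) (g x)) p v =
      cross (f p) (fderiv ℝ g p v) + cross (fderiv ℝ f p v) (g p) := by
  have h1 := crossL.hasFDerivAt_of_bilinear hf.hasFDerivAt hg.hasFDerivAt
  have h2 : HasFDerivAt (fun x => cross (f x) (g x)) _ p := h1
  rw [h2.fderiv]
  simp

theorem contDiffAt_sheetForm {ψ : Plane → Plane} {p : Plane} (hF : ContDiff ℝ ∞ F)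
    (hN : ContDiffAt ℝ ∞ (unitNormal F) p) (hψ : ContDiffAt ℝ ∞ ψ p)
    (hN2 : ContDiffAt ℝ ∞ (unitNormal F) (ψ p)) (v : Plane) :
    ContDiffAt ℝ ∞ (sheetForm F ψ v) p := by
  have hG : ContDiffAt ℝ ∞ (fun x => F (ψ x)) p := hF.contDiffAt.comp p hψ
  have hdG : ContDiffAt ℝ ∞ (fun x => fderiv ℝ (fun x => F (ψ x)) x v) p :=
    (hG.fderiv_right (m := ∞) (by simp)).clm_apply contDiffAt_const
  exact hN.inner ℝ (contDiffAt_cross hdG (hN2.comp p hψ))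

/-- The divergence identity. The second derivatives of `G` cancel by symmetry, and the derivative of
`N₂` gives the mean curvature by `cross_fderiv_unitNormal`, which is independent of the parameter. -/
theorem fderiv_sheetForm_sub {ψ : Plane → Plane} {p : Plane} (hF : ContDiff ℝ ∞ F)
    (hN : ContDiffAt ℝ ∞ (unitNormal F) p) (hψ : ContDiffAt ℝ ∞ ψ p)
    (hi2 : Function.Injective (fderiv ℝ F (ψ p))) (v w : Plane) :
    fderiv ℝ (sheetForm F ψ w) p v - fderiv ℝ (sheetForm F ψ v) p w = sheetDiv F ψ p v w := by
  have hN2 := contDiffAt_unitNormal hF hi2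
  set G : Plane → Space := fun x => F (ψ x) with hG'
  have hG : ContDiffAt ℝ ∞ G p := hF.contDiffAt.comp p hψ
  have hdG : ContDiffAt ℝ ∞ (fderiv ℝ G) p := hG.fderiv_right (m := ∞) (by simp)
  have hdGd : DifferentiableAt ℝ (fderiv ℝ G) p := hdG.differentiableAt (by simp)
  have hNd : DifferentiableAt ℝ (unitNormal F) p := hN.differentiableAt (by simp)
  have hN2d : DifferentiableAt ℝ (fun x => unitNormal F (ψ x)) p :=
    (hN2.comp p hψ).differentiableAt (by simp)
  have hsymm : fderiv ℝ (fderiv ℝ G) p v w = fderiv ℝ (fderiv ℝ G) p w v :=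
    (hG.isSymmSndFDerivAt (by simpa using (WithTop.coe_le_coe.2 le_top : ((2 : ℕ∞) : ℕ∞ω) ≤ (∞ : ℕ∞ω)))).eq v w
  have hder : ∀ a b : Plane, fderiv ℝ (sheetForm F ψ b) p a =
      inner ℝ (unitNormal F p) (cross (fderiv ℝ G p b) (fderiv ℝ (fun x => unitNormal F (ψ x)) p a) +
        cross (fderiv ℝ (fderiv ℝ G) p a b) (unitNormal F (ψ p))) +
      inner ℝ (fderiv ℝ (unitNormal F) p a) (cross (fderiv ℝ G p b) (unitNormal F (ψ p))) := by
    intro a b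
    have h1 : DifferentiableAt ℝ (fun x => fderiv ℝ G x b) p := hdGd.clm_apply (differentiableAt_const b)
    have h2 : DifferentiableAt ℝ (fun x => cross (fderiv ℝ G x b) (unitNormal F (ψ x))) p := by
      have := (crossL.hasFDerivAt_of_bilinear h1.hasFDerivAt hN2d.hasFDerivAt).differentiableAt
      exact this
    have h3 : fderiv ℝ (fun x => fderiv ℝ G x b) p a = fderiv ℝ (fderiv ℝ G) p a b := by
      rw [fderiv_clm_apply hdGd (differentiableAt_const b)]
      simp
    change fderiv ℝ (fun x => inner ℝ (unitNormal F x)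
      (cross (fderiv ℝ G x b) (unitNormal F (ψ x)))) p a = _
    rw [fderiv_inner_apply ℝ hNd h2, fderiv_cross h1 hN2d, h3]
  have hGc : ∀ a, fderiv ℝ G p a = fderiv ℝ F (ψ p) (fderiv ℝ ψ p a) := by
    intro a
    rw [hG', fderiv_fun_comp p (hF.contDiffAt.differentiableAt (by simp)) (hψ.differentiableAt (by simp))]
    rfl
  have hNc : ∀ a, fderiv ℝ (fun x => unitNormal F (ψ x)) p a =
      fderiv ℝ (unitNormal F) (ψ p) (fderiv ℝ ψ p a) := by
    intro a
    rw [fderiv_fun_comp p (hN2.differentiableAt (by simp)) (hψ.differentiableAt (by simp))]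
    rfl
  have hcmc := cross_fderiv_unitNormal hF hi2 (fderiv ℝ ψ p v) (fderiv ℝ ψ p w)
  rw [cross_swap (fderiv ℝ (unitNormal F) (ψ p) (fderiv ℝ ψ p w)), ← hGc, ← hGc, ← hNc, ← hNc] at hcmc
  have hcmc' := congrArg (fun x => inner ℝ (unitNormal F p) x) hcmc
  simp only [inner_add_right, inner_neg_right, real_inner_smul_right] at hcmc'
  rw [hder v w, hder w v, sheetDiv, hsymm]
  simp only [inner_add_right]
  linarith

end Divergence

/-! ### Pointwise estimates -/

section Pointwise

variable {F : Plane → Space} {h C L : ℝ}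

/-- For a unit vector `ν (1, -a, -b)` the number `1 - ν (1 + a²)` is of second order in the tilt. -/
theorem abs_one_sub_mul_le {ν a b : ℝ} (hν : 0 < ν) (hν1 : ν ≤ 1)
    (hab : ν ^ 2 * (1 + a ^ 2 + b ^ 2) = 1) : |1 - ν * (1 + a ^ 2)| ≤ a ^ 2 + b ^ 2 := by
  have e1 : ν ^ 2 * (a ^ 2 + b ^ 2) ≤ 1 * (a ^ 2 + b ^ 2) :=
    mul_le_mul_of_nonneg_right (pow_le_one₀ hν.le hν1) (by positivity)
  have e2 : ν ^ 2 ≤ ν := by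
    rw [pow_two]
    exact mul_le_of_le_one_right hν.le hν1
  have e3 : ν * (1 + a ^ 2) ≤ 1 * (1 + a ^ 2) := mul_le_mul_of_nonneg_right hν1 (by positivity)
  have e4 : 0 ≤ ν * a ^ 2 := by positivity
  have e5 : ν ^ 2 * (1 + a ^ 2 + b ^ 2) = ν ^ 2 + ν ^ 2 * (a ^ 2 + b ^ 2) := by ring
  rw [abs_le]
  constructor <;> linarith [sq_nonneg b]

theorem two_mul_le_sq_add {κ μ b z T : ℝ} (hμ : 0 ≤ μ) (hT : μ ≤ T) :
    κ * (2 * μ * (b * z)) ≤ b ^ 2 + κ ^ 2 * T ^ 2 * z ^ 2 := by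
  have e2 : μ ^ 2 ≤ T ^ 2 := pow_le_pow_left₀ hμ hT 2
  have e3 : κ ^ 2 * z ^ 2 * μ ^ 2 ≤ κ ^ 2 * z ^ 2 * T ^ 2 :=
    mul_le_mul_of_nonneg_left e2 (by positivity)
  have e4 : (b - κ * μ * z) ^ 2 = b ^ 2 - κ * (2 * μ * (b * z)) + κ ^ 2 * z ^ 2 * μ ^ 2 := by ring
  linarith [sq_nonneg (b - κ * μ * z)]

/-- The Young inequality behind stability. Here `φ = u s` is the test function, `bᵢ` are the
components of its gradient and `-cᵢ` those of `N₂ / ν` in a principal frame; the parenthesis on the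
right-hand side is the exterior derivative of `(φ² / u) ⟨N, dG × N₂⟩` in this frame. -/
theorem young_stability {τ s u k₁ k₂ ν c₁ c₂ b₁ b₂ : ℝ} (hτ : 0 < τ) (hτ1 : τ ≤ 1 / 20)
    (h1 : |u * k₁| ≤ τ) (h2 : |u * k₂| ≤ τ) (hν : 1 - τ ≤ ν)
    (hν1 : ν ^ 2 * (1 + c₁ ^ 2 + c₂ ^ 2) = 1) :
    (1 - 9 * τ) * (k₁ ^ 2 + k₂ ^ 2) * (u * s) ^ 2 - (b₁ ^ 2 + b₂ ^ 2) ≤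
      -(1 - 8 * τ) * (2 * ν * (b₁ * (1 - u * k₂) * (s * c₁) + b₂ * (1 - u * k₁) * (s * c₂)) -
        (1 - u * k₁) * (1 - u * k₂) * ν * ((s * c₁) ^ 2 + (s * c₂) ^ 2) +
        u * s ^ 2 * ((k₁ + k₂) * (1 - u * k₁) * (1 - u * k₂) -
          k₁ * ((1 - u * k₂) * ν + (1 - u * k₂) * ν * c₂ ^ 2) -
          k₂ * ((1 - u * k₁) * ν + (1 - u * k₁) * ν * c₁ ^ 2))) := by
  obtain ⟨x, hx⟩ : ∃ x, x = u * k₁ := ⟨_, rfl⟩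
  obtain ⟨y, hy⟩ : ∃ y, y = u * k₂ := ⟨_, rfl⟩
  rw [← hx] at h1
  rw [← hy] at h2
  obtain ⟨hx1, hx2⟩ := abs_le.mp h1
  obtain ⟨hy1, hy2⟩ := abs_le.mp h2
  have hνpos : 0 < ν := by linarith
  have hνle : ν ≤ 1 := by
    have e1 : 0 ≤ ν ^ 2 * (c₁ ^ 2 + c₂ ^ 2) := by positivity
    have e2 : ν ^ 2 ≤ 1 := by linarith
    exact (sq_le_one_iff₀ hνpos.le).mp e2
  -- `η₁ = 1 - ν (1 + c₁²)` and `η₂ = 1 - ν (1 + c₂²)` are of second order in `c`.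
  have hη1 := abs_one_sub_mul_le hνpos hνle hν1
  have hη2 := abs_one_sub_mul_le (a := c₂) (b := c₁) hνpos hνle (by linarith)
  set c := c₁ ^ 2 + c₂ ^ 2 with hc
  have hc0 : 0 ≤ c := by positivity
  have hη2' : |1 - ν * (1 + c₂ ^ 2)| ≤ c := by linarith
  set η₁ := 1 - ν * (1 + c₁ ^ 2) with hη1d
  set η₂ := 1 - ν * (1 + c₂ ^ 2) with hη2d
  obtain ⟨z₁, hz1⟩ : ∃ z, z = s * c₁ := ⟨_, rfl⟩
  obtain ⟨z₂, hz2⟩ : ∃ z, z = s * c₂ := ⟨_, rfl⟩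
  have hzc : z₁ ^ 2 + z₂ ^ 2 = s ^ 2 * c := by rw [hz1, hz2, hc]; ring
  have hQ : u * s ^ 2 * ((k₁ + k₂) * (1 - u * k₁) * (1 - u * k₂) -
          k₁ * ((1 - u * k₂) * ν + (1 - u * k₂) * ν * c₂ ^ 2) -
          k₂ * ((1 - u * k₁) * ν + (1 - u * k₁) * ν * c₁ ^ 2)) =
      s ^ 2 * (-(x ^ 2 * (1 - y) + y ^ 2 * (1 - x)) + (x * (1 - y) * η₂ + y * (1 - x) * η₁)) := by
    rw [hx, hy, hη1d, hη2d]; ring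
  have hlhs : (1 - 9 * τ) * (k₁ ^ 2 + k₂ ^ 2) * (u * s) ^ 2 =
      (1 - 9 * τ) * (s ^ 2 * (x ^ 2 + y ^ 2)) := by rw [hx, hy]; ring
  rw [hQ, hlhs, ← hx, ← hy, ← hz1, ← hz2]
  obtain ⟨κ, hκ⟩ : ∃ κ, κ = 1 - 8 * τ := ⟨_, rfl⟩
  have hκpos : 0 < κ := by linarith
  -- the terms of first order in the gradient of `φ`
  have hcross : ∀ b m z : ℝ, 0 ≤ m → m ≤ 1 + τ →
      κ * (2 * ν * (b * m * z)) ≤ b ^ 2 + κ ^ 2 * (1 + τ) ^ 2 * z ^ 2 := by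
    intro b m z hm hm1
    have e1 : ν * m ≤ 1 * (1 + τ) := by gcongr
    rw [one_mul] at e1
    have := two_mul_le_sq_add (κ := κ) (b := b) (z := z) (mul_nonneg hνpos.le hm) e1
    calc _ = κ * (2 * (ν * m) * (b * z)) := by ring
      _ ≤ _ := this
  have hc1 := hcross b₁ (1 - y) z₁ (by linarith) (by linarith)
  have hc2 := hcross b₂ (1 - x) z₂ (by linarith) (by linarith)
  -- the terms of second order in `c`
  have hprod : ∀ a m η : ℝ, |a| ≤ τ → 0 ≤ m → m ≤ 1 + τ → |η| ≤ c → a * m * η ≤ τ * (1 + τ) * c := by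
    intro a m η ha hm hm1 hη
    calc a * m * η ≤ |a * m * η| := le_abs_self _
      _ = |a| * m * |η| := by rw [abs_mul, abs_mul, abs_of_nonneg hm]
      _ ≤ τ * (1 + τ) * c := by gcongr
  have hp1 := hprod x (1 - y) η₂ h1 (by linarith) (by linarith) hη2'
  have hp2 := hprod y (1 - x) η₁ h2 (by linarith) (by linarith) hη1
  have hm : (1 - τ) ^ 3 ≤ (1 - x) * (1 - y) * ν := by
    have e1 : (1 - τ) * (1 - τ) ≤ (1 - x) * (1 - y) :=
      mul_le_mul (by linarith) (by linarith) (by linarith) (by linarith)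
    calc (1 - τ) ^ 3 = (1 - τ) * (1 - τ) * (1 - τ) := by ring
      _ ≤ (1 - x) * (1 - y) * ν :=
        mul_le_mul e1 hν (by linarith) (mul_nonneg (by linarith) (by linarith))
  have hxy : (1 - τ) * (x ^ 2 + y ^ 2) ≤ x ^ 2 * (1 - y) + y ^ 2 * (1 - x) := by
    have e1 := mul_le_mul_of_nonneg_left (sub_le_sub_left hy2 1) (sq_nonneg x)
    have e2 := mul_le_mul_of_nonneg_left (sub_le_sub_left hx2 1) (sq_nonneg y)
    linarith
  have hs0 := sq_nonneg s
  have g1 : s ^ 2 * c * (1 - τ) ^ 3 ≤ s ^ 2 * c * ((1 - x) * (1 - y) * ν) :=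
    mul_le_mul_of_nonneg_left hm (by positivity)
  have g2 : s ^ 2 * (x * (1 - y) * η₂ + y * (1 - x) * η₁) ≤ s ^ 2 * (2 * (τ * (1 + τ) * c)) :=
    mul_le_mul_of_nonneg_left (by linarith) hs0
  have g3 : s ^ 2 * ((1 - τ) * (x ^ 2 + y ^ 2)) ≤ s ^ 2 * (x ^ 2 * (1 - y) + y ^ 2 * (1 - x)) :=
    mul_le_mul_of_nonneg_left hxy hs0
  have g4 : κ * (1 + τ) ^ 2 ≤ (1 - τ) ^ 3 - 2 * τ * (1 + τ) := by
    have : (1 - τ) ^ 3 - 2 * τ * (1 + τ) - κ * (1 + τ) ^ 2 = τ + 16 * τ ^ 2 + 7 * τ ^ 3 := by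
      rw [hκ]; ring
    have : 0 ≤ τ + 16 * τ ^ 2 + 7 * τ ^ 3 := by positivity
    linarith
  have g5 : s ^ 2 * c * (κ * (κ * (1 + τ) ^ 2)) ≤
      s ^ 2 * c * (κ * ((1 - τ) ^ 3 - 2 * τ * (1 + τ))) :=
    mul_le_mul_of_nonneg_left (mul_le_mul_of_nonneg_left g4 hκpos.le) (by positivity)
  have g6 : (1 - 9 * τ) * (s ^ 2 * (x ^ 2 + y ^ 2)) ≤ κ * (s ^ 2 * ((1 - τ) * (x ^ 2 + y ^ 2))) := by
    have : κ * (s ^ 2 * ((1 - τ) * (x ^ 2 + y ^ 2))) - (1 - 9 * τ) * (s ^ 2 * (x ^ 2 + y ^ 2)) =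
      8 * τ ^ 2 * (s ^ 2 * (x ^ 2 + y ^ 2)) := by rw [hκ]; ring
    have : 0 ≤ 8 * τ ^ 2 * (s ^ 2 * (x ^ 2 + y ^ 2)) := by positivity
    linarith
  have f1 := mul_le_mul_of_nonneg_left g1 hκpos.le
  have f2 := mul_le_mul_of_nonneg_left g2 hκpos.le
  have f3 := mul_le_mul_of_nonneg_left g3 hκpos.le
  have hz : κ ^ 2 * (1 + τ) ^ 2 * z₁ ^ 2 + κ ^ 2 * (1 + τ) ^ 2 * z₂ ^ 2 =
      s ^ 2 * c * (κ * (κ * (1 + τ) ^ 2)) := by rw [← mul_add, hzc]; ring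
  rw [← hκ, hzc]
  have efin : -κ * (2 * ν * (b₁ * (1 - y) * z₁ + b₂ * (1 - x) * z₂) -
        (1 - x) * (1 - y) * ν * (s ^ 2 * c) +
        s ^ 2 * (-(x ^ 2 * (1 - y) + y ^ 2 * (1 - x)) + (x * (1 - y) * η₂ + y * (1 - x) * η₁))) =
      -(κ * (2 * ν * (b₁ * (1 - y) * z₁))) - κ * (2 * ν * (b₂ * (1 - x) * z₂)) +
        κ * (s ^ 2 * c * ((1 - x) * (1 - y) * ν)) +
        κ * (s ^ 2 * (x ^ 2 * (1 - y) + y ^ 2 * (1 - x))) -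
        κ * (s ^ 2 * (x * (1 - y) * η₂ + y * (1 - x) * η₁)) := by ring
  rw [efin]
  have egood : s ^ 2 * c * (κ * ((1 - τ) ^ 3 - 2 * τ * (1 + τ))) =
      κ * (s ^ 2 * c * (1 - τ) ^ 3) - κ * (s ^ 2 * (2 * (τ * (1 + τ) * c))) := by ring
  linarith

end Pointwise

section Frame

open Filter Topology

variable {F : Plane → Space} {h C L : ℝ}

theorem sheetForm_eq (F : Plane → Space) (ψ : Plane → Plane) (p v : Plane) :
    sheetForm F ψ v p = v 0 * sheetForm F ψ (EuclideanSpace.single 0 1) p +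
      v 1 * sheetForm F ψ (EuclideanSpace.single 1 1) p := by
  unfold sheetForm
  rw [clm_plane_eq (fderiv ℝ (fun x => F (ψ x)) p) v]
  simp only [cross_add_left, cross_smul_left, inner_add_right, real_inner_smul_right]

theorem sheetDiv_eq (F : Plane → Space) (ψ : Plane → Plane) (p v w : Plane) :
    sheetDiv F ψ p v w = (v 0 * w 1 - v 1 * w 0) *
      sheetDiv F ψ p (EuclideanSpace.single 0 1) (EuclideanSpace.single 1 1) := by
  unfold sheetDiv
  rw [clm_plane_eq (fderiv ℝ (fun x => F (ψ x)) p) v, clm_plane_eq (fderiv ℝ (fun x => F (ψ x)) p) w,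
    clm_plane_eq (fderiv ℝ (unitNormal F) p) v, clm_plane_eq (fderiv ℝ (unitNormal F) p) w]
  obtain ⟨G0, hG0⟩ : ∃ x, x = fderiv ℝ (fun x => F (ψ x)) p (EuclideanSpace.single 0 1) := ⟨_, rfl⟩
  obtain ⟨G1, hG1⟩ : ∃ x, x = fderiv ℝ (fun x => F (ψ x)) p (EuclideanSpace.single 1 1) := ⟨_, rfl⟩
  obtain ⟨N0, hN0⟩ : ∃ x, x = fderiv ℝ (unitNormal F) p (EuclideanSpace.single 0 1) := ⟨_, rfl⟩
  obtain ⟨N1, hN1⟩ : ∃ x, x = fderiv ℝ (unitNormal F) p (EuclideanSpace.single 1 1) := ⟨_, rfl⟩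
  simp only [← hG0, ← hG1, ← hN0, ← hN1, cross_add_left, cross_smul_left, cross_add_right,
    cross_smul_right, inner_add_right, real_inner_smul_right, inner_add_left, real_inner_smul_left,
    cross_self, cross_swap G1 G0, inner_neg_right, inner_zero_right]
  ring

/-- The first order data of a sheet function in a principal frame: with
`N₂ = ν (N - c₁ e₁ - c₂ e₂)`, everything is expressed by `ν`, `c`, the height and the principal
curvatures. -/
theorem IsSheetFunction.exists_frame {τ : ℝ} {u : Plane → ℝ} {ψ : Plane → Plane} {p : Plane}
    (A : IsAdmissible F h C L) (S : IsSheetFunction F C τ u ψ p) (hτ1 : τ < 1) (hp : p ∈ disk)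
    {v₁ v₂ : Plane} {k₁ k₂ : ℝ} (P : IsPrincipal F p v₁ v₂ k₁ k₂) :
    ∃ ν c₁ c₂ : ℝ, 1 - τ ≤ ν ∧ ν ^ 2 * (1 + c₁ ^ 2 + c₂ ^ 2) = 1 ∧
      fderiv ℝ u p v₁ = (1 - u p * k₁) * c₁ ∧ fderiv ℝ u p v₂ = (1 - u p * k₂) * c₂ ∧
      sheetForm F ψ v₁ p = -((1 - u p * k₁) * ν * c₂) ∧
      sheetForm F ψ v₂ p = (1 - u p * k₂) * ν * c₁ ∧
      sheetDiv F ψ p v₁ v₂ = (k₁ + k₂) * (1 - u p * k₁) * (1 - u p * k₂) -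
          k₁ * ((1 - u p * k₂) * ν + (1 - u p * k₂) * ν * c₂ ^ 2) -
          k₂ * ((1 - u p * k₁) * ν + (1 - u p * k₁) * ν * c₁ ^ 2) := by
  have hN := A.contDiffAt_normal hp
  have hdG : ∀ v, fderiv ℝ (fun x => F (ψ x)) p v = fderiv ℝ F p v +
      (u p • fderiv ℝ (unitNormal F) p v + fderiv ℝ u p v • unitNormal F p) := by
    intro v
    have e1 : (fun x => F (ψ x)) =ᶠ[𝓝 p] fun x => F x + u x • unitNormal F x := S.eq
    have hu := S.smooth_height.differentiableAt (by simp)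
    have hNd := hN.differentiableAt (by simp)
    have hs : DifferentiableAt ℝ (fun x => u x • unitNormal F x) p := hu.smul hNd
    rw [e1.fderiv_eq, fderiv_fun_add (A.smooth.contDiffAt.differentiableAt (by simp)) hs,
      fderiv_fun_smul hu hNd]
    simp
  have hperp : ∀ v, inner ℝ (unitNormal F (ψ p)) (fderiv ℝ (fun x => F (ψ x)) p v) = 0 := by
    intro v
    rw [fderiv_fun_comp p (A.smooth.contDiffAt.differentiableAt (by simp))
      (S.smooth_param.differentiableAt (by simp))]
    exact inner_unitNormal_fderiv F (ψ p) _
  have hmean : meanCurvature F (ψ p) = k₁ + k₂ := by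
    rw [A.cmc _ S.mem, ← A.cmc _ hp, P.mean]
  have hn2 := norm_unitNormal (A.inj S.mem)
  have htilt := S.tilt
  have g1 := hdG v₁
  have g2 := hdG v₂
  have p1 := hperp v₁
  have p2 := hperp v₂
  rw [P.dN1] at g1
  rw [P.dN2] at g2
  unfold sheetForm sheetDiv
  rw [P.dN1, P.dN2, hmean]
  have H := P.frame
  obtain ⟨G1, hG1⟩ : ∃ x, x = fderiv ℝ (fun x => F (ψ x)) p v₁ := ⟨_, rfl⟩
  obtain ⟨G2, hG2⟩ : ∃ x, x = fderiv ℝ (fun x => F (ψ x)) p v₂ := ⟨_, rfl⟩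
  obtain ⟨e1, he1⟩ : ∃ x, x = fderiv ℝ F p v₁ := ⟨_, rfl⟩
  obtain ⟨e2, he2⟩ : ∃ x, x = fderiv ℝ F p v₂ := ⟨_, rfl⟩
  obtain ⟨n, hn⟩ : ∃ x, x = unitNormal F p := ⟨_, rfl⟩
  obtain ⟨X, hX⟩ : ∃ x, x = unitNormal F (ψ p) := ⟨_, rfl⟩
  obtain ⟨a1, ha1⟩ : ∃ x, x = fderiv ℝ u p v₁ := ⟨_, rfl⟩
  obtain ⟨a2, ha2⟩ : ∃ x, x = fderiv ℝ u p v₂ := ⟨_, rfl⟩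
  simp only [← hG1, ← hG2, ← he1, ← he2, ← hn, ← hX, ← ha1, ← ha2] at *
  obtain ⟨ν, hν⟩ : ∃ x, x = inner ℝ X n := ⟨_, rfl⟩
  obtain ⟨x1, hx1⟩ : ∃ x, x = inner ℝ X e1 := ⟨_, rfl⟩
  obtain ⟨x2, hx2⟩ : ∃ x, x = inner ℝ X e2 := ⟨_, rfl⟩
  have hg1 : G1 = (1 - u p * k₁) • e1 + a1 • n := by rw [g1]; module
  have hg2 : G2 = (1 - u p * k₂) • e2 + a2 • n := by rw [g2]; module
  have t1 : inner ℝ n (cross e1 X) = x2 := by rw [inner_cross_rotate, H.c31, hx2]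
  have t2 : inner ℝ n (cross e2 X) = -x1 := by
    rw [inner_cross_rotate, cross_swap, H.c23, inner_neg_right, hx1]
  have t3 : inner ℝ n (cross n X) = 0 := by rw [inner_cross_rotate, cross_self, inner_zero_right]
  have t4 : inner ℝ e1 (cross e2 X) = ν := by rw [inner_cross_rotate, H.hc, hν]
  have t5 : inner ℝ e1 (cross n X) = -x2 := by
    rw [inner_cross_rotate, cross_swap, H.c31, inner_neg_right, hx2]
  have t6 : inner ℝ e2 (cross e1 X) = -ν := by
    rw [inner_cross_rotate, cross_swap, H.hc, inner_neg_right, hν]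
  have t7 : inner ℝ e2 (cross n X) = x1 := by rw [inner_cross_rotate, H.c23, hx1]
  rw [real_inner_comm, ← hν] at htilt
  have hνpos : 0 < ν := by linarith
  have q1 : (1 - u p * k₁) * x1 + a1 * ν = 0 := by
    rw [hg1, inner_add_right, real_inner_smul_right, real_inner_smul_right, ← hx1, ← hν] at p1
    exact p1
  have q2 : (1 - u p * k₂) * x2 + a2 * ν = 0 := by
    rw [hg2, inner_add_right, real_inner_smul_right, real_inner_smul_right, ← hx2, ← hν] at p2
    exact p2
  have hsq : x1 ^ 2 + x2 ^ 2 + ν ^ 2 = 1 := by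
    have := H.norm_sq X
    rw [hn2, ← hx1, ← hx2, ← hν] at this
    linarith
  obtain ⟨c1, hc1⟩ : ∃ c, c = -x1 / ν := ⟨_, rfl⟩
  obtain ⟨c2, hc2⟩ : ∃ c, c = -x2 / ν := ⟨_, rfl⟩
  have hx1' : x1 = -(ν * c1) := by rw [hc1]; field_simp
  have hx2' : x2 = -(ν * c2) := by rw [hc2]; field_simp
  -- The slope of the height is determined by the tilt, as `dG v = m e + (du v) N` is orthogonal to `N₂`.
  have r1 : a1 = (1 - u p * k₁) * c1 := by
    apply mul_right_cancel₀ hνpos.ne'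
    rw [hx1'] at q1
    linarith
  have r2 : a2 = (1 - u p * k₂) * c2 := by
    apply mul_right_cancel₀ hνpos.ne'
    rw [hx2'] at q2
    linarith
  have m1 : inner ℝ n (cross G1 G2) = (1 - u p * k₁) * (1 - u p * k₂) := by
    have s1 : inner ℝ n (cross e1 e2) = 1 := by rw [H.hc, H.h33]
    have s2 : inner ℝ n (cross e1 n) = 0 := by
      rw [inner_cross_rotate, H.c31, H.h32]
    have s3 : inner ℝ n (cross n e2) = 0 := by
      rw [inner_cross_rotate, cross_self, inner_zero_right]
    rw [hg1, hg2]
    simp only [cross_add_left, cross_smul_left, cross_add_right, cross_smul_right, inner_add_right,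
      real_inner_smul_right, s1, s2, s3, cross_self, inner_zero_right]
    ring
  refine ⟨ν, c1, c2, htilt, ?_, r1, r2, ?_, ?_, ?_⟩
  · rw [hx1', hx2'] at hsq
    linarith
  · rw [hg1]
    simp only [cross_add_left, cross_smul_left, inner_add_right, real_inner_smul_right, t1, t3, hx2']
    ring
  · rw [hg2]
    simp only [cross_add_left, cross_smul_left, inner_add_right, real_inner_smul_right, t2, t3, hx1']
    ring
  · rw [m1, hg1, hg2]
    simp only [cross_add_left, cross_smul_left, inner_add_right, real_inner_smul_right,
      real_inner_smul_left, t4, t5, t6, t7, hx1', hx2', r1, r2]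
    ring

/-- The one-form `(φ² / u) ⟨N, dG × N₂⟩`, evaluated on `v`. -/
def flux (F : Plane → Space) (u : Plane → ℝ) (ψ : Plane → Plane) (φ : Plane → ℝ) (v p : Plane) : ℝ :=
  φ p ^ 2 * (u p)⁻¹ * sheetForm F ψ v p

/-- The exterior derivative of the one-form `flux`, on the coordinate directions. -/
def divFlux (F : Plane → Space) (u : Plane → ℝ) (ψ : Plane → Plane) (φ : Plane → ℝ) (p : Plane) : ℝ :=
  pd 0 (flux F u ψ φ (EuclideanSpace.single 1 1)) p -
    pd 1 (flux F u ψ φ (EuclideanSpace.single 0 1)) p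

/-- The exterior derivative of `flux` on arbitrary directions, by the product rule. -/
theorem divFlux_eq {τ : ℝ} {u : Plane → ℝ} {ψ : Plane → Plane} {p : Plane}
    (A : IsAdmissible F h C L) (S : IsSheetFunction F C τ u ψ p) (hp : p ∈ disk) {φ : Plane → ℝ}
    (hφ : ContDiff ℝ ∞ φ) (v w : Plane) :
    (v 0 * w 1 - v 1 * w 0) * divFlux F u ψ φ p =
      (2 * φ p * fderiv ℝ φ p v * (u p)⁻¹ - φ p ^ 2 * ((u p)⁻¹ ^ 2 * fderiv ℝ u p v)) *
        sheetForm F ψ w p -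
      (2 * φ p * fderiv ℝ φ p w * (u p)⁻¹ - φ p ^ 2 * ((u p)⁻¹ ^ 2 * fderiv ℝ u p w)) *
        sheetForm F ψ v p +
      φ p ^ 2 * (u p)⁻¹ * sheetDiv F ψ p v w := by
  have hN := A.contDiffAt_normal hp
  have hβ : ∀ a, DifferentiableAt ℝ (sheetForm F ψ a) p := fun a =>
    (contDiffAt_sheetForm A.smooth hN S.smooth_param (A.contDiffAt_normal S.mem) a).differentiableAt
      (by simp)
  have hφd : DifferentiableAt ℝ φ p := hφ.contDiffAt.differentiableAt (by simp)
  have hud : DifferentiableAt ℝ u p := S.smooth_height.differentiableAt (by simp)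
  have hw : HasFDerivAt (fun x => φ x ^ 2 * (u x)⁻¹)
      ((2 * φ p * (u p)⁻¹) • fderiv ℝ φ p - (φ p ^ 2 * (u p)⁻¹ ^ 2) • fderiv ℝ u p) p := by
    have h1 := (hφd.hasFDerivAt.pow 2).mul
      ((hasDerivAt_inv S.ne).comp_hasFDerivAt p hud.hasFDerivAt)
    refine h1.congr_fderiv ?_
    ext a
    simp
    ring
  have hflux : ∀ a b, fderiv ℝ (flux F u ψ φ b) p a =
      (2 * φ p * fderiv ℝ φ p a * (u p)⁻¹ - φ p ^ 2 * ((u p)⁻¹ ^ 2 * fderiv ℝ u p a)) *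
        sheetForm F ψ b p + φ p ^ 2 * (u p)⁻¹ * fderiv ℝ (sheetForm F ψ b) p a := by
    intro a b
    have h1 : HasFDerivAt (flux F u ψ φ b) _ p := hw.mul (hβ b).hasFDerivAt
    rw [h1.fderiv]
    simp
    ring
  have hcurl := fderiv_sheetForm_sub A.smooth hN S.smooth_param (A.inj S.mem)
    (EuclideanSpace.single 0 1) (EuclideanSpace.single 1 1)
  rw [divFlux, pd, pd, hflux, hflux, sheetDiv_eq F ψ p v w, ← hcurl, sheetForm_eq F ψ p v,
    sheetForm_eq F ψ p w, clm_plane_eq (fderiv ℝ φ p) v, clm_plane_eq (fderiv ℝ φ p) w,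
    clm_plane_eq (fderiv ℝ u p) v, clm_plane_eq (fderiv ℝ u p) w]
  simp only [smul_eq_mul]
  ring

/-- The pointwise form of almost stability: the stability integrand is at most a divergence. -/
theorem stability_integrand_le {τ : ℝ} {u : Plane → ℝ} {ψ : Plane → Plane} {p : Plane}
    (A : IsAdmissible F h C L) (hC : 0 < C) (S : IsSheetFunction F C τ u ψ p) (hτ : 0 < τ)
    (hτ1 : τ ≤ 1 / 20) (hp : p ∈ disk) (hpL : ‖F p‖ < L) {φ : Plane → ℝ} (hφ : ContDiff ℝ ∞ φ) :
    (1 - 9 * τ) * (normSqA F p * φ p ^ 2 * areaDensity F p) - gradNormSq F φ p * areaDensity F p ≤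
      -(1 - 8 * τ) * divFlux F u ψ φ p := by
  obtain ⟨v₁, v₂, k₁, k₂, P⟩ := exists_isPrincipal A.smooth (A.inj hp)
  obtain ⟨ν, c₁, c₂, hν, hν1, hu1, hu2, hs1, hs2, hd⟩ := S.exists_frame A (by linarith) hp P
  have hk : k₁ ^ 2 + k₂ ^ 2 ≤ (2 * C) ^ 2 := by
    have := A.curvature_le p hp (by simpa using hpL)
    rw [P.normSq] at this
    linarith
  have hk' : ∀ k : ℝ, k ^ 2 ≤ (2 * C) ^ 2 → |u p * k| ≤ τ := by
    intro k h1
    rw [abs_mul]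
    have h2 : |k| ≤ 2 * C := abs_le_of_sq_le_sq h1 (by positivity)
    exact (mul_le_mul_of_nonneg_left h2 (abs_nonneg _)).trans S.height_le
  have h1 := hk' k₁ (by linarith [sq_nonneg k₂])
  have h2 := hk' k₂ (by linarith [sq_nonneg k₁])
  have key := young_stability (s := φ p * (u p)⁻¹) (b₁ := fderiv ℝ φ p v₁) (b₂ := fderiv ℝ φ p v₂)
    hτ hτ1 h1 h2 hν hν1
  have hdiv := divFlux_eq A S hp hφ v₁ v₂
  rw [hu1, hu2, hs1, hs2, hd] at hdiv
  have hune := S.ne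
  obtain ⟨d, hdd⟩ : ∃ d, d = v₁ 0 * v₂ 1 - v₁ 1 * v₂ 0 := ⟨_, rfl⟩
  have hdet := P.det
  have hdpos := P.det_pos
  rw [← hdd] at hdet hdpos hdiv
  have hus : u p * (φ p * (u p)⁻¹) = φ p := by field_simp
  rw [hus] at key
  have hmain : (1 - 9 * τ) * (k₁ ^ 2 + k₂ ^ 2) * φ p ^ 2 -
      (fderiv ℝ φ p v₁ ^ 2 + fderiv ℝ φ p v₂ ^ 2) ≤ -(1 - 8 * τ) * (d * divFlux F u ψ φ p) := by
    refine key.trans (le_of_eq ?_)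
    rw [hdiv]
    congr 1
    field_simp
    ring
  rw [P.normSq, P.grad]
  refine le_of_mul_le_mul_left ?_ hdpos
  calc _ = ((1 - 9 * τ) * (k₁ ^ 2 + k₂ ^ 2) * φ p ^ 2 -
      (fderiv ℝ φ p v₁ ^ 2 + fderiv ℝ φ p v₂ ^ 2)) * (d * areaDensity F p) := by ring
    _ = (1 - 9 * τ) * (k₁ ^ 2 + k₂ ^ 2) * φ p ^ 2 -
      (fderiv ℝ φ p v₁ ^ 2 + fderiv ℝ φ p v₂ ^ 2) := by rw [hdet, mul_one]
    _ ≤ _ := hmain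
    _ = _ := by ring

end Frame

/-! ### Stability of the region below a sheet -/

section Integration

open Filter Topology

variable {F : Plane → Space} {h C L : ℝ}

theorem continuous_firstForm (hF : ContDiff ℝ ∞ F) : Continuous (firstForm F) :=
  continuous_matrix fun i j => (contDiff_pd hF i).continuous.inner (contDiff_pd hF j).continuous

theorem det_firstForm_ne_zero {p : Plane} (hi : Function.Injective (fderiv ℝ F p)) :
    (firstForm F p).det ≠ 0 := by
  intro h0
  have := areaDensity_pos hi
  rw [areaDensity, h0, Real.sqrt_zero] at this
  exact lt_irrefl _ this

theorem continuousOn_inv_firstForm (A : IsAdmissible F h C L) :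
    ContinuousOn (fun p => (firstForm F p)⁻¹) disk := by
  have h1 := continuous_firstForm A.smooth
  have h2 : ContinuousOn (fun p => ((firstForm F p).det)⁻¹ • (firstForm F p).adjugate) disk :=
    (h1.matrix_det.continuousOn.inv₀ fun p hp => det_firstForm_ne_zero (A.inj hp)).smul
      h1.matrix_adjugate.continuousOn
  refine h2.congr fun p _ => ?_
  rw [Matrix.inv_def, Ring.inverse_eq_inv']

theorem continuousOn_normSqA (A : IsAdmissible F h C L) : ContinuousOn (normSqA F) disk := by
  have h1 : ContinuousOn (secondForm F) disk := by
    refine continuousOn_pi.mpr fun i => continuousOn_pi.mpr fun j => ?_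
    exact (contDiff_pd (contDiff_pd A.smooth j) i).continuous.continuousOn.inner
      fun p hp => (A.contDiffAt_normal hp).continuousAt.continuousWithinAt
  have hmul : Continuous fun x : Matrix (Fin 2) (Fin 2) ℝ × Matrix (Fin 2) (Fin 2) ℝ => x.1 * x.2 :=
    continuous_fst.matrix_mul continuous_snd
  have h2 : ContinuousOn (shapeOperator F) disk :=
    hmul.comp_continuousOn ((continuousOn_inv_firstForm A).prodMk h1)
  exact (continuous_id.matrix_trace).comp_continuousOn (hmul.comp_continuousOn (h2.prodMk h2))

theorem continuousOn_gradNormSq (A : IsAdmissible F h C L) {φ : Plane → ℝ} (hφ : ContDiff ℝ ∞ φ) :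
    ContinuousOn (gradNormSq F φ) disk := by
  have h1 : Continuous fun p => (fun i => pd i φ p : Fin 2 → ℝ) :=
    continuous_pi fun i => (contDiff_pd hφ i).continuous
  have hmul : Continuous fun x : Matrix (Fin 2) (Fin 2) ℝ × (Fin 2 → ℝ) => x.2 ⬝ᵥ (x.1 *ᵥ x.2) :=
    continuous_snd.dotProduct (continuous_fst.matrix_mulVec continuous_snd)
  exact hmul.comp_continuousOn ((continuousOn_inv_firstForm A).prodMk h1.continuousOn)

theorem continuous_areaDensity (hF : ContDiff ℝ ∞ F) : Continuous (areaDensity F) :=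
  (continuous_firstForm hF).matrix_det.sqrt

theorem integral_fderiv_eq_zero {f : Plane → ℝ} (hf : ContDiff ℝ ∞ f) (hc : HasCompactSupport f)
    (v : Plane) : Integrable (fun p => fderiv ℝ f p v) ∧ ∫ p, fderiv ℝ f p v = 0 := by
  have hi : Integrable (fun p => fderiv ℝ f p v) :=
    ((hf.continuous_fderiv (by simp)).clm_apply continuous_const).integrable_of_hasCompactSupport
      (hc.fderiv_apply ℝ v)
  refine ⟨hi, ?_⟩
  have := integral_mul_fderiv_eq_neg_fderiv_mul_of_integrable (μ := volume) (f := fun _ : Plane => (1 : ℝ))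
    (g := f) (v := v) (by simp) (by simpa using hi)
    (by simpa using hf.continuous.integrable_of_hasCompactSupport hc)
    (fun _ _ => differentiableAt_const _) (fun p _ => hf.contDiffAt.differentiableAt (by simp))
  simpa using this

theorem flux_eventuallyEq_zero {u : Plane → ℝ} {ψ : Plane → Plane} {φ : Plane → ℝ} {p : Plane}
    (hp : p ∉ tsupport φ) (v : Plane) : flux F u ψ φ v =ᶠ[𝓝 p] 0 := by
  filter_upwards [notMem_tsupport_iff_eventuallyEq.mp hp] with x hx
  simp [flux, hx]

theorem contDiff_flux {τ : ℝ} {u : Plane → ℝ} {ψ : Plane → Plane} {φ : Plane → ℝ} {Ω : Set Plane}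
    (A : IsAdmissible F h C L) (hS : ∀ p ∈ Ω, IsSheetFunction F C τ u ψ p) (hΩ : Ω ⊆ disk)
    (hφ : ContDiff ℝ ∞ φ) (hsupp : tsupport φ ⊆ Ω) (v : Plane) : ContDiff ℝ ∞ (flux F u ψ φ v) := by
  rw [contDiff_iff_contDiffAt]
  intro p
  by_cases hp : p ∈ tsupport φ
  · have S := hS p (hsupp hp)
    have h1 := contDiffAt_sheetForm A.smooth (A.contDiffAt_normal (hΩ (hsupp hp))) S.smooth_param
      (A.contDiffAt_normal S.mem) v
    exact ((hφ.contDiffAt.pow 2).mul (S.smooth_height.inv S.ne)).mul h1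
  · exact contDiffAt_const.congr_of_eventuallyEq (flux_eventuallyEq_zero hp v)

theorem hasCompactSupport_flux {u : Plane → ℝ} {ψ : Plane → Plane} {φ : Plane → ℝ}
    (hφ : HasCompactSupport φ) (v : Plane) : HasCompactSupport (flux F u ψ φ v) :=
  hφ.mono' fun p hp => by
    by_contra hcon
    exact hp (flux_eventuallyEq_zero hcon v).self_of_nhds

/-- A region over which there is a close sheet is almost stable: the divergence of the flux
integrates to zero. -/
theorem isDeltaStable_of_isSheetFunction (A : IsAdmissible F h C L) (hC : 0 < C) {τ : ℝ} (hτ : 0 < τ)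
    (hτ1 : τ ≤ 1 / 20) {Ω : Set Plane} (hΩ : ∀ p ∈ Ω, p ∈ disk ∧ ‖F p‖ < L) {u : Plane → ℝ}
    {ψ : Plane → Plane} (hS : ∀ p ∈ Ω, IsSheetFunction F C τ u ψ p) : IsDeltaStable F Ω (9 * τ) := by
  intro φ hφ hφc hsupp
  have hΩd : Ω ⊆ disk := fun p hp => (hΩ p hp).1
  have hcd := fun v => contDiff_flux A hS hΩd hφ hsupp v
  have hi := fun v w => integral_fderiv_eq_zero (hcd v) (hasCompactSupport_flux hφc v) w
  have hDi : Integrable (divFlux F u ψ φ) := (hi _ _).1.sub (hi _ _).1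
  have hD0 : ∫ p, divFlux F u ψ φ p = 0 := by
    have := integral_sub (hi (EuclideanSpace.single 1 1) (EuclideanSpace.single 0 1)).1
      (hi (EuclideanSpace.single 0 1) (EuclideanSpace.single 1 1)).1
    rw [(hi _ _).2, (hi _ _).2, sub_zero] at this
    exact this
  have hoff : ∀ p ∉ tsupport φ, divFlux F u ψ φ p = 0 := by
    intro p hp
    simp only [divFlux, pd, (flux_eventuallyEq_zero hp _).fderiv_eq]
    simp
  have hDd : ∫ p in disk, divFlux F u ψ φ p = 0 := by
    rw [setIntegral_eq_integral_of_forall_compl_eq_zero fun p hp =>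
      hoff p fun hp' => hp (hΩd (hsupp hp')), hD0]
  have hcomp : IsCompact disk := isCompact_closedBall 0 1
  have hA : IntegrableOn (fun p => normSqA F p * φ p ^ 2 * areaDensity F p) disk :=
    ContinuousOn.integrableOn_compact hcomp (((continuousOn_normSqA A).mul
      (hφ.continuous.pow 2).continuousOn).mul (continuous_areaDensity A.smooth).continuousOn)
  have hG : IntegrableOn (fun p => gradNormSq F φ p * areaDensity F p) disk :=
    ContinuousOn.integrableOn_compact hcomp ((continuousOn_gradNormSq A hφ).mul
      (continuous_areaDensity A.smooth).continuousOn)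
  have hle : ∫ p in disk, ((1 - 9 * τ) * (normSqA F p * φ p ^ 2 * areaDensity F p) -
      gradNormSq F φ p * areaDensity F p) ≤ ∫ p in disk, -(1 - 8 * τ) * divFlux F u ψ φ p := by
    refine setIntegral_mono_on ((hA.const_mul _).sub hG) (hDi.integrableOn.const_mul _)
      measurableSet_closedBall fun p hp => ?_
    by_cases hps : p ∈ tsupport φ
    · have hpΩ := hΩ p (hsupp hps)
      exact stability_integrand_le A hC (hS p (hsupp hps)) hτ hτ1 hpΩ.1 hpΩ.2 hφ
    · have h1 := notMem_tsupport_iff_eventuallyEq.mp hps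
      have h2 : ∀ i, pd i φ p = 0 := fun i => by
        rw [pd, h1.fderiv_eq]
        simp
      rw [hoff p hps, h1.self_of_nhds]
      simp [gradNormSq, h2]
  rw [integral_sub (hA.const_mul _) hG, integral_const_mul, integral_const_mul, hDd, mul_zero] at hle
  exact sub_nonpos.mp hle

/-- Stability improves as `δ` decreases, since `∫ |A|² φ²` is nonnegative. -/
theorem IsDeltaStable.mono (A : IsAdmissible F h C L) {Ω : Set Plane} {δ δ' : ℝ}
    (hS : IsDeltaStable F Ω δ) (hδ : δ ≤ δ') : IsDeltaStable F Ω δ' := by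
  intro φ hφ hφc hsupp
  refine le_trans ?_ (hS φ hφ hφc hsupp)
  refine mul_le_mul_of_nonneg_right (by linarith) ?_
  refine setIntegral_nonneg measurableSet_closedBall fun p hp => ?_
  obtain ⟨v₁, v₂, k₁, k₂, P⟩ := exists_isPrincipal A.smooth (A.inj hp)
  beta_reduce
  rw [P.normSq]
  have := (areaDensity_pos (A.inj hp)).le
  positivity

end Integration

end CMCDisk

end

theorem mainTheorem6 (C L ε : ℝ) (hC : 0 < C) (hL : 1 < L) (hε : 0 < ε)
    (l : ℝ) (hl : 0 < l) (hlL : l < L - (1 + ε)) :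
    ∃ C_l : ℝ, 0 < C_l ∧ ∀ δ : ℝ, 0 < δ → ∃ α_lδ : ℝ, 0 < α_lδ ∧
      ∀ (h : ℝ) (F : CMCDisk.Plane → CMCDisk.Space), CMCDisk.IsAdmissible F h C L →
        ∀ α : ℝ, α < α_lδ →
          ∀ p ∈ CMCDisk.disk, ∀ q ∈ CMCDisk.disk,
            F p ∈ CMCDisk.unitComponent F → F q ∈ CMCDisk.unitComponent F →
            dist (F p) (F q) ≤ α →
            ENNReal.ofReal C_l ≤ CMCDisk.intrinsicDist F p q →
            0 < inner ℝ (CMCDisk.unitNormal F p) (CMCDisk.unitNormal F q) →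
            CMCDisk.IsDeltaStable F (CMCDisk.geodesicBall F p l) δ := by
  -- `l + 1 + 2ρ < L`, and `r` is small for `ρ / 2` too: the tilt bound is needed on the slightly larger
  -- ball of radius `L - ρ`, since the lowest sheet is differentiated at the points of the geodesic ball.
  obtain ⟨ρ, hρ⟩ : ∃ ρ, ρ = ε / 2 := ⟨_, rfl⟩
  have hρpos : 0 < ρ := by linarith
  obtain ⟨r, hr⟩ : ∃ r, r = min (1 / (60 * C)) (ρ / 4) := ⟨_, rfl⟩
  have hrpos : 0 < r := by rw [hr]; positivity
  have hr1 : 3 * C * r ≤ 1 / 20 := by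
    have : r ≤ 1 / (60 * C) := by rw [hr]; exact min_le_left _ _
    calc 3 * C * r ≤ 3 * C * (1 / (60 * C)) := by gcongr
      _ = 1 / 20 := by field_simp; norm_num
  have hr2 : r ≤ ρ / 4 := by rw [hr]; exact min_le_right _ _
  have hsm : CMCDisk.IsSmallRadius C ρ r := ⟨hrpos, hr1, by linarith⟩
  have hsm' : CMCDisk.IsSmallRadius C (ρ / 2) r := ⟨hrpos, hr1, by linarith⟩
  refine ⟨4 * r, by positivity, fun δ hδ => ?_⟩
  obtain ⟨τ, hτ⟩ : ∃ τ, τ = min (1 / 20) (δ / 9) := ⟨_, rfl⟩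
  have hτpos : 0 < τ := by rw [hτ]; positivity
  have hτ1 : τ ≤ 1 / 20 := by rw [hτ]; exact min_le_left _ _
  have hτδ : 9 * τ ≤ δ := by
    have : τ ≤ δ / 9 := by rw [hτ]; exact min_le_right _ _
    linarith
  obtain ⟨α₁, hα₁, htilt⟩ := CMCDisk.exists_sheet_tilt hC hsm' hτpos (by linarith)
  obtain ⟨β, hβ⟩ : ∃ β, β = min α₁ ρ := ⟨_, rfl⟩
  have hβpos : 0 < β := by rw [hβ]; positivity
  -- the height below which the sheets are close to the order `τ`
  obtain ⟨θ, hθ⟩ : ∃ θ, θ = min (β / 2) (τ / (2 * C)) := ⟨_, rfl⟩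
  have hθpos : 0 < θ := by rw [hθ]; positivity
  have hθβ : θ < β := by
    have : θ ≤ β / 2 := by rw [hθ]; exact min_le_left _ _
    linarith
  have hθτ : θ * (2 * C) ≤ τ := by
    have : θ ≤ τ / (2 * C) := by rw [hθ]; exact min_le_right _ _
    rwa [le_div_iff₀ (by positivity)] at this
  obtain ⟨α₂, hα₂, hsheets⟩ := CMCDisk.exists_sheets_over_geodesicBall hC hsm hl hθpos
  refine ⟨α₂, hα₂, fun h F A α hα p hp q hq hpc _ hd hfar hN => ?_⟩
  have hpn : ‖F p‖ < 1 := by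
    have := connectedComponentIn_subset _ _ hpc
    simpa using this.2
  obtain ⟨s, -, hs⟩ := hsheets A (by linarith) hp hq hpn (hd.trans hα.le) hfar hN
  have hT : CMCDisk.HasTiltBound F s (L - ρ) β τ := by
    intro p' q' t' hp' hpM S ht
    exact htilt A hp' (by linarith) S (ht.trans (by rw [hβ]; exact min_le_left _ _))
  have hβρ : β ≤ ρ := by rw [hβ]; exact min_le_right _ _
  have hττ : τ ^ 2 ≤ τ := by
    rw [pow_two]
    exact mul_le_of_le_one_right hτpos.le (by linarith)
  have hΩ : ∀ p' ∈ CMCDisk.geodesicBall F p l, p' ∈ CMCDisk.disk ∧ ‖F p'‖ < L - ρ ∧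
      ∃ q' t', CMCDisk.IsSheetAt F s p' q' t' ∧ |t'| ≤ θ := fun p' hp' =>
    ⟨hp'.1, by have := (hs p' hp').1; linarith, (hs p' hp').2⟩
  obtain ⟨u, ψ, hS⟩ := CMCDisk.exists_isSheetFunction A hT (by linarith) hττ hθβ hθτ hC (by linarith) hΩ
  exact (CMCDisk.isDeltaStable_of_isSheetFunction A hC hτpos hτ1
    (fun p' hp' => ⟨hp'.1, by have := (hΩ p' hp').2.1; linarith⟩) hS).mono A hτδ
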